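/- Let $n\ge 3$ and $\lambda>n-1$. For $z\in\mathbb C^n$ write $|z|^2=\sum_j|z_j|^2$, $z^\top z=\sum_j z_j^2$, $\Delta(z)=1-2|z|^2+|z^\top z|^2$, and let $D=D_n^{IV}=\{z\in\mathbb C^n:\ |z|<1,\ 2|z|^2<1+|z^\top z|^2\}$ be the Cartan domain of type IV. Let $v_\lambda$ be the probability measure on $D$ proportional to $\Delta(z)^{\lambda-n}\,dv(z)$, where $dv$ is Lebesgue measure; let $\mathcal A^2_\lambda(D)$ be the closed subspace of $L^2(D,v_\lambda)$ consisting of the holomorphic functions, $B_\lambda$ the orthogonal projection of $L^2(D,v_\lambda)$ onto it, and, for $a\in L^\infty(D)$, let $T_a=T^{(\lambda)}_a\in\mathcal B(\mathcal A^2_\lambda(D))$, $T_a(h)=B_\lambda(ah)$, be the Toeplitz operator with symbol $a$. Equip $D$ with the symplectic form $\omega=i\sum_{j,k}g_{jk}\,dz_j\wedge d\overline z_k$ of its Bergman metric, where $g_{jk}=\frac1{2n}\frac{\partial^2}{\partial z_j\partial\overline z_k}\log K(z,z)$ and $K(z,w)=\big(1-2z^\top\overline w+(z^\top z)\overline{(w^\top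 w)}\big)^{-n}$. Let $\mathrm{SO}(2)$, identified with the unit circle $\mathbb T$, act on $D$ by $(t,z)\mapsto tz$, and identify its Lie algebra and the dual of the latter with $\mathbb R$ so that $X\in\mathbb R$ has exponential $e^{iX}$ and induces the vector field $X^\sharp_z=\frac{d}{dr}\big|_{r=0}e^{irX}z$. A moment map for this action is a smooth function $\mu:D\to\mathbb R$ with $\mu(tz)=\mu(z)$ for all $t\in\mathbb T$, $z\in D$, and $d(X\mu)=\omega(X^\sharp,\cdot)$ for all $X\in\mathbb R$. For $k\in\mathbb N=\{0,1,2,\dots\}$ let $\mathcal H^{k}(\mathbb C^n)$ be the space of homogeneous holomorphic polynomials $p$ of degree $k$ on $\mathbb C^n$ with $\sum_j\partial^2p/\partial z_j^2=0$. Then the following hold. (0) The function $$\mu^{\mathrm{SO}(2)}(z)=\frac{|z^\top z|^2-|z|^2}{1+|z^\top z|^2-2|z|^2}$$ is a moment map for the $\mathrm{SO}(2)$-action on $D$. (1) There is a Hilbert direct sum decomposition $$\mathcal A^2_\lambda(D)=\bigoplus_{(k_1,k_2)\in\mathbb N^2}\mathcal H^{k_1}(\mathbb C^n)(z^\top z)^{k_2}.$$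 Moreover, for every moment map $\mu$ of the $\mathrm{SO}(2)$-action (in particular for $\mu=\mu^{\mathrm{SO}(2)}$): (2) The unital $C^*$-algebra generated by all Toeplitz operators $T^{(\lambda)}_a$ whose symbol $a\in L^\infty(D)$ is of the form $a=f\circ\mu$ almost everywhere, with $f:\mathbb R\to\mathbb C$ measurable, is commutative. (3) If $f:\mathbb R\to\mathbb C$ is measurable and $a=f\circ\mu$ is essentially bounded on $D$, then $T^{(\lambda)}_a$ maps each summand $\mathcal H^{k_1}(\mathbb C^n)(z^\top z)^{k_2}$ into itself, and there are complex numbers $c_{k_1,k_2}(f,\lambda)$, $(k_1,k_2)\in\mathbb N^2$, such that $T^{(\lambda)}_a$ acts on this summand as $c_{k_1,k_2}(f,\lambda)$ times the identity, for every $(k_1,k_2)\in\mathbb N^2$. -/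

import Mathlib

open MeasureTheory Set Filter Topology
open scoped ENNReal ComplexConjugate

noncomputable section

namespace CartanIV

/-! ## The domain and the weighted measures -/

/-- The bilinear product `zᵀ w` on `ℂⁿ`. -/
def dot {n : ℕ} (z w : Fin n → ℂ) : ℂ := ∑ j, z j * w j

/-- The square `|z|²` of the Euclidean norm on `ℂⁿ`. -/
def absSq {n : ℕ} (z : Fin n → ℂ) : ℝ := ∑ j, ‖z j‖ ^ 2

/-- The Cartan domain of type IV: all `z ∈ ℂⁿ` with `|z| < 1` and `2 |z|² < 1 + |zᵀ z|²`. -/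
def domain (n : ℕ) : Set (Fin n → ℂ) :=
  {z | absSq z < 1 ∧ 2 * absSq z < 1 + ‖dot z z‖ ^ 2}

/-- `Δ(z) = 1 - 2 |z|² + |zᵀ z|²`. -/
def Delta {n : ℕ} (z : Fin n → ℂ) : ℝ := 1 - 2 * absSq z + ‖dot z z‖ ^ 2

/-- The measure `Δ(z)^(λ - n) dv(z)` on the domain, `dv` being Lebesgue measure on `ℂⁿ = ℝ²ⁿ`. -/
def weightedMeasure (n : ℕ) (lam : ℝ) : Measure (Fin n → ℂ) :=
  (volume.restrict (domain n)).withDensity fun z => ENNReal.ofReal (Delta z ^ (lam - n))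

/-- The measure `v_λ`: the previous one divided by its total mass, so that `v_λ` has total mass
one (any normalisation of Lebesgue measure cancels). It is carried by the domain. -/
def bergmanMeasure (n : ℕ) (lam : ℝ) : Measure (Fin n → ℂ) :=
  (weightedMeasure n lam univ)⁻¹ • weightedMeasure n lam

/-! ## Square integrable holomorphic functions form a closed subspace -/

theorem volume_rot (n : ℕ) (c : Circle) :
    MeasurePreserving (fun w : Fin n → ℂ => (c : ℂ) • w) volume volume := by
  have h : ∀ _ : Fin n, MeasurePreserving (fun x : ℂ => (c : ℂ) * x) volume volume := fun _ =>
    (rotation c).measurePreserving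
  exact volume_preserving_pi h

theorem mean_value_le {n : ℕ} {z : Fin n → ℂ} {r : ℝ} {g : (Fin n → ℂ) → ℂ}
    (hg : DifferentiableOn ℂ g (Metric.ball z r)) :
    ‖g z‖ₑ * volume (Metric.ball z r) ≤ ∫⁻ w in Metric.ball z r, ‖g w‖ₑ := by
  classical
  set H : (Fin n → ℂ) → ℝ≥0∞ := (Metric.ball (0 : Fin n → ℂ) r).indicator (fun w => ‖g (z + w)‖ₑ)
    with hH
  have hmap : MapsTo (fun w => z + w) (Metric.ball (0 : Fin n → ℂ) r) (Metric.ball z r) := by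
    intro w hw
    simpa [Metric.mem_ball, dist_eq_norm] using hw
  have hHm : Measurable H := by
    have hc : ContinuousOn (fun w => ‖g (z + w)‖ₑ) (Metric.ball (0 : Fin n → ℂ) r) :=
      (hg.continuousOn.comp (by fun_prop) hmap).enorm
    have := hc.measurable_piecewise (g := fun _ => (0 : ℝ≥0∞)) continuousOn_const
      measurableSet_ball
    rw [hH, ← Set.piecewise_eq_indicator]
    exact this
  have hint : ∫⁻ w, H w = ∫⁻ w in Metric.ball z r, ‖g w‖ₑ := by
    rw [← lintegral_indicator measurableSet_ball,
      ← lintegral_add_left_eq_self (μ := volume) ((Metric.ball z r).indicator _) z]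
    refine lintegral_congr fun w => ?_
    by_cases hw : w ∈ Metric.ball (0 : Fin n → ℂ) r
    · rw [hH, indicator_of_mem hw, indicator_of_mem (hmap hw)]
    · rw [hH, indicator_of_notMem hw, indicator_of_notMem]
      simpa [Metric.mem_ball, dist_eq_norm] using hw
  have hvol : volume (Metric.ball z r) = volume (Metric.ball (0 : Fin n → ℂ) r) := by
    have := measure_preimage_add volume (-z) (Metric.ball (0 : Fin n → ℂ) r)
    rw [← this]
    congr 1
    ext w
    simp [Metric.mem_ball, dist_eq_norm, neg_add_eq_sub]
  -- one variable mean value inequality along circles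
  have hpt : ∀ w ∈ Metric.ball (0 : Fin n → ℂ) r,
      ENNReal.ofReal (2 * Real.pi) * ‖g z‖ₑ
        ≤ ∫⁻ θ in Ioc 0 (2 * Real.pi), H ((Circle.exp θ : ℂ) • w) := by
    intro w hw
    have hw' : ‖w‖ < r := by simpa using hw
    have hsub : MapsTo (fun ζ : ℂ => z + ζ • w) (Metric.closedBall 0 1) (Metric.ball z r) := by
      intro ζ hζ
      have hζ' : ‖ζ‖ ≤ 1 := by simpa using hζ
      simp only [Metric.mem_ball, dist_eq_norm, add_sub_cancel_left, norm_smul]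
      nlinarith [norm_nonneg w]
    have hdc : DiffContOnCl ℂ (fun ζ : ℂ => g (z + ζ • w)) (Metric.ball 0 |1|) := by
      rw [abs_one]
      refine DifferentiableOn.diffContOnCl ?_
      rw [closure_ball _ one_ne_zero]
      exact hg.comp (by fun_prop) hsub
    have hav := hdc.circleAverage
    have hav2 : (2 * Real.pi : ℝ) • g z
        = ∫ θ in Ioc 0 (2 * Real.pi), g (z + (Circle.exp θ : ℂ) • w) := by
      rw [Real.circleAverage_def, zero_smul, add_zero] at hav
      rw [← hav, smul_smul, mul_inv_cancel₀ (by positivity), one_smul,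
        intervalIntegral.integral_of_le (by positivity)]
      simp [circleMap, Circle.coe_exp]
    calc ENNReal.ofReal (2 * Real.pi) * ‖g z‖ₑ = ‖(2 * Real.pi : ℝ) • g z‖ₑ := by
          rw [enorm_smul, Real.enorm_eq_ofReal (by positivity)]
      _ ≤ ∫⁻ θ in Ioc 0 (2 * Real.pi), ‖g (z + (Circle.exp θ : ℂ) • w)‖ₑ := by
          rw [hav2]; exact enorm_integral_le_lintegral_enorm _
      _ = _ := by
          refine lintegral_congr fun θ => ?_
          rw [hH, indicator_of_mem]
          simpa [norm_smul] using hw'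
  have hexp : Measurable (fun θ : ℝ => (Circle.exp θ : ℂ)) := by fun_prop
  have hjm : Measurable (fun p : (Fin n → ℂ) × ℝ => H ((Circle.exp p.2 : ℂ) • p.1)) := by
    refine hHm.comp ?_
    exact (hexp.comp measurable_snd).smul measurable_fst
  have htot : ENNReal.ofReal (2 * Real.pi) * (‖g z‖ₑ * volume (Metric.ball (0 : Fin n → ℂ) r))
      ≤ ENNReal.ofReal (2 * Real.pi) * ∫⁻ w, H w := by
    calc _ = ∫⁻ _ in Metric.ball (0 : Fin n → ℂ) r, ENNReal.ofReal (2 * Real.pi) * ‖g z‖ₑ := by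
          rw [setLIntegral_const, mul_assoc]
      _ ≤ ∫⁻ w in Metric.ball (0 : Fin n → ℂ) r,
            ∫⁻ θ in Ioc 0 (2 * Real.pi), H ((Circle.exp θ : ℂ) • w) :=
          setLIntegral_mono' measurableSet_ball hpt
      _ ≤ ∫⁻ w, ∫⁻ θ in Ioc 0 (2 * Real.pi), H ((Circle.exp θ : ℂ) • w) :=
          setLIntegral_le_lintegral _ _
      _ = ∫⁻ θ in Ioc 0 (2 * Real.pi), ∫⁻ w, H ((Circle.exp θ : ℂ) • w) :=
          lintegral_lintegral_swap hjm.aemeasurable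
      _ = ∫⁻ _ in Ioc 0 (2 * Real.pi), ∫⁻ w, H w := by
          refine lintegral_congr fun θ => ?_
          exact (volume_rot n (Circle.exp θ)).lintegral_comp hHm
      _ = _ := by
          rw [setLIntegral_const, Real.volume_Ioc, sub_zero, mul_comm]
  rw [hvol, ← hint]
  exact (ENNReal.mul_le_mul_iff_right (by simp [Real.pi_pos]) ENNReal.ofReal_ne_top).1 htot

theorem eval_le {n : ℕ} {U : Set (Fin n → ℂ)} {ν : Measure (Fin n → ℂ)} {z : Fin n → ℂ} {r : ℝ}
    (hr : 0 < r) (hzU : Metric.ball z r ⊆ U) {C : ℝ≥0∞} (hC : C ≠ ⊤)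
    (hCν : volume.restrict (Metric.ball z r) ≤ C • ν) :
    ∃ K : ℝ, 0 ≤ K ∧ ∀ g : (Fin n → ℂ) → ℂ, DifferentiableOn ℂ g U → MemLp g 2 ν →
      ∀ x ∈ Metric.ball z (r / 2), ‖g x‖ ≤ K * (eLpNorm g 2 ν).toReal := by
  set V := volume (Metric.ball (0 : Fin n → ℂ) (r / 2)) with hV
  have hV0 : V ≠ 0 := (Metric.measure_ball_pos _ _ (by positivity)).ne'
  have hVt : V ≠ ⊤ := measure_ball_lt_top.ne
  set K' : ℝ≥0∞ := C ^ (1 / 2 : ℝ) * V ^ (1 / 2 : ℝ) / V with hK'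
  have hK't : K' ≠ ⊤ := by
    refine ENNReal.div_ne_top (ENNReal.mul_ne_top ?_ ?_) hV0
    · exact ENNReal.rpow_ne_top_of_nonneg (by norm_num) hC
    · exact ENNReal.rpow_ne_top_of_nonneg (by norm_num) hVt
  refine ⟨K'.toReal, ENNReal.toReal_nonneg, fun g hg hgν x hx => ?_⟩
  have hsub : Metric.ball x (r / 2) ⊆ Metric.ball z r :=
    Metric.ball_subset_ball' (by rw [Metric.mem_ball] at hx; linarith)
  have hvol : volume (Metric.ball x (r / 2)) = V := by
    have := measure_preimage_add volume (-x) (Metric.ball (0 : Fin n → ℂ) (r / 2))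
    rw [hV, ← this]
    congr 1
    ext w
    simp [Metric.mem_ball, dist_eq_norm, neg_add_eq_sub]
  have hg' : DifferentiableOn ℂ g (Metric.ball x (r / 2)) := hg.mono (hsub.trans hzU)
  have h1 := mean_value_le hg'
  rw [hvol] at h1
  have h2 : ∫⁻ w in Metric.ball x (r / 2), ‖g w‖ₑ ≤ C ^ (1 / 2 : ℝ) * eLpNorm g 2 ν * V ^ (1 / 2 : ℝ) := by
    rw [← eLpNorm_one_eq_lintegral_enorm]
    have h3 := eLpNorm_le_eLpNorm_mul_rpow_measure_univ
      (μ := volume.restrict (Metric.ball x (r / 2))) (f := g) (p := 1) (q := 2) (by norm_num)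
      (hg'.continuousOn.aestronglyMeasurable measurableSet_ball)
    rw [Measure.restrict_apply_univ, hvol] at h3
    have h4 : eLpNorm g 2 (volume.restrict (Metric.ball x (r / 2)))
        ≤ C ^ (1 / 2 : ℝ) * eLpNorm g 2 ν := by
      calc _ ≤ eLpNorm g 2 (C • ν) :=
            eLpNorm_mono_measure _ ((Measure.restrict_mono hsub le_rfl).trans hCν)
        _ ≤ _ := by
            rw [eLpNorm_smul_measure_of_ne_top (by norm_num)]
            simp
    refine h3.trans ?_
    have h5 : (1 / (1 : ℝ≥0∞).toReal - 1 / (2 : ℝ≥0∞).toReal) = (1 / 2 : ℝ) := by norm_num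
    rw [h5]
    gcongr
  have h6 : ‖g x‖ₑ ≤ K' * eLpNorm g 2 ν := by
    have := h1.trans h2
    rw [hK', ENNReal.div_eq_inv_mul]
    calc ‖g x‖ₑ ≤ (C ^ (1 / 2 : ℝ) * eLpNorm g 2 ν * V ^ (1 / 2 : ℝ)) / V :=
          (ENNReal.le_div_iff_mul_le (Or.inl hV0) (Or.inl hVt)).2 this
      _ = _ := by rw [ENNReal.div_eq_inv_mul]; ring
  rw [← ENNReal.toReal_mul, ← toReal_enorm]
  exact ENNReal.toReal_mono (ENNReal.mul_ne_top hK't hgν.eLpNorm_ne_top) h6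

/-- The space of classes of square integrable functions that are holomorphic on `U`. -/
def holoL2 {n : ℕ} (U : Set (Fin n → ℂ)) (ν : Measure (Fin n → ℂ)) : Submodule ℂ (Lp ℂ 2 ν) where
  carrier := {F | ∃ g : (Fin n → ℂ) → ℂ, DifferentiableOn ℂ g U ∧ F =ᵐ[ν] g}
  zero_mem' := ⟨0, differentiableOn_const 0, Lp.coeFn_zero ℂ 2 ν⟩
  add_mem' := by
    rintro F G ⟨f, hf, hF⟩ ⟨g, hg, hG⟩
    exact ⟨f + g, hf.add hg, (Lp.coeFn_add F G).trans (hF.add hG)⟩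
  smul_mem' := by
    rintro c F ⟨f, hf, hF⟩
    exact ⟨c • f, hf.const_smul c, (Lp.coeFn_smul c F).trans (hF.const_smul c)⟩

theorem isClosed_holoL2 {n : ℕ} {U : Set (Fin n → ℂ)} {ν : Measure (Fin n → ℂ)}
    (hU : ∀ᵐ z ∂ν, z ∈ U)
    (hloc : ∀ z ∈ U, ∃ r > 0, Metric.ball z r ⊆ U ∧
      ∃ C : ℝ≥0∞, C ≠ ⊤ ∧ volume.restrict (Metric.ball z r) ≤ C • ν) :
    IsClosed (holoL2 U ν : Set (Lp ℂ 2 ν)) := by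
  refine IsSeqClosed.isClosed ?_
  intro F F₀ hF hlim
  choose g hg hFg using hF
  have hmem : ∀ k, MemLp (g k) 2 ν := fun k => (memLp_congr_ae (hFg k)).1 (Lp.memLp (F k))
  have hnorm : ∀ k l, (eLpNorm (g k - g l) 2 ν).toReal = ‖F k - F l‖ := by
    intro k l
    rw [Lp.norm_def]
    congr 1
    exact eLpNorm_congr_ae (((Lp.coeFn_sub _ _).trans ((hFg k).sub (hFg l))).symm)
  have hcau : ∀ ε > 0, ∃ N, ∀ k ≥ N, ∀ l ≥ N, ‖F k - F l‖ < ε := by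
    simpa [dist_eq_norm] using Metric.cauchySeq_iff.1 hlim.cauchySeq
  -- uniform estimates for the functions and their derivatives
  have hunif : ∀ z ∈ U, ∃ ρ > 0, ∃ K : ℝ, 0 < K ∧ Metric.ball z ρ ⊆ U ∧
      (∀ k l, ∀ x ∈ Metric.ball z ρ, ‖g k x - g l x‖ ≤ K * ‖F k - F l‖) ∧
      (∀ k l, ∀ x ∈ Metric.ball z ρ,
        ‖fderiv ℂ (g k) x - fderiv ℂ (g l) x‖ ≤ K * ‖F k - F l‖) := by
    intro z hz
    obtain ⟨r, hr, hrU, C, hC, hCν⟩ := hloc z hz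
    obtain ⟨K, hK0, hK⟩ := eval_le hr hrU hC hCν
    have hb : ∀ k l, ∀ x ∈ Metric.ball z (r / 2), ‖g k x - g l x‖ ≤ K * ‖F k - F l‖ := by
      intro k l x hx
      rw [← hnorm]
      exact hK (g k - g l) ((hg k).sub (hg l)) ((hmem k).sub (hmem l)) x hx
    have hsub1 : Metric.ball z (r / 2) ⊆ U :=
      (Metric.ball_subset_ball (by linarith)).trans hrU
    have hsub2 : Metric.ball z (r / 4) ⊆ Metric.ball z (r / 2) :=
      Metric.ball_subset_ball (by linarith)
    refine ⟨r / 4, by positivity, K + 2 * K / (r / 4) + 1, by positivity, hsub2.trans hsub1, ?_, ?_⟩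
    · intro k l x hx
      refine (hb k l x (hsub2 hx)).trans ?_
      gcongr
      have : 0 ≤ 2 * K / (r / 4) := by positivity
      linarith
    · intro k l x hx
      have hsub3 : Metric.ball x (r / 4) ⊆ Metric.ball z (r / 2) :=
        Metric.ball_subset_ball' (by rw [Metric.mem_ball] at hx; linarith)
      have hd : ∀ k, DifferentiableAt ℂ (g k) x := fun k =>
        (hg k).differentiableAt (mem_of_superset (Metric.ball_mem_nhds x (by positivity))
          (hsub3.trans hsub1))
      have hmaps : MapsTo (g k - g l) (Metric.ball x (r / 4))
          (Metric.closedBall ((g k - g l) x) (2 * K * ‖F k - F l‖)) := by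
        intro y hy
        have h1 := hb k l y (hsub3 hy)
        have h2 := hb k l x (hsub2 hx)
        rw [Metric.mem_closedBall, dist_eq_norm]
        calc _ ≤ ‖(g k - g l) y‖ + ‖(g k - g l) x‖ := norm_sub_le _ _
          _ ≤ K * ‖F k - F l‖ + K * ‖F k - F l‖ := add_le_add h1 h2
          _ = _ := by ring
      have h3 := Complex.norm_fderiv_le_div_of_mapsTo_ball
        (((hg k).sub (hg l)).mono (hsub3.trans hsub1)) hmaps (by positivity)
      rw [fderiv_sub (hd k) (hd l)] at h3
      refine h3.trans ?_
      rw [mul_div_right_comm]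
      gcongr
      linarith
  -- the pointwise limit
  have hptc : ∀ x ∈ U, ∃ y, Tendsto (fun k => g k x) atTop (𝓝 y) := by
    intro x hx
    obtain ⟨ρ, hρ, K, hK, -, h1, -⟩ := hunif x hx
    refine cauchySeq_tendsto_of_complete (Metric.cauchySeq_iff.2 fun ε hε => ?_)
    obtain ⟨N, hN⟩ := hcau (ε / K) (by positivity)
    refine ⟨N, fun k hk l hl => ?_⟩
    rw [dist_eq_norm]
    refine (h1 k l x (Metric.mem_ball_self hρ)).trans_lt ?_
    have := hN k hk l hl
    rwa [lt_div_iff₀ hK, mul_comm] at this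
  choose! G hG using hptc
  refine ⟨G, fun z hz => ?_, ?_⟩
  · obtain ⟨ρ, hρ, K, hK, hρU, -, h2⟩ := hunif z hz
    have huc : UniformCauchySeqOn (fun k => fderiv ℂ (g k)) atTop (Metric.ball z ρ) := by
      rw [Metric.uniformCauchySeqOn_iff]
      intro ε hε
      obtain ⟨N, hN⟩ := hcau (ε / K) (by positivity)
      refine ⟨N, fun k hk l hl x hx => ?_⟩
      rw [dist_eq_norm]
      refine (h2 k l x hx).trans_lt ?_
      have := hN k hk l hl
      rwa [lt_div_iff₀ hK, mul_comm] at this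
    have hptd : ∀ x ∈ Metric.ball z ρ, ∃ y, Tendsto (fun k => fderiv ℂ (g k) x) atTop (𝓝 y) :=
      fun x hx => cauchySeq_tendsto_of_complete (huc.cauchySeq hx)
    choose! G' hG' using hptd
    have htu := huc.tendstoUniformlyOn_of_tendsto hG'
    have := hasFDerivAt_of_tendstoUniformlyOn Metric.isOpen_ball htu
      (fun k x hx => ((hg k).differentiableAt
        (mem_of_superset (Metric.isOpen_ball.mem_nhds hx) hρU)).hasFDerivAt)
      (fun x hx => hG x (hρU hx)) (Metric.mem_ball_self hρ)
    exact this.differentiableAt.differentiableWithinAt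
  · have hm := tendstoInMeasure_of_tendsto_Lp hlim
    obtain ⟨ns, hns, hae⟩ := hm.exists_seq_tendsto_ae
    have hall : ∀ᵐ z ∂ν, ∀ k, F k z = g k z := ae_all_iff.2 hFg
    filter_upwards [hae, hall, hU] with z hz1 hz2 hz3
    refine tendsto_nhds_unique hz1 ?_
    simp_rw [hz2]
    exact (hG z hz3).comp hns.tendsto_atTop

theorem continuous_absSq {n : ℕ} : Continuous (absSq : (Fin n → ℂ) → ℝ) := by
  unfold absSq; fun_prop

theorem continuous_dot_self {n : ℕ} : Continuous (fun z : Fin n → ℂ => dot z z) := by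
  unfold dot; fun_prop

theorem continuous_Delta {n : ℕ} : Continuous (Delta : (Fin n → ℂ) → ℝ) := by
  have h1 := continuous_absSq (n := n)
  have h2 := continuous_dot_self (n := n)
  unfold Delta; fun_prop

theorem isOpen_domain (n : ℕ) : IsOpen (domain n) := by
  have h1 := continuous_absSq (n := n)
  have h2 := continuous_dot_self (n := n)
  exact (isOpen_lt h1 continuous_const).inter
    (isOpen_lt (continuous_const.mul h1) (continuous_const.add (h2.norm.pow 2)))

theorem Delta_pos {n : ℕ} {z : Fin n → ℂ} (hz : z ∈ domain n) : 0 < Delta z := by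
  have := hz.2
  unfold Delta
  linarith

theorem exists_restrict_le (n : ℕ) (lam : ℝ) {z : Fin n → ℂ} (hz : z ∈ domain n) :
    ∃ r > 0, Metric.ball z r ⊆ domain n ∧ ∃ C : ℝ≥0∞, C ≠ ⊤ ∧
      volume.restrict (Metric.ball z r) ≤ C • weightedMeasure n lam := by
  obtain ⟨r, hr, hrU⟩ := Metric.nhds_basis_closedBall.mem_iff.1 ((isOpen_domain n).mem_nhds hz)
  have hcont : ContinuousOn (fun y : Fin n → ℂ => Delta y ^ (lam - n)) (Metric.closedBall z r) :=
    continuous_Delta.continuousOn.rpow_const fun y hy => Or.inl (Delta_pos (hrU hy)).ne'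
  obtain ⟨y₀, hy₀, hmin⟩ := (isCompact_closedBall z r).exists_isMinOn
    (Metric.nonempty_closedBall.2 hr.le) hcont
  set m := Delta y₀ ^ (lam - n) with hm
  have hm0 : 0 < m := Real.rpow_pos_of_pos (Delta_pos (hrU hy₀)) _
  have hsub : Metric.ball z r ⊆ domain n := Metric.ball_subset_closedBall.trans hrU
  refine ⟨r, hr, hsub, (ENNReal.ofReal m)⁻¹, by simpa using hm0, ?_⟩
  have h1 : ENNReal.ofReal m • volume.restrict (Metric.ball z r) ≤ weightedMeasure n lam := by
    refine Measure.le_iff.2 fun s hs => ?_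
    rw [Measure.smul_apply, Measure.restrict_apply hs, smul_eq_mul, weightedMeasure,
      withDensity_apply _ hs, Measure.restrict_restrict hs, ← setLIntegral_const]
    calc _ ≤ ∫⁻ y in s ∩ Metric.ball z r, ENNReal.ofReal (Delta y ^ (lam - n)) :=
          setLIntegral_mono' (hs.inter measurableSet_ball) fun y hy =>
            ENNReal.ofReal_le_ofReal (hmin (Metric.ball_subset_closedBall hy.2))
      _ ≤ _ := lintegral_mono_set (inter_subset_inter_right _ hsub)
  refine Measure.le_iff.2 fun s hs => ?_
  have h2 := Measure.le_iff.1 h1 s hs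
  rw [Measure.smul_apply, smul_eq_mul] at h2 ⊢
  rw [← ENNReal.div_eq_inv_mul, ENNReal.le_div_iff_mul_le (Or.inl (by simpa using hm0))
    (Or.inl ENNReal.ofReal_ne_top), mul_comm]
  exact h2

/-! ## Bergman spaces and Toeplitz operators -/

/-- The weighted Bergman space `A²_λ`: the subspace of `L²(v_λ)` of all classes represented by a
function that is holomorphic on the domain. -/
def bergman (n : ℕ) (lam : ℝ) : Submodule ℂ (Lp ℂ 2 (bergmanMeasure n lam)) :=
  holoL2 (domain n) (bergmanMeasure n lam)

theorem isClosed_bergman (n : ℕ) (lam : ℝ) :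
    IsClosed (bergman n lam : Set (Lp ℂ 2 (bergmanMeasure n lam))) := by
  by_cases h0 : bergmanMeasure n lam = 0
  · have : (bergman n lam : Set (Lp ℂ 2 (bergmanMeasure n lam))) = univ := by
      refine eq_univ_of_forall fun F => ⟨0, differentiableOn_const 0, ?_⟩
      have : ae (bergmanMeasure n lam) = ⊥ := by rw [h0]; exact ae_zero
      rw [Filter.EventuallyEq, this]
      exact Filter.eventually_bot
    rw [this]
    exact isClosed_univ
  · have ht : weightedMeasure n lam univ ≠ ⊤ := by
      intro h
      apply h0
      rw [bergmanMeasure, h]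
      simp
    have hz : weightedMeasure n lam univ ≠ 0 := by
      intro h
      apply h0
      rw [bergmanMeasure, Measure.measure_univ_eq_zero.1 h]
      simp
    refine isClosed_holoL2 ?_ ?_
    · have h1 : ∀ᵐ z ∂(weightedMeasure n lam), z ∈ domain n :=
        (withDensity_absolutelyContinuous _ _).ae_le
          (ae_restrict_mem (isOpen_domain n).measurableSet)
      exact Measure.ae_smul_measure h1 _
    · intro z hzd
      obtain ⟨r, hr, hrU, C, hC, hle⟩ := exists_restrict_le n lam hzd
      refine ⟨r, hr, hrU, C * weightedMeasure n lam univ, ENNReal.mul_ne_top hC ht, ?_⟩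
      rwa [bergmanMeasure, smul_smul, mul_assoc, ENNReal.mul_inv_cancel hz ht, mul_one]

instance instCompleteSpaceBergman (n : ℕ) (lam : ℝ) : CompleteSpace (bergman n lam) :=
  (isClosed_bergman n lam).completeSpace_coe

/-- The multiplication operator `M_a` on `L²(v_λ)`, for `a ∈ L^∞`. -/
def mulOp {n : ℕ} {lam : ℝ} (a : Lp ℂ ⊤ (bergmanMeasure n lam)) :
    Lp ℂ 2 (bergmanMeasure n lam) →L[ℂ] Lp ℂ 2 (bergmanMeasure n lam) :=
  (ContinuousLinearMap.mul ℂ ℂ).holderL (bergmanMeasure n lam) ⊤ 2 2 a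

/-- The Toeplitz operator `T_a = B_λ ∘ M_a` on `A²_λ`, where `B_λ` is the orthogonal projection
of `L²(v_λ)` onto `A²_λ`. -/
def toeplitz {n : ℕ} {lam : ℝ} (a : Lp ℂ ⊤ (bergmanMeasure n lam)) :
    bergman n lam →L[ℂ] bergman n lam :=
  (bergman n lam).orthogonalProjectionOnto ∘L mulOp a ∘L (bergman n lam).subtypeL

/-- The unital C*-algebra of operators on a Hilbert space `H` generated by a set of bounded
operators: the norm closure of the unital star algebra generated by the set. -/
def cstarAlgebraGenerated {H : Type*} [NormedAddCommGroup H] [InnerProductSpace ℂ H]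
    [CompleteSpace H] (S : Set (H →L[ℂ] H)) : StarSubalgebra ℂ (H →L[ℂ] H) :=
  (StarAlgebra.adjoin ℂ S).topologicalClosure

/-- The unital C*-algebra generated by the Toeplitz operators with symbols in `S`. -/
def toeplitzAlgebra {n : ℕ} {lam : ℝ} (S : Set (Lp ℂ ⊤ (bergmanMeasure n lam))) :
    StarSubalgebra ℂ (bergman n lam →L[ℂ] bergman n lam) :=
  cstarAlgebraGenerated (toeplitz '' S)

/-! ## The Bergman metric, its symplectic form and moment maps -/

/-- The (weightless) Bergman kernel `K(z,w) = (1 - 2 zᵀ w̄ + (zᵀ z) conj(wᵀ w))^(-n)`. -/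
def bergmanKernel (n : ℕ) (z w : Fin n → ℂ) : ℂ :=
  ((1 - 2 * dot z (fun j => conj (w j)) + dot z z * conj (dot w w)) ^ n)⁻¹

/-- The Wirtinger derivative `∂F/∂z_j`. -/
def wirtinger {n : ℕ} (j : Fin n) (F : (Fin n → ℂ) → ℂ) (z : Fin n → ℂ) : ℂ :=
  (fderiv ℝ F z (Pi.single j 1) - Complex.I * fderiv ℝ F z (Pi.single j Complex.I)) / 2

/-- The conjugate Wirtinger derivative of `F` with respect to the conjugate of `z_j`. -/
def wirtingerBar {n : ℕ} (j : Fin n) (F : (Fin n → ℂ) → ℂ) (z : Fin n → ℂ) : ℂ :=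
  (fderiv ℝ F z (Pi.single j 1) + Complex.I * fderiv ℝ F z (Pi.single j Complex.I)) / 2

/-- The coefficients `g_{jk}(z)` of the Bergman metric `∑ g_{jk} dz_j ⊗ dz̄_k`, that is `1 / (2n)`
times the derivative of `log K(z,z)` with respect to `z_j` and the conjugate of `z_k`. -/
def metricCoeff (n : ℕ) (j k : Fin n) (z : Fin n → ℂ) : ℂ :=
  1 / (2 * n) *
    wirtinger j (wirtingerBar k fun w => Complex.log (bergmanKernel n w w)) z

/-- The symplectic form `ω = i ∑ g_{jk} dz_j ∧ dz̄_k` of the Bergman metric at `z`. -/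
def symplecticForm (n : ℕ) (z u v : Fin n → ℂ) : ℂ :=
  Complex.I * ∑ j, ∑ k, metricCoeff n j k z * (u j * conj (v k) - v j * conj (u k))

/-- The vector field on `ℂⁿ` induced by `X` in the Lie algebra of `SO(2)`. The group is identified
with the unit circle, which acts by `t • z`, and its Lie algebra with `ℝ`, the exponential map
being `X ↦ exp(iX)`. -/
def inducedField {n : ℕ} (X : ℝ) (z : Fin n → ℂ) : Fin n → ℂ :=
  deriv (fun r : ℝ => (Circle.exp (r * X) : ℂ) • z) 0

/-- `μ` is a moment map for the action of `SO(2)` on the domain with the symplectic form of the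
Bergman metric. The dual of the Lie algebra is identified with `ℝ`, so `⟨μ(z), X⟩ = μ(z) X`; the
coadjoint action is trivial because `SO(2)` is abelian. -/
structure IsMomentMapSO2 (n : ℕ) (μ : (Fin n → ℂ) → ℝ) : Prop where
  smooth : ContDiffOn ℝ (⊤ : ℕ∞) μ (domain n)
  hamiltonian : ∀ X : ℝ, ∀ z ∈ domain n, ∀ u : Fin n → ℂ,
    ((fderiv ℝ (fun w => μ w * X) z u : ℝ) : ℂ) = symplecticForm n z (inducedField X z) u
  equivariant : ∀ t : Circle, ∀ z ∈ domain n, μ ((t : ℂ) • z) = μ z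

/-- The function `(|zᵀ z|² - |z|²) / (1 + |zᵀ z|² - 2 |z|²)`. -/
def momentMapSO2 (n : ℕ) (z : Fin n → ℂ) : ℝ :=
  (‖dot z z‖ ^ 2 - absSq z) / (1 + ‖dot z z‖ ^ 2 - 2 * absSq z)

/-- The essentially bounded symbols of the form `f ∘ μ` with `f` measurable. -/
def momentMapSymbols (n : ℕ) (lam : ℝ) (μ : (Fin n → ℂ) → ℝ) :
    Set (Lp ℂ ⊤ (bergmanMeasure n lam)) :=
  {a | ∃ f : ℝ → ℂ, Measurable f ∧ a =ᵐ[bergmanMeasure n lam] fun z => f (μ z)}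

/-! ## Harmonic polynomials -/

/-- The holomorphic Laplacian `∑ ∂²/∂z_j²` on polynomials. -/
def laplacian (n : ℕ) : MvPolynomial (Fin n) ℂ →ₗ[ℂ] MvPolynomial (Fin n) ℂ :=
  ∑ j, (MvPolynomial.pderiv j).toLinearMap ∘ₗ (MvPolynomial.pderiv j).toLinearMap

/-- `H^m(ℂⁿ)`: the harmonic polynomials that are homogeneous of degree `m`. -/
def harmonicPoly (n m : ℕ) : Submodule ℂ (MvPolynomial (Fin n) ℂ) :=
  MvPolynomial.homogeneousSubmodule (Fin n) ℂ m ⊓ LinearMap.ker (laplacian n)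

/-- The subspace `H^{k₁}(ℂⁿ) (zᵀ z)^{k₂}` of the Bergman space. -/
def component (n : ℕ) (lam : ℝ) (k : ℕ × ℕ) : Submodule ℂ (bergman n lam) where
  carrier := {F | ∃ p ∈ harmonicPoly n k.1, (F : Lp ℂ 2 (bergmanMeasure n lam))
    =ᵐ[bergmanMeasure n lam] fun z => MvPolynomial.eval z p * dot z z ^ k.2}
  zero_mem' := by
    refine ⟨0, zero_mem _, (Lp.coeFn_zero ℂ 2 (bergmanMeasure n lam)).trans ?_⟩
    filter_upwards with z
    simp
  add_mem' := by
    rintro F G ⟨p, hp, hF⟩ ⟨q, hq, hG⟩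
    refine ⟨p + q, add_mem hp hq, (Lp.coeFn_add _ _).trans ?_⟩
    filter_upwards [hF, hG] with z h1 h2
    simp [h1, h2, add_mul]
  smul_mem' := by
    rintro c F ⟨p, hp, hF⟩
    refine ⟨c • p, Submodule.smul_mem _ c hp, (Lp.coeFn_smul _ _).trans ?_⟩
    filter_upwards [hF] with z h1
    simp [h1, mul_assoc, MvPolynomial.smul_eval]

end CartanIV

end

open CartanIV

noncomputable section

namespace CartanIV

open MvPolynomial

/-! ## Differential operators on polynomials -/

/-! The function μ(z) = (|zᵀz|² − |z|²)/Δ(z) equals ½ ∑ z_j ∂_j log Δ, and the metric coefficients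
are −½ ∂_j ∂̄_k log Δ. Contracting ω with the field iXz therefore gives d(Xμ). As D is balanced,
hence connected, any other moment map differs from μ by a constant on D. So every symbol f ∘ μ
depends there only on |z|² and |zᵀz|, and is invariant under the circle and under all real
rotations.

Part (3) is then Schur's lemma for SO(n) × SO(2) acting on a multiplicity-free space. It is proved
with the sesquilinear forms (p, q) ↦ ∫ a p q̄ dv_λ on polynomials, for which the infinitesimal
rotations z_i ∂_j − z_j ∂_i are skew when a is invariant (`rotInvariant_symbolForm`). Distinct
summands are orthogonal for every such form: circle invariance separates degrees, and the Casimir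
operator, with eigenvalue −2k(k+n−2) on H^k, separates harmonic degrees (`RotInvariant.eq_zero`).
Inside one summand, every nonzero rotation-stable subspace of H^k contains the highest weight vector
(z_a + i z_b)^k (`isoX_pow_mem`; this needs n ≥ 3), so two stable subspaces orthogonal to each other
for an anisotropic form cannot both be nonzero. This makes the form of a proportional to the inner
product (`RotInvariant.eq_smul`), the ratio being an eigenvalue of the compressed Toeplitz operator.

For (1), completeness has two ingredients. The Fischer decomposition writes every homogeneous
polynomial as a sum of terms h (zᵀz)^j with h harmonic. And a holomorphic F orthogonal to all
polynomials vanishes: averaging over the circle shows that its m-th homogeneous Taylor term is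
orthogonal to every polynomial of degree m, hence to itself (`eq_zero_of_orthogonal_polynomials`).

The condition λ > n − 1 enters through the finiteness of ∫_D Δ^(λ−n) dv
(`weightedMeasure_univ_lt_top`): otherwise the normalised measure would be zero. Finally (2) follows
from (3): operators that are scalar on each summand form a commutative star algebra, and
commutativity survives norm closure. -/

/-- A commutator of derivations is a derivation, hence determined by its values on the variables. -/
theorem derivation_bracket_apply {n : ℕ}
    {D₁ D₂ D₃ : Derivation ℂ (MvPolynomial (Fin n) ℂ) (MvPolynomial (Fin n) ℂ)}
    (h : ∀ i, D₁ (D₂ (X i)) - D₂ (D₁ (X i)) = D₃ (X i)) (f : MvPolynomial (Fin n) ℂ) :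
    D₁ (D₂ f) = D₂ (D₁ f) + D₃ f := by
  have : ⁅D₁, D₂⁆ = D₃ := derivation_ext fun i => by rw [Derivation.commutator_apply, h i]
  rw [← this, Derivation.commutator_apply]
  ring

theorem pderiv_comm {n : ℕ} (i j : Fin n) (f : MvPolynomial (Fin n) ℂ) :
    pderiv i (pderiv j f) = pderiv j (pderiv i f) := by
  have := derivation_bracket_apply (D₁ := pderiv i) (D₂ := pderiv j) (D₃ := 0) (fun k => by
    simp only [pderiv_X, Pi.single_apply]
    split_ifs <;> simp) f
  simpa using this

/-- The infinitesimal rotation `z_i ∂_j - z_j ∂_i`. -/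
def rot {n : ℕ} (i j : Fin n) : Derivation ℂ (MvPolynomial (Fin n) ℂ) (MvPolynomial (Fin n) ℂ) :=
  (X i : MvPolynomial (Fin n) ℂ) • pderiv j - (X j : MvPolynomial (Fin n) ℂ) • pderiv i

/-- The Euler operator `∑ z_i ∂_i`. -/
def euler (n : ℕ) : Derivation ℂ (MvPolynomial (Fin n) ℂ) (MvPolynomial (Fin n) ℂ) :=
  ∑ i, (X i : MvPolynomial (Fin n) ℂ) • pderiv i

/-- The quadratic form `zᵀ z` as a polynomial. -/
def quad (n : ℕ) : MvPolynomial (Fin n) ℂ := ∑ i, X i ^ 2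

theorem rot_apply {n : ℕ} (i j : Fin n) (f : MvPolynomial (Fin n) ℂ) :
    rot i j f = X i * pderiv j f - X j * pderiv i f := by
  simp [rot]

theorem derivation_sum_apply {n : ℕ} {ι : Type*} (s : Finset ι)
    (D : ι → Derivation ℂ (MvPolynomial (Fin n) ℂ) (MvPolynomial (Fin n) ℂ))
    (f : MvPolynomial (Fin n) ℂ) : (∑ i ∈ s, D i) f = ∑ i ∈ s, D i f := by
  classical
  induction s using Finset.induction_on with
  | empty => simp
  | insert a s ha ih => rw [Finset.sum_insert ha, Finset.sum_insert ha, Derivation.add_apply, ih]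

theorem euler_apply {n : ℕ} (f : MvPolynomial (Fin n) ℂ) :
    euler n f = ∑ i, X i * pderiv i f := by
  simp [euler, derivation_sum_apply]

theorem euler_X {n : ℕ} (i : Fin n) : euler n (X i) = X i := by
  simp [euler_apply, pderiv_X, Pi.single_apply]

theorem euler_of_isHomogeneous {n k : ℕ} {f : MvPolynomial (Fin n) ℂ} (hf : f.IsHomogeneous k) :
    euler n f = k * f := by
  rw [euler_apply, hf.sum_X_mul_pderiv, nsmul_eq_mul]

theorem laplacian_apply {n : ℕ} (f : MvPolynomial (Fin n) ℂ) :
    laplacian n f = ∑ j, pderiv j (pderiv j f) := by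
  simp [laplacian]

theorem pderiv_quad {n : ℕ} (i : Fin n) : pderiv i (quad n) = 2 * X i := by
  simp only [quad, map_sum, pderiv_pow, pderiv_X, Pi.single_apply]
  simp

theorem rot_quad {n : ℕ} (i j : Fin n) : rot i j (quad n) = 0 := by
  rw [rot_apply, pderiv_quad, pderiv_quad]
  ring

theorem rot_mul_quad_pow {n : ℕ} (i j : Fin n) (f : MvPolynomial (Fin n) ℂ) (m : ℕ) :
    rot i j (f * quad n ^ m) = rot i j f * quad n ^ m := by
  rw [Derivation.leibniz, Derivation.leibniz_pow, rot_quad]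
  simp [mul_comm]

theorem quad_isHomogeneous (n : ℕ) : (quad n).IsHomogeneous 2 :=
  IsHomogeneous.sum _ _ _ fun i _ => by simpa using (isHomogeneous_X ℂ i).pow 2

theorem quad_ne_zero {n : ℕ} (hn : 0 < n) : quad n ≠ 0 := by
  intro h
  have h2 := congrArg (eval (Pi.single (⟨0, hn⟩ : Fin n) (1 : ℂ))) h
  simp [quad, Pi.single_apply] at h2

theorem isHomogeneous_pderiv_of_succ {n k : ℕ} {f : MvPolynomial (Fin n) ℂ}
    (hf : f.IsHomogeneous (k + 1)) (i : Fin n) : (pderiv i f).IsHomogeneous k := by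
  simpa using hf.pderiv (i := i)

theorem isHomogeneous_laplacian {n k : ℕ} {f : MvPolynomial (Fin n) ℂ}
    (hf : f.IsHomogeneous (k + 2)) : (laplacian n f).IsHomogeneous k := by
  rw [laplacian_apply]
  exact IsHomogeneous.sum _ _ _ fun i _ =>
    isHomogeneous_pderiv_of_succ (isHomogeneous_pderiv_of_succ hf i) i

theorem pderiv_eq_zero_of_isHomogeneous_zero {n : ℕ} {f : MvPolynomial (Fin n) ℂ}
    (hf : f.IsHomogeneous 0) (i : Fin n) : pderiv i f = 0 := by
  rw [totalDegree_eq_zero_iff_eq_C.1 ((totalDegree_zero_iff_isHomogeneous _).2 hf), pderiv_C]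

theorem laplacian_eq_zero_of_lt_two {n k : ℕ} (hk : k < 2) {f : MvPolynomial (Fin n) ℂ}
    (hf : f.IsHomogeneous k) : laplacian n f = 0 := by
  rw [laplacian_apply]
  refine Finset.sum_eq_zero fun i _ => ?_
  interval_cases k
  · rw [pderiv_eq_zero_of_isHomogeneous_zero hf, map_zero]
  · exact pderiv_eq_zero_of_isHomogeneous_zero (isHomogeneous_pderiv_of_succ hf i) i

theorem isHomogeneous_rot {n k : ℕ} {f : MvPolynomial (Fin n) ℂ} (hf : f.IsHomogeneous k)
    (i j : Fin n) : (rot i j f).IsHomogeneous k := by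
  cases k with
  | zero =>
    rw [rot_apply, pderiv_eq_zero_of_isHomogeneous_zero hf, pderiv_eq_zero_of_isHomogeneous_zero hf]
    simpa using isHomogeneous_zero _ _ _
  | succ k =>
    rw [rot_apply, add_comm k 1]
    exact ((isHomogeneous_X ℂ i).mul (isHomogeneous_pderiv_of_succ hf j)).sub
      ((isHomogeneous_X ℂ j).mul (isHomogeneous_pderiv_of_succ hf i))

theorem mem_harmonicPoly {n k : ℕ} {f : MvPolynomial (Fin n) ℂ} :
    f ∈ harmonicPoly n k ↔ f.IsHomogeneous k ∧ laplacian n f = 0 := Iff.rfl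

theorem pderiv_rot {n : ℕ} (i j k : Fin n) (f : MvPolynomial (Fin n) ℂ) :
    pderiv k (rot i j f) = rot i j (pderiv k f)
      + ((if k = i then pderiv j f else 0) - (if k = j then pderiv i f else 0)) := by
  rw [rot_apply, rot_apply, map_sub, Derivation.leibniz, Derivation.leibniz, pderiv_X, pderiv_X,
    pderiv_comm k j, pderiv_comm k i]
  simp only [Pi.single_apply, smul_eq_mul]
  simp only [eq_comm (a := i) (b := k), eq_comm (a := j) (b := k)]
  split_ifs <;> ring

/-- The first-order corrections from `pderiv_rot` are mixed second derivatives that cancel between k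
= i and k = j. Hence harmonic polynomials are stable under rotations. -/
theorem laplacian_rot {n : ℕ} (i j : Fin n) (f : MvPolynomial (Fin n) ℂ) :
    laplacian n (rot i j f) = rot i j (laplacian n f) := by
  have h : ∀ k, pderiv k (pderiv k (rot i j f)) = rot i j (pderiv k (pderiv k f))
      + ((if k = i then 2 * pderiv i (pderiv j f) else 0)
        - (if k = j then 2 * pderiv i (pderiv j f) else 0)) := by
    intro k
    rw [pderiv_rot, map_add, pderiv_rot, map_sub]
    split_ifs with h1 h2 h2
    · subst h1; subst h2; ring
    · subst h1; rw [map_zero, pderiv_comm j k]; ring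
    · subst h2; rw [map_zero, pderiv_comm i k]; ring
    · rw [map_zero]; ring
  rw [laplacian_apply, laplacian_apply, Finset.sum_congr rfl fun k _ => h k, Finset.sum_add_distrib,
    Finset.sum_sub_distrib, map_sum]
  simp

theorem rot_mem_harmonicPoly {n k : ℕ} {f : MvPolynomial (Fin n) ℂ} (hf : f ∈ harmonicPoly n k)
    (i j : Fin n) : rot i j f ∈ harmonicPoly n k := by
  obtain ⟨h1, h2⟩ := mem_harmonicPoly.1 hf
  refine mem_harmonicPoly.2 ⟨isHomogeneous_rot h1 i j, ?_⟩
  rw [laplacian_rot, h2, map_zero]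

/-- Leibniz with q = zᵀz: Δq = 2n, and the cross term 2∇q·∇g is four times the Euler operator, which
acts on degree k as k. -/
theorem laplacian_quad_mul {n k : ℕ} {g : MvPolynomial (Fin n) ℂ} (hg : g.IsHomogeneous k) :
    laplacian n (quad n * g) = (2 * n + 4 * k) * g + quad n * laplacian n g := by
  have h : ∀ j : Fin n, pderiv j (pderiv j (quad n * g))
      = 2 * g + 4 * (X j * pderiv j g) + quad n * pderiv j (pderiv j g) := by
    intro j
    simp only [Derivation.leibniz, smul_eq_mul, map_add, pderiv_quad]
    have : pderiv j (2 : MvPolynomial (Fin n) ℂ) = 0 := by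
      exact Derivation.map_natCast (pderiv j) 2
    rw [this]
    simp
    ring
  rw [laplacian_apply, laplacian_apply, Finset.sum_congr rfl fun j _ => h j, Finset.sum_add_distrib,
    Finset.sum_add_distrib, ← Finset.mul_sum, ← Finset.mul_sum, ← Finset.mul_sum, ← euler_apply,
    euler_of_isHomogeneous hg]
  simp
  ring

/-! ## The Fischer decomposition -/

/-- Surjectivity of qΔ + c on homogeneous polynomials, for all c > 0 at once, because the induction
lowers the degree by two and enlarges c. -/
theorem exists_quad_mul_laplacian_add (n : ℕ) : ∀ (k c : ℕ), 0 < c →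
    ∀ p : MvPolynomial (Fin n) ℂ, p.IsHomogeneous k →
    ∃ g : MvPolynomial (Fin n) ℂ, g.IsHomogeneous k ∧
      quad n * laplacian n g + c * g = p := by
  intro k
  induction k using Nat.strong_induction_on with
  | _ k ih =>
    intro c hc p hp
    have hc' : (C (c : ℂ)⁻¹ : MvPolynomial (Fin n) ℂ) * c = 1 := by
      rw [← map_natCast (C : ℂ →+* MvPolynomial (Fin n) ℂ), ← C_mul,
        inv_mul_cancel₀ (by exact_mod_cast hc.ne'), C_1]
    rcases lt_or_ge k 2 with hk | hk
    · refine ⟨C (c : ℂ)⁻¹ * p, hp.C_mul _, ?_⟩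
      rw [laplacian_eq_zero_of_lt_two hk (hp.C_mul _)]
      linear_combination p * hc'
    · obtain ⟨d, rfl⟩ := Nat.exists_eq_add_of_le hk
      rw [add_comm 2 d] at *
      -- With g = c⁻¹(p − q g₁) it suffices that Δg = g₁. By `laplacian_quad_mul` this is the
      -- equation (qΔ + c + 2n + 4d) g₁ = Δp in degree d.
      obtain ⟨g₁, hg₁, he⟩ := ih d (by omega) (c + (2 * n + 4 * d)) (by omega) (laplacian n p)
        (isHomogeneous_laplacian hp)
      have hqg : (quad n * g₁).IsHomogeneous (d + 2) := by
        rw [add_comm]; exact (quad_isHomogeneous n).mul hg₁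
      refine ⟨C (c : ℂ)⁻¹ * (p - quad n * g₁), (hp.sub hqg).C_mul _, ?_⟩
      have hl : laplacian n (C (c : ℂ)⁻¹ * (p - quad n * g₁)) = g₁ := by
        rw [C_mul', map_smul, map_sub, laplacian_quad_mul hg₁, ← C_mul', ← he]
        push_cast
        linear_combination g₁ * hc'
      rw [hl]
      linear_combination (p - quad n * g₁) * hc'

/-- One step of the Fischer decomposition: p − qg is harmonic exactly when (qΔ + 2n + 4k) g = Δp,
which is solvable by the previous lemma. -/
theorem exists_harmonic_add_quad_mul {n : ℕ} (hn : 0 < n) {k : ℕ} {p : MvPolynomial (Fin n) ℂ}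
    (hp : p.IsHomogeneous (k + 2)) :
    ∃ h ∈ harmonicPoly n (k + 2), ∃ g : MvPolynomial (Fin n) ℂ,
      g.IsHomogeneous k ∧ p = h + g * quad n := by
  obtain ⟨g, hg, he⟩ := exists_quad_mul_laplacian_add n k (2 * n + 4 * k) (by omega)
    (laplacian n p) (isHomogeneous_laplacian hp)
  have hqg : (g * quad n).IsHomogeneous (k + 2) := hg.mul (quad_isHomogeneous n)
  refine ⟨p - g * quad n, mem_harmonicPoly.2 ⟨hp.sub hqg, ?_⟩, g, hg, by ring⟩
  rw [map_sub, mul_comm g, laplacian_quad_mul hg, ← he]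
  push_cast
  ring

theorem mem_of_isHomogeneous {n : ℕ} (hn : 0 < n) {W : Submodule ℂ (MvPolynomial (Fin n) ℂ)}
    (hW : ∀ k j, ∀ h ∈ harmonicPoly n k, h * quad n ^ j ∈ W) :
    ∀ (k j : ℕ) (p : MvPolynomial (Fin n) ℂ), p.IsHomogeneous k → p * quad n ^ j ∈ W := by
  intro k
  induction k using Nat.strong_induction_on with
  | _ k ih =>
    intro j p hp
    rcases lt_or_ge k 2 with hk | hk
    · exact hW k j p ⟨hp, laplacian_eq_zero_of_lt_two hk hp⟩
    · obtain ⟨d, rfl⟩ := Nat.exists_eq_add_of_le hk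
      rw [add_comm 2 d] at *
      obtain ⟨h, hh, g, hg, rfl⟩ := exists_harmonic_add_quad_mul hn hp
      rw [add_mul, mul_assoc, ← pow_succ']
      exact add_mem (hW _ _ h hh) (ih d (by omega) (j + 1) g hg)

/-! ## The Casimir operator and orthogonality -/

/-- The Casimir operator on harmonic polynomials. Its factor 2 comes from summing over ordered
pairs. -/
theorem sum_rot_rot {n k : ℕ} {f : MvPolynomial (Fin n) ℂ} (hf : f ∈ harmonicPoly n k) :
    ∑ i, ∑ j, rot i j (rot i j f) = -(2 * (k * (k + n - 2))) * f := by
  obtain ⟨h1, h2⟩ := mem_harmonicPoly.1 hf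
  have he : euler n f = k * f := euler_of_isHomogeneous h1
  have hee : ∑ i, X i * ∑ j, X j * pderiv i (pderiv j f)
      = (k * k - k : MvPolynomial (Fin n) ℂ) * f := by
    have h3 : euler n (euler n f) = k * (k * f) := by
      rw [he, ← nsmul_eq_mul, map_nsmul, he, nsmul_eq_mul, nsmul_eq_mul]
    rw [euler_apply, euler_apply] at h3
    have h4 : ∀ i, pderiv i (∑ j, X j * pderiv j f)
        = pderiv i f + ∑ j, X j * pderiv i (pderiv j f) := by
      intro i
      simp [Finset.sum_add_distrib, pderiv_X, Pi.single_apply, add_comm]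
    simp_rw [h4, mul_add, Finset.sum_add_distrib] at h3
    rw [← euler_apply, he] at h3
    linear_combination h3
  have key : ∀ i j, rot i j (rot i j f) =
      X i ^ 2 * pderiv j (pderiv j f) + X j ^ 2 * pderiv i (pderiv i f)
      - X i * pderiv i f - X j * pderiv j f
      - 2 * (X i * (X j * pderiv i (pderiv j f)))
      + ((if i = j then X i * pderiv j f else 0) + (if i = j then X j * pderiv i f else 0)) := by
    intro i j
    rw [rot_apply, pderiv_rot, pderiv_rot, rot_apply, rot_apply, pderiv_comm j i]
    by_cases hij : i = j
    · subst hij; simp; ring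
    · simp [hij, Ne.symm hij]; ring
  have h5 : ∑ x : Fin n, (∑ i : Fin n, X i ^ 2) * pderiv x (pderiv x f) = 0 := by
    rw [← Finset.mul_sum, ← laplacian_apply, h2, mul_zero]
  have h6 : ∑ x : Fin n, X x * ((n : MvPolynomial (Fin n) ℂ) * pderiv x f) = n * (k * f) := by
    rw [← he, euler_apply, Finset.mul_sum]
    exact Finset.sum_congr rfl fun _ _ => by ring
  simp_rw [key, Finset.sum_add_distrib, Finset.sum_sub_distrib, Finset.sum_add_distrib,
    ← Finset.mul_sum, ← laplacian_apply, h2, hee]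
  simp only [mul_zero, Finset.sum_const_zero, Finset.sum_ite_eq, Finset.mem_univ,
    if_true, Finset.sum_const, Finset.card_univ, Fintype.card_fin, ← Finset.sum_mul,
    ← euler_apply, he, nsmul_eq_mul, h5, h6]
  ring

/-- A sesquilinear form on polynomials for which the infinitesimal rotations are skew. -/
def RotInvariant {n : ℕ}
    (B : MvPolynomial (Fin n) ℂ →ₗ[ℂ] MvPolynomial (Fin n) ℂ →ₗ⋆[ℂ] ℂ) : Prop :=
  ∀ i j p q, B (rot i j p) q = -B p (rot i j q)

/-- Two skew steps make the Casimir operator symmetric for B. Rotations annihilate zᵀz, so the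
powers of `quad n` do not affect its real eigenvalues, which differ for k ≠ k'. -/
theorem RotInvariant.eq_zero {n : ℕ} (hn : 2 ≤ n)
    {B : MvPolynomial (Fin n) ℂ →ₗ[ℂ] MvPolynomial (Fin n) ℂ →ₗ⋆[ℂ] ℂ} (hB : RotInvariant B)
    {k k' : ℕ} (hk : k ≠ k') {h h' : MvPolynomial (Fin n) ℂ} (hh : h ∈ harmonicPoly n k)
    (hh' : h' ∈ harmonicPoly n k') (m m' : ℕ) : B (h * quad n ^ m) (h' * quad n ^ m') = 0 := by
  have e : ∀ {l : ℕ} {f : MvPolynomial (Fin n) ℂ} (s : ℕ), f ∈ harmonicPoly n l →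
      ∑ i, ∑ j, rot i j (rot i j (f * quad n ^ s))
        = ((-(2 * (l * (l + n - 2))) : ℝ) : ℂ) • (f * quad n ^ s) := by
    intro l f s hf
    simp_rw [rot_mul_quad_pow, ← Finset.sum_mul]
    rw [sum_rot_rot hf, smul_eq_C_mul]
    simp only [Complex.ofReal_neg, Complex.ofReal_mul, Complex.ofReal_ofNat, Complex.ofReal_natCast,
      Complex.ofReal_sub, Complex.ofReal_add, map_neg, map_mul, map_sub, map_add, map_natCast,
      map_ofNat]
    ring
  have h1 : B (∑ i, ∑ j, rot i j (rot i j (h * quad n ^ m))) (h' * quad n ^ m')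
      = B (h * quad n ^ m) (∑ i, ∑ j, rot i j (rot i j (h' * quad n ^ m'))) := by
    simp only [map_sum, LinearMap.sum_apply]
    refine Finset.sum_congr rfl fun i _ => Finset.sum_congr rfl fun j _ => ?_
    rw [hB, hB, neg_neg]
  rw [e m hh, e m' hh', map_smul, LinearMap.smul_apply, map_smulₛₗ, Complex.conj_ofReal,
    smul_eq_mul, smul_eq_mul] at h1
  have h2 : ((-(2 * (k * (k + n - 2))) : ℝ) : ℂ) - ((-(2 * (k' * (k' + n - 2))) : ℝ) : ℂ) ≠ 0 := by
    rw [← Complex.ofReal_sub]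
    refine Complex.ofReal_ne_zero.2 fun h0 => hk ?_
    have hn' : (2 : ℝ) ≤ n := by exact_mod_cast hn
    -- Equality of the eigenvalues factors this way; for n ≥ 2 the second factor vanishes only if k
    -- = k' = 0.
    have h3 : ((k : ℝ) - k') * (k + k' + n - 2) = 0 := by linear_combination h0 / (-2)
    rcases mul_eq_zero.1 h3 with h4 | h4
    · exact_mod_cast sub_eq_zero.1 h4
    · have h5 : (0 : ℝ) ≤ k := k.cast_nonneg
      have h6 : (0 : ℝ) ≤ k' := k'.cast_nonneg
      have h7 : (k : ℝ) = k' := by linarith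
      exact_mod_cast h7
  refine (mul_eq_zero.1 ?_).resolve_left h2
  rw [sub_mul, h1, sub_self]

end CartanIV

namespace CartanIV

open MvPolynomial

/-! ## Highest weight vectors -/

section HighestWeight

variable {n : ℕ}

/-- The linear form `z_a + i z_b`. -/
def isoX (a b : Fin n) : MvPolynomial (Fin n) ℂ := X a + C Complex.I * X b

/-- The derivation `∂_a - i ∂_b`. -/
def dIso (a b : Fin n) : Derivation ℂ (MvPolynomial (Fin n) ℂ) (MvPolynomial (Fin n) ℂ) :=
  pderiv a - (C Complex.I : MvPolynomial (Fin n) ℂ) • pderiv b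

/-- The derivation `∂_a + i ∂_b`. -/
def dIsoBar (a b : Fin n) : Derivation ℂ (MvPolynomial (Fin n) ℂ) (MvPolynomial (Fin n) ℂ) :=
  pderiv a + (C Complex.I : MvPolynomial (Fin n) ℂ) • pderiv b

/-- The Cartan element `-i (z_a ∂_b - z_b ∂_a)`. -/
def weightOp (a b : Fin n) : Derivation ℂ (MvPolynomial (Fin n) ℂ) (MvPolynomial (Fin n) ℂ) :=
  -((C Complex.I : MvPolynomial (Fin n) ℂ) • rot a b)

/-- The raising operator attached to the index `j`. -/
def raiseOp (a b j : Fin n) : Derivation ℂ (MvPolynomial (Fin n) ℂ) (MvPolynomial (Fin n) ℂ) :=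
  rot a j + (C Complex.I : MvPolynomial (Fin n) ℂ) • rot b j

theorem C_I_mul_C_I : (C Complex.I * C Complex.I : MvPolynomial (Fin n) ℂ) = -1 := by
  rw [← C_mul, Complex.I_mul_I, map_neg, C_1]

theorem dIso_apply (a b : Fin n) (f : MvPolynomial (Fin n) ℂ) :
    dIso a b f = pderiv a f - C Complex.I * pderiv b f := by simp [dIso]

theorem dIsoBar_apply (a b : Fin n) (f : MvPolynomial (Fin n) ℂ) :
    dIsoBar a b f = pderiv a f + C Complex.I * pderiv b f := by simp [dIsoBar]

theorem weightOp_apply (a b : Fin n) (f : MvPolynomial (Fin n) ℂ) :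
    weightOp a b f = -(C Complex.I * rot a b f) := by simp [weightOp]

theorem raiseOp_apply (a b j : Fin n) (f : MvPolynomial (Fin n) ℂ) :
    raiseOp a b j f = isoX a b * pderiv j f - X j * dIsoBar a b f := by
  simp [raiseOp, rot_apply, isoX, dIsoBar]
  ring

theorem derivation_C_mul (D : Derivation ℂ (MvPolynomial (Fin n) ℂ) (MvPolynomial (Fin n) ℂ))
    (c : ℂ) (f : MvPolynomial (Fin n) ℂ) : D (C c * f) = C c * D f := by
  rw [C_mul', Derivation.map_smul, C_mul']

theorem rot_X (a b i : Fin n) :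
    rot a b (X i : MvPolynomial (Fin n) ℂ) = (if i = b then X a else 0) - if i = a then X b else 0 := by
  rw [rot_apply, pderiv_X, pderiv_X, Pi.single_apply, Pi.single_apply]
  simp

theorem pderiv_X_eq_ite (a i : Fin n) :
    pderiv a (X i : MvPolynomial (Fin n) ℂ) = if i = a then 1 else 0 := by
  rw [pderiv_X, Pi.single_apply]

theorem weightOp_pderiv {a b j : Fin n} (hja : j ≠ a) (hjb : j ≠ b) (f : MvPolynomial (Fin n) ℂ) :
    weightOp a b (pderiv j f) = pderiv j (weightOp a b f) := by
  rw [weightOp_apply, weightOp_apply, map_neg, derivation_C_mul, pderiv_rot]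
  simp [hja, hjb]

theorem weightOp_dIso {a b : Fin n} (hab : a ≠ b) (f : MvPolynomial (Fin n) ℂ) :
    weightOp a b (dIso a b f) = dIso a b (weightOp a b f) - dIso a b f := by
  simp only [weightOp_apply, dIso_apply, map_neg, map_sub, derivation_C_mul, pderiv_rot]
  simp only [hab, hab.symm, if_true, if_false]
  linear_combination (pderiv a f) * C_I_mul_C_I (n := n)

theorem weightOp_dIsoBar {a b : Fin n} (hab : a ≠ b) (f : MvPolynomial (Fin n) ℂ) :
    weightOp a b (dIsoBar a b f) = dIsoBar a b (weightOp a b f) + dIsoBar a b f := by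
  simp only [weightOp_apply, dIsoBar_apply, map_neg, map_add, derivation_C_mul, pderiv_rot]
  simp only [hab, hab.symm, if_true, if_false]
  linear_combination (-pderiv a f) * C_I_mul_C_I (n := n)

/-- The raising operator has weight +1, since z_a + i z_b and ∂_a + i∂_b both have weight +1 while
z_j and ∂_j have weight 0. -/
theorem weightOp_raiseOp {a b j : Fin n} (hab : a ≠ b) (hja : j ≠ a) (hjb : j ≠ b)
    (f : MvPolynomial (Fin n) ℂ) :
    weightOp a b (raiseOp a b j f) = raiseOp a b j (weightOp a b f) + raiseOp a b j f := by
  have h1 : weightOp a b (isoX a b) = isoX a b := by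
    rw [weightOp_apply, isoX, map_add, derivation_C_mul, rot_X, rot_X]
    simp only [hab, hab.symm, if_true, if_false]
    linear_combination (-X a) * C_I_mul_C_I (n := n)
  have h2 : weightOp a b (X j) = 0 := by
    rw [weightOp_apply, rot_X]
    simp [hja, hjb]
  simp only [raiseOp_apply]
  rw [map_sub, Derivation.leibniz, Derivation.leibniz, h1, h2, weightOp_pderiv hja hjb,
    weightOp_dIsoBar hab]
  simp only [smul_eq_mul]
  ring

theorem pderiv_left_eq (a b : Fin n) (f : MvPolynomial (Fin n) ℂ) :
    pderiv a f = C (1 / 2) * (dIso a b f + dIsoBar a b f) := by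
  have h : (C (1 / 2) * 2 : MvPolynomial (Fin n) ℂ) = 1 := by
    rw [← map_ofNat (C : ℂ →+* MvPolynomial (Fin n) ℂ), ← C_mul]; norm_num
  rw [dIso_apply, dIsoBar_apply]
  linear_combination (-pderiv a f) * h

theorem pderiv_right_eq (a b : Fin n) (f : MvPolynomial (Fin n) ℂ) :
    pderiv b f = C (1 / 2) * (C Complex.I * (dIso a b f - dIsoBar a b f)) := by
  have h : (C (1 / 2) * 2 : MvPolynomial (Fin n) ℂ) = 1 := by
    rw [← map_ofNat (C : ℂ →+* MvPolynomial (Fin n) ℂ), ← C_mul]; norm_num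
  rw [dIso_apply, dIsoBar_apply]
  linear_combination (-pderiv b f) * h + (2 * C (1 / 2) * pderiv b f) * C_I_mul_C_I (n := n)

theorem eq_zero_of_pderiv_eq_zero {k : ℕ} {f : MvPolynomial (Fin n) ℂ}
    (hf : f.IsHomogeneous (k + 1)) (h : ∀ j, pderiv j f = 0) : f = 0 := by
  have h1 := euler_of_isHomogeneous hf
  rw [euler_apply] at h1
  simp only [h, mul_zero, Finset.sum_const_zero] at h1
  have h2 : ((k + 1 : ℕ) : MvPolynomial (Fin n) ℂ) ≠ 0 := Nat.cast_ne_zero.2 k.succ_ne_zero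
  exact (mul_eq_zero.1 h1.symm).resolve_left h2

theorem isHomogeneous_dIso {k : ℕ} {f : MvPolynomial (Fin n) ℂ}
    (hf : f.IsHomogeneous (k + 1)) (a b : Fin n) : (dIso a b f).IsHomogeneous k := by
  rw [dIso_apply]
  exact (isHomogeneous_pderiv_of_succ hf a).sub ((isHomogeneous_pderiv_of_succ hf b).C_mul _)

theorem isHomogeneous_dIsoBar {k : ℕ} {f : MvPolynomial (Fin n) ℂ}
    (hf : f.IsHomogeneous (k + 1)) (a b : Fin n) : (dIsoBar a b f).IsHomogeneous k := by
  rw [dIsoBar_apply]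
  exact (isHomogeneous_pderiv_of_succ hf a).add ((isHomogeneous_pderiv_of_succ hf b).C_mul _)

/-- The derivatives ∂_a − i∂_b, ∂_a + i∂_b and ∂_j shift the weight by −1, +1 and 0 and lower the
degree by one. In positive degree not all of them kill f, so induction on the degree bounds the
weight. -/
theorem abs_re_weight_le {a b : Fin n} (hab : a ≠ b) :
    ∀ {k : ℕ} {f : MvPolynomial (Fin n) ℂ} {α : ℂ}, f.IsHomogeneous k → f ≠ 0 →
      weightOp a b f = C α * f → |α.re| ≤ k := by
  intro k
  induction k with
  | zero =>
    intro f α hf h0 h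
    rw [weightOp_apply, rot_apply, pderiv_eq_zero_of_isHomogeneous_zero hf,
      pderiv_eq_zero_of_isHomogeneous_zero hf] at h
    have h1 : C α * f = 0 := by rw [← h]; simp
    have h2 : α = 0 := by simpa [h0] using h1
    simp [h2]
  | succ k ih =>
    intro f α hf h0 h
    by_contra hlt
    rw [Nat.cast_succ] at hlt
    have h1 : dIso a b f = 0 := by
      by_contra h1
      have := ih (α := α - 1) (isHomogeneous_dIso hf a b) h1
        (by rw [weightOp_dIso hab, h, derivation_C_mul, C_sub, C_1]; ring)
      rw [Complex.sub_re, Complex.one_re, abs_le] at this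
      exact hlt (abs_le.2 ⟨by linarith, by linarith⟩)
    have h2 : dIsoBar a b f = 0 := by
      by_contra h1
      have := ih (α := α + 1) (isHomogeneous_dIsoBar hf a b) h1
        (by rw [weightOp_dIsoBar hab, h, derivation_C_mul, C_add, C_1]; ring)
      rw [Complex.add_re, Complex.one_re, abs_le] at this
      exact hlt (abs_le.2 ⟨by linarith, by linarith⟩)
    refine h0 (eq_zero_of_pderiv_eq_zero hf fun j => ?_)
    by_cases hja : j = a
    · rw [hja, pderiv_left_eq a b, h1, h2, add_zero, mul_zero]
    by_cases hjb : j = b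
    · rw [hjb, pderiv_right_eq a b, h1, h2, sub_zero, mul_zero, mul_zero]
    by_contra h3
    have := ih (α := α) (isHomogeneous_pderiv_of_succ hf j) h3
      (by rw [weightOp_pderiv hja hjb, h, derivation_C_mul])
    exact hlt (this.trans (by linarith))

/-- Such an f depends only on z_a + i z_b. By induction ∂_a f − i∂_b f is a multiple of its k-th
power, and Euler's identity recovers f. -/
theorem eq_C_mul_isoX_pow {a b : Fin n} (hab : a ≠ b) :
    ∀ {k : ℕ} {f : MvPolynomial (Fin n) ℂ}, f.IsHomogeneous k → dIsoBar a b f = 0 →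
      (∀ j, j ≠ a → j ≠ b → pderiv j f = 0) → ∃ c, f = C c * isoX a b ^ k := by
  intro k
  induction k with
  | zero =>
    intro f hf _ _
    exact ⟨_, by
      rw [pow_zero, mul_one]
      exact totalDegree_eq_zero_iff_eq_C.1 ((totalDegree_zero_iff_isHomogeneous _).2 hf)⟩
  | succ k ih =>
    intro f hf h1 h2
    have h3 : dIsoBar a b (dIso a b f) = dIso a b (dIsoBar a b f) := by
      simp only [dIso_apply, dIsoBar_apply, map_add, map_sub, derivation_C_mul, pderiv_comm b a]
      ring
    obtain ⟨c, hc⟩ := ih (isHomogeneous_dIso hf a b) (by rw [h3, h1, map_zero]) fun j hja hjb => by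
      rw [dIso_apply, map_sub, derivation_C_mul, pderiv_comm j a, pderiv_comm j b, h2 j hja hjb]
      simp
    have h4 := euler_of_isHomogeneous hf
    rw [euler_apply, Fintype.sum_eq_add a b hab (fun j hj => by rw [h2 j hj.1 hj.2, mul_zero]),
      pderiv_left_eq a b, pderiv_right_eq a b f, h1, hc, add_zero, sub_zero] at h4
    refine ⟨((k : ℂ) + 1)⁻¹ * (1 / 2 * c), ?_⟩
    have h5 : C ((k : ℂ) + 1)⁻¹ * (k + 1 : MvPolynomial (Fin n) ℂ) = 1 := by
      rw [← map_natCast (C : ℂ →+* MvPolynomial (Fin n) ℂ), ← C_1, ← C_add, ← C_mul,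
        inv_mul_cancel₀ (by exact_mod_cast k.succ_ne_zero)]
    rw [C_mul, C_mul]
    push_cast at h4
    have h6 : ((k : MvPolynomial (Fin n) ℂ) + 1) * f = C (1 / 2) * C c * isoX a b ^ (k + 1) := by
      rw [← h4, isoX]; ring
    linear_combination (-f) * h5 + C ((k : ℂ) + 1)⁻¹ * h6

theorem isoX_ne_zero {a b : Fin n} (hab : a ≠ b) : isoX a b ≠ 0 := by
  intro h
  have h2 := congrArg (eval (Pi.single a (1 : ℂ))) h
  simp [isoX, hab.symm] at h2

/-- It is enough that g = (∂_a + i∂_b) f vanishes: the raising equations then kill every ∂_j f with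
j ≠ a, b. -/
theorem highest_weight_eq (hn : 3 ≤ n) {a b : Fin n} (hab : a ≠ b) {k : ℕ}
    {f : MvPolynomial (Fin n) ℂ} (hf : f ∈ harmonicPoly n k) {α : ℂ}
    (hα : weightOp a b f = C α * f) (hr : ∀ j, j ≠ a → j ≠ b → raiseOp a b j f = 0) :
    ∃ c, f = C c * isoX a b ^ k := by
  obtain ⟨h1, h2⟩ := mem_harmonicPoly.1 hf
  rcases eq_or_ne f 0 with rfl | h0
  · exact ⟨0, by simp⟩
  have hre := abs_re_weight_le hab h1 h0 hα
  set g := dIsoBar a b f with hg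
  set s : Finset (Fin n) := (Finset.univ.erase a).erase b with hs
  have hsplit : ∀ F : Fin n → MvPolynomial (Fin n) ℂ, ∑ j, F j = F a + (F b + ∑ j ∈ s, F j) := by
    intro F
    rw [hs, Finset.add_sum_erase _ _ (Finset.mem_erase.2 ⟨hab.symm, Finset.mem_univ _⟩),
      Finset.add_sum_erase _ _ (Finset.mem_univ _)]
  have hcard : (s.card : MvPolynomial (Fin n) ℂ) = n - 2 := by
    rw [hs, Finset.card_erase_of_mem (Finset.mem_erase.2 ⟨hab.symm, Finset.mem_univ _⟩),
      Finset.card_erase_of_mem (Finset.mem_univ _), Finset.card_univ, Fintype.card_fin,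
      Nat.sub_sub, Nat.cast_sub (by omega)]
    norm_num
  have hmem : ∀ j ∈ s, j ≠ a ∧ j ≠ b := by
    intro j hj
    rw [hs, Finset.mem_erase, Finset.mem_erase] at hj
    exact ⟨hj.2.1, hj.1⟩
  have h3 : ∀ j, j ≠ a → j ≠ b → isoX a b * pderiv j f = X j * g := by
    intro j hja hjb
    have := hr j hja hjb
    rw [raiseOp_apply] at this
    exact sub_eq_zero.1 this
  have h4 : ∀ j ∈ s, isoX a b * pderiv j (pderiv j f) = g + X j * pderiv j g := by
    intro j hj
    obtain ⟨hja, hjb⟩ := hmem j hj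
    have h5 := congrArg (pderiv j) (h3 j hja hjb)
    rw [Derivation.leibniz, Derivation.leibniz, pderiv_X_self] at h5
    have h6 : pderiv j (isoX a b) = 0 := by
      rw [isoX, map_add, derivation_C_mul, pderiv_X_eq_ite, pderiv_X_eq_ite]
      simp [hja.symm, hjb.symm]
    rw [h6] at h5
    simp only [smul_eq_mul, mul_zero, add_zero, mul_one] at h5
    rw [h5, add_comm]
  have h5 := Finset.sum_congr (rfl : s = s) h4
  rw [← Finset.mul_sum, Finset.sum_add_distrib, Finset.sum_const, nsmul_eq_mul, hcard] at h5
  have h6 := h2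
  rw [laplacian_apply, hsplit] at h6
  have h7 : euler n g = (k - 1) * g := by
    have h8 : ∀ i, euler n (pderiv i f) = (k - 1) * pderiv i f := by
      intro i
      have := derivation_bracket_apply (D₁ := euler n) (D₂ := pderiv i) (D₃ := -pderiv i)
        (fun l => by
          rw [euler_X, pderiv_X_eq_ite, Derivation.neg_apply, pderiv_X_eq_ite]
          split_ifs <;> simp) f
      rw [this, euler_of_isHomogeneous h1, Derivation.neg_apply, ← nsmul_eq_mul, map_nsmul,
        nsmul_eq_mul]
      ring
    rw [hg, dIsoBar_apply, map_add, derivation_C_mul, h8, h8]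
    ring
  rw [euler_apply, hsplit] at h7
  have h8 : weightOp a b g = (C α + 1) * g := by
    rw [hg, weightOp_dIsoBar hab, hα, derivation_C_mul]
    ring
  rw [weightOp_apply, rot_apply] at h8
  have h9 : pderiv a (pderiv a f) + pderiv b (pderiv b f) = dIso a b g := by
    rw [hg, dIso_apply, dIsoBar_apply, map_add, map_add, derivation_C_mul, derivation_C_mul,
      pderiv_comm b a]
    linear_combination (pderiv b (pderiv b f)) * C_I_mul_C_I (n := n)
  rw [dIso_apply] at h9
  -- Summing the differentiated raising equations gives (z_a + i z_b) ∑_{j≠a,b} ∂_j² f = (n−2) g +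
  -- ∑_{j≠a,b} z_j ∂_j g. Harmonicity turns the left side into −(z_a + i z_b)(∂_a − i∂_b) g, which
  -- the weight and the degree of g express through multiples of g.
  have h10 : C (α + k + n - 2) * g = 0 := by
    simp only [C_add, C_sub, map_natCast, map_ofNat]
    rw [isoX] at h5
    linear_combination (-1 : MvPolynomial (Fin n) ℂ) * h5 + (X a + C Complex.I * X b) * h6
      - h7 - h8 - (X a + C Complex.I * X b) * h9 + X b * pderiv b g * C_I_mul_C_I (n := n)
  have h11 : g = 0 := by
    -- Since Re α ≥ −k, the scalar has real part at least n − 2 > 0. For n = 2 the weight α = −k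
    -- would escape.
    refine (mul_eq_zero.1 h10).resolve_left fun h => ?_
    rw [C_eq_zero] at h
    have h12 := congrArg Complex.re h
    simp only [Complex.add_re, Complex.sub_re, Complex.natCast_re, Complex.re_ofNat,
      Complex.zero_re] at h12
    have h13 : (3 : ℝ) ≤ n := by exact_mod_cast hn
    linarith [(abs_le.1 hre).1]
  refine eq_C_mul_isoX_pow hab h1 h11 fun j hja hjb => ?_
  have := h3 j hja hjb
  rw [h11, mul_zero] at this
  exact (mul_eq_zero.1 this).resolve_left (isoX_ne_zero hab)

/-! ### Rotation-stable subspaces and Schur's lemma -/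

instance finiteDimensional_harmonicPoly (n k : ℕ) : FiniteDimensional ℂ (harmonicPoly n k) := by
  have : FiniteDimensional ℂ (homogeneousSubmodule (Fin n) ℂ k) :=
    Module.Finite.iff_fg.2 (homogeneousSubmodule_fg (Fin n) ℂ k)
  exact Submodule.finiteDimensional_of_le inf_le_left

/-- A stable subspace contains a weight vector. Raising it must stop, as weights are bounded by k,
and it stops at a highest weight vector, which is unique up to scalars. -/
theorem isoX_pow_mem (hn : 3 ≤ n) {a b : Fin n} (hab : a ≠ b) {k : ℕ}
    {W : Submodule ℂ (MvPolynomial (Fin n) ℂ)} (hW : W ≤ harmonicPoly n k) (hW0 : W ≠ ⊥)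
    (hrot : ∀ i j, ∀ f ∈ W, rot i j f ∈ W) : isoX a b ^ k ∈ W := by
  have hC : ∀ (c : ℂ) f, f ∈ W → C c * f ∈ W := fun c f hf => by
    rw [C_mul']; exact W.smul_mem c hf
  have hH : ∀ f ∈ W, weightOp a b f ∈ W := fun f hf => by
    rw [weightOp_apply]; exact W.neg_mem (hC _ _ (hrot a b f hf))
  have hraise : ∀ j, ∀ f ∈ W, raiseOp a b j f ∈ W := fun j f hf => by
    have : raiseOp a b j f = rot a j f + C Complex.I * rot b j f := by simp [raiseOp]
    rw [this]
    exact W.add_mem (hrot a j f hf) (hC _ _ (hrot b j f hf))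
  -- The number m bounds the distance k − Re α to the top weight; each raising shortens this
  -- distance by one.
  have key : ∀ (m : ℕ) (f : MvPolynomial (Fin n) ℂ) (α : ℂ), f ∈ W → f ≠ 0 →
      weightOp a b f = C α * f → k - α.re < m → isoX a b ^ k ∈ W := by
    intro m
    induction m with
    | zero =>
      intro f α hf h0 hα hlt
      have := abs_re_weight_le hab (mem_harmonicPoly.1 (hW hf)).1 h0 hα
      rw [Nat.cast_zero] at hlt
      linarith [(abs_le.1 this).2]
    | succ m ih =>
      intro f α hf h0 hα hlt
      by_cases hr : ∀ j, j ≠ a → j ≠ b → raiseOp a b j f = 0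
      · obtain ⟨c, rfl⟩ := highest_weight_eq hn hab (hW hf) hα hr
        have hc : c ≠ 0 := by rintro rfl; simp at h0
        have := hC c⁻¹ _ hf
        rwa [← mul_assoc, ← C_mul, inv_mul_cancel₀ hc, C_1, one_mul] at this
      · push Not at hr
        obtain ⟨j, hja, hjb, hj⟩ := hr
        refine ih (raiseOp a b j f) (α + 1) (hraise j f hf) hj ?_ ?_
        · rw [weightOp_raiseOp hab hja hjb, hα, derivation_C_mul, C_add, C_1]
          ring
        · rw [Complex.add_re, Complex.one_re]
          push_cast at hlt
          linarith
  have : FiniteDimensional ℂ W := Submodule.finiteDimensional_of_le hW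
  have : Nontrivial W := Submodule.nontrivial_iff_ne_bot.2 hW0
  obtain ⟨α, hα⟩ := Module.End.exists_eigenvalue
    (((weightOp a b : MvPolynomial (Fin n) ℂ →ₗ[ℂ] MvPolynomial (Fin n) ℂ)).restrict hH)
  obtain ⟨f, hf⟩ := hα.exists_hasEigenvector
  obtain ⟨m, hm⟩ := exists_nat_gt ((k : ℝ) - α.re)
  refine key m f α f.2 (by simpa using hf.2) ?_ hm
  have := congrArg Subtype.val hf.apply_eq_smul
  rw [C_mul']
  simpa using this

/-- Schur's lemma for invariant forms on `H^k q^m`. -/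
theorem RotInvariant.eq_smul (hn : 3 ≤ n)
    {B B' : MvPolynomial (Fin n) ℂ →ₗ[ℂ] MvPolynomial (Fin n) ℂ →ₗ⋆[ℂ] ℂ}
    (hB : RotInvariant B) (hB' : RotInvariant B') {k m : ℕ}
    (haniso : ∀ p ∈ harmonicPoly n k, B (p * quad n ^ m) (p * quad n ^ m) = 0 → p = 0)
    {c : ℂ} {p₀ : MvPolynomial (Fin n) ℂ} (hp₀ : p₀ ∈ harmonicPoly n k) (h0 : p₀ ≠ 0)
    (hc : ∀ q ∈ harmonicPoly n k,
      B' (p₀ * quad n ^ m) (q * quad n ^ m) = c * B (p₀ * quad n ^ m) (q * quad n ^ m)) :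
    ∀ p ∈ harmonicPoly n k, ∀ q ∈ harmonicPoly n k,
      B' (p * quad n ^ m) (q * quad n ^ m) = c * B (p * quad n ^ m) (q * quad n ^ m) := by
  have hab : (⟨0, by omega⟩ : Fin n) ≠ ⟨1, by omega⟩ := by simp
  -- W is where the two forms are proportional with ratio c. Skewness of both forms makes it stable,
  -- and it contains p₀.
  let W : Submodule ℂ (MvPolynomial (Fin n) ℂ) :=
    { carrier := {p | p ∈ harmonicPoly n k ∧ ∀ q ∈ harmonicPoly n k,
        B' (p * quad n ^ m) (q * quad n ^ m) = c * B (p * quad n ^ m) (q * quad n ^ m)}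
      zero_mem' := ⟨zero_mem _, fun q _ => by simp⟩
      add_mem' := fun {p p'} hp hp' => ⟨add_mem hp.1 hp'.1, fun q hq => by
        simp only [add_mul, map_add, LinearMap.add_apply, hp.2 q hq, hp'.2 q hq, mul_add]⟩
      smul_mem' := fun d p hp => ⟨Submodule.smul_mem _ d hp.1, fun q hq => by
        simp only [smul_mul_assoc, map_smul, LinearMap.smul_apply, hp.2 q hq, smul_eq_mul]
        ring⟩ }
  have hWrot : ∀ i j, ∀ f ∈ W, rot i j f ∈ W := fun i j f hf =>
    ⟨rot_mem_harmonicPoly hf.1 i j, fun q hq => by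
      rw [← rot_mul_quad_pow, hB', hB, rot_mul_quad_pow, hf.2 _ (rot_mem_harmonicPoly hq i j)]
      ring⟩
  have hWle : W ≤ harmonicPoly n k := fun p hp => hp.1
  have hw : isoX ⟨0, by omega⟩ ⟨1, by omega⟩ ^ k ∈ W :=
    isoX_pow_mem hn hab hWle ((Submodule.ne_bot_iff _).2 ⟨p₀, ⟨hp₀, hc⟩, h0⟩) hWrot
  -- W' is the B-orthogonal complement of W, again stable. If it were nonzero, it would share the
  -- highest weight vector with W, against anisotropy.
  let W' : Submodule ℂ (MvPolynomial (Fin n) ℂ) :=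
    { carrier := {p | p ∈ harmonicPoly n k ∧ ∀ q ∈ W, B (p * quad n ^ m) (q * quad n ^ m) = 0}
      zero_mem' := ⟨zero_mem _, fun q _ => by simp⟩
      add_mem' := fun {p p'} hp hp' => ⟨add_mem hp.1 hp'.1, fun q hq => by
        simp only [add_mul, map_add, LinearMap.add_apply, hp.2 q hq, hp'.2 q hq, add_zero]⟩
      smul_mem' := fun d p hp => ⟨Submodule.smul_mem _ d hp.1, fun q hq => by
        simp only [smul_mul_assoc, map_smul, LinearMap.smul_apply, hp.2 q hq, smul_zero]⟩ }
  have hW'rot : ∀ i j, ∀ f ∈ W', rot i j f ∈ W' := fun i j f hf =>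
    ⟨rot_mem_harmonicPoly hf.1 i j, fun q hq => by
      rw [← rot_mul_quad_pow, hB, rot_mul_quad_pow, hf.2 _ (hWrot i j q hq), neg_zero]⟩
  have hW'le : W' ≤ harmonicPoly n k := fun p hp => hp.1
  have hW'bot : W' = ⊥ := by
    by_contra hne
    have h1 := isoX_pow_mem hn hab hW'le hne hW'rot
    exact pow_ne_zero k (isoX_ne_zero hab) (haniso _ (hWle hw) (h1.2 _ hw))
  -- Were W proper, being B-orthogonal to a basis of W would impose fewer than dim H^k linear
  -- conditions, so W' would be nonzero.
  have hWeq : W = harmonicPoly n k := by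
    by_contra hne
    have hlt : W < harmonicPoly n k := lt_of_le_of_ne hWle hne
    have : FiniteDimensional ℂ W := Submodule.finiteDimensional_of_le hWle
    have hfin := Submodule.finrank_lt_finrank_of_lt hlt
    let bas := Module.finBasis ℂ W
    let φ : harmonicPoly n k →ₗ[ℂ] (Fin (Module.finrank ℂ W) → ℂ) :=
      { toFun := fun p i => B (p * quad n ^ m) ((bas i : MvPolynomial (Fin n) ℂ) * quad n ^ m)
        map_add' := fun p p' => by
          funext i
          simp [add_mul]
        map_smul' := fun d p => by
          funext i
          simp }
    have hker : LinearMap.ker φ ≠ ⊥ :=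
      LinearMap.ker_ne_bot_of_finrank_lt (by rwa [Module.finrank_fin_fun])
    obtain ⟨p, hp, hp0⟩ := (Submodule.ne_bot_iff _).1 hker
    have hpW' : (p : MvPolynomial (Fin n) ℂ) ∈ W' := by
      refine ⟨p.2, fun q hq => ?_⟩
      have h2 := bas.sum_repr ⟨q, hq⟩
      have h3 := congrArg Subtype.val h2
      simp only [Submodule.coe_sum, Submodule.coe_smul] at h3
      rw [← h3, Finset.sum_mul, map_sum]
      refine Finset.sum_eq_zero fun i _ => ?_
      have h4 : B (p * quad n ^ m) ((bas i : MvPolynomial (Fin n) ℂ) * quad n ^ m) = 0 :=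
        congrFun (LinearMap.mem_ker.1 hp) i
      rw [smul_mul_assoc, map_smulₛₗ, h4, smul_zero]
    rw [hW'bot, Submodule.mem_bot] at hpW'
    exact hp0 (Subtype.ext hpW')
  intro p hp
  rw [← hWeq] at hp
  exact hp.2

end HighestWeight

end CartanIV

namespace CartanIV

/-! ## Wirtinger calculus -/

section Wirtinger

variable {n : ℕ}

/-- The real linear functional `u ↦ ∑ (P_j u_j + Q_j conj u_j)`. -/
def wirtCLM (P Q : Fin n → ℂ) : (Fin n → ℂ) →L[ℝ] ℂ :=
  ∑ j, (P j • (ContinuousLinearMap.proj j : (Fin n → ℂ) →L[ℝ] ℂ)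
    + Q j • ((Complex.conjCLE : ℂ →L[ℝ] ℂ) ∘L (ContinuousLinearMap.proj j : (Fin n → ℂ) →L[ℝ] ℂ)))

theorem wirtCLM_apply (P Q u : Fin n → ℂ) :
    wirtCLM P Q u = ∑ j, (P j * u j + Q j * conj (u j)) := by
  simp [wirtCLM]

/-- `F` is real differentiable at `z` with Wirtinger derivatives `P` and `Q`. -/
def HasWirtAt (F : (Fin n → ℂ) → ℂ) (P Q z : Fin n → ℂ) : Prop := HasFDerivAt F (wirtCLM P Q) z

variable {F G : (Fin n → ℂ) → ℂ} {P Q P' Q' z : Fin n → ℂ}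

theorem HasWirtAt.congr_coeff (h : HasWirtAt F P Q z) (hP : ∀ j, P j = P' j) (hQ : ∀ j, Q j = Q' j) :
    HasWirtAt F P' Q' z := by
  rwa [← funext hP, ← funext hQ]

theorem HasWirtAt.wirtinger_eq (h : HasWirtAt F P Q z) (j : Fin n) : wirtinger j F z = P j := by
  rw [wirtinger, HasFDerivAt.fderiv h, wirtCLM_apply, wirtCLM_apply,
    Finset.sum_eq_single j (fun i _ hi => by simp [hi]) (by simp),
    Finset.sum_eq_single j (fun i _ hi => by simp [hi]) (by simp)]
  simp only [Pi.single_eq_same, map_one, mul_one, Complex.conj_I]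
  linear_combination ((Q j - P j) / 2) * Complex.I_mul_I

theorem HasWirtAt.wirtingerBar_eq (h : HasWirtAt F P Q z) (j : Fin n) :
    wirtingerBar j F z = Q j := by
  rw [wirtingerBar, HasFDerivAt.fderiv h, wirtCLM_apply, wirtCLM_apply,
    Finset.sum_eq_single j (fun i _ hi => by simp [hi]) (by simp),
    Finset.sum_eq_single j (fun i _ hi => by simp [hi]) (by simp)]
  simp only [Pi.single_eq_same, map_one, mul_one, Complex.conj_I]
  linear_combination (-(Q j - P j) / 2) * Complex.I_mul_I

theorem hasWirtAt_const (c : ℂ) (z : Fin n → ℂ) : HasWirtAt (fun _ => c) 0 0 z := by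
  refine (hasFDerivAt_const c z).congr_fderiv ?_
  ext u
  simp [wirtCLM_apply]

theorem hasWirtAt_coord (j : Fin n) (z : Fin n → ℂ) :
    HasWirtAt (fun w => w j) (Pi.single j 1) 0 z := by
  refine (ContinuousLinearMap.proj (R := ℝ) (φ := fun _ : Fin n => ℂ) j).hasFDerivAt.congr_fderiv ?_
  ext u
  simp [wirtCLM_apply, Pi.single_apply]

theorem hasWirtAt_conj_coord (j : Fin n) (z : Fin n → ℂ) :
    HasWirtAt (fun w => conj (w j)) 0 (Pi.single j 1) z := by
  refine ((Complex.conjCLE : ℂ →L[ℝ] ℂ) ∘L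
    (ContinuousLinearMap.proj (R := ℝ) (φ := fun _ : Fin n => ℂ) j)).hasFDerivAt.congr_fderiv ?_
  ext u
  simp [wirtCLM_apply, Pi.single_apply]

theorem HasWirtAt.add (hF : HasWirtAt F P Q z) (hG : HasWirtAt G P' Q' z) :
    HasWirtAt (fun w => F w + G w) (P + P') (Q + Q') z := by
  refine (HasFDerivAt.add hF hG).congr_fderiv ?_
  ext u
  simp only [wirtCLM_apply, _root_.add_apply, ← Finset.sum_add_distrib, Pi.add_apply]
  exact Finset.sum_congr rfl fun j _ => by ring

theorem HasWirtAt.mul (hF : HasWirtAt F P Q z) (hG : HasWirtAt G P' Q' z) :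
    HasWirtAt (fun w => F w * G w) (F z • P' + G z • P) (F z • Q' + G z • Q) z := by
  refine (HasFDerivAt.mul hF hG).congr_fderiv ?_
  ext u
  simp only [wirtCLM_apply, _root_.add_apply, _root_.smul_apply,
    smul_eq_mul, Finset.mul_sum, ← Finset.sum_add_distrib, Pi.add_apply, Pi.smul_apply]
  exact Finset.sum_congr rfl fun j _ => by ring

theorem HasWirtAt.const_mul (c : ℂ) (hF : HasWirtAt F P Q z) :
    HasWirtAt (fun w => c * F w) (c • P) (c • Q) z :=
  ((hasWirtAt_const c z).mul hF).congr_coeff (by simp) (by simp)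

theorem HasWirtAt.sub (hF : HasWirtAt F P Q z) (hG : HasWirtAt G P' Q' z) :
    HasWirtAt (fun w => F w - G w) (P - P') (Q - Q') z := by
  refine (HasFDerivAt.sub hF hG).congr_fderiv ?_
  ext u
  simp only [wirtCLM_apply, _root_.sub_apply, ← Finset.sum_sub_distrib, Pi.sub_apply]
  exact Finset.sum_congr rfl fun j _ => by ring

theorem HasWirtAt.sum {ι : Type*} {s : Finset ι} {F : ι → (Fin n → ℂ) → ℂ} {P Q : ι → Fin n → ℂ}
    (h : ∀ i ∈ s, HasWirtAt (F i) (P i) (Q i) z) :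
    HasWirtAt (fun w => ∑ i ∈ s, F i w) (∑ i ∈ s, P i) (∑ i ∈ s, Q i) z := by
  refine (HasFDerivAt.fun_sum h).congr_fderiv ?_
  ext u
  simp only [wirtCLM_apply, _root_.sum_apply, Finset.sum_apply, Finset.sum_mul,
    ← Finset.sum_add_distrib]
  exact Finset.sum_comm

theorem HasWirtAt.comp_hasDerivAt {g : ℂ → ℂ} {g' : ℂ} (hg : HasDerivAt g g' (F z))
    (hF : HasWirtAt F P Q z) : HasWirtAt (fun w => g (F w)) (g' • P) (g' • Q) z := by
  refine ((hg.hasFDerivAt.restrictScalars ℝ).comp z hF).congr_fderiv ?_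
  ext u
  simp only [wirtCLM_apply, ContinuousLinearMap.comp_apply, Finset.sum_mul,
    ContinuousLinearMap.coe_restrictScalars', ContinuousLinearMap.toSpanSingleton_apply,
    smul_eq_mul, Pi.smul_apply]
  exact Finset.sum_congr rfl fun j _ => by ring

/-! ## The defining function and the Bergman metric -/

theorem conj_dot (z w : Fin n → ℂ) : conj (dot z w) = dot (fun j => conj (z j)) fun j => conj (w j) := by
  simp [dot]

theorem ofReal_absSq (z : Fin n → ℂ) : (absSq z : ℂ) = dot z fun j => conj (z j) := by
  simp [absSq, dot, Complex.mul_conj']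

theorem ofReal_norm_dot_sq (z : Fin n → ℂ) : ((‖dot z z‖ ^ 2 : ℝ) : ℂ) = dot z z * conj (dot z z) := by
  rw [Complex.mul_conj']
  norm_cast

theorem ofReal_Delta (z : Fin n → ℂ) :
    (Delta z : ℂ) = 1 - 2 * dot z (fun j => conj (z j)) + dot z z * conj (dot z z) := by
  rw [Delta, Complex.ofReal_add, ofReal_norm_dot_sq, Complex.ofReal_sub, Complex.ofReal_mul,
    ofReal_absSq]
  simp

theorem hasWirtAt_dot_self (z : Fin n → ℂ) : HasWirtAt (fun w => dot w w) ((2 : ℂ) • z) 0 z := by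
  refine (HasWirtAt.sum fun j (_ : j ∈ Finset.univ) =>
    (hasWirtAt_coord j z).mul (hasWirtAt_coord j z)).congr_coeff ?_ ?_
  · intro j
    simp [Finset.sum_add_distrib, Pi.single_apply, two_mul]
  · simp

theorem hasWirtAt_conj_dot_self (z : Fin n → ℂ) :
    HasWirtAt (fun w => conj (dot w w)) 0 ((2 : ℂ) • fun j => conj (z j)) z := by
  simp_rw [conj_dot]
  refine (HasWirtAt.sum fun j (_ : j ∈ Finset.univ) =>
    (hasWirtAt_conj_coord j z).mul (hasWirtAt_conj_coord j z)).congr_coeff ?_ ?_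
  · simp
  · intro j
    simp [Finset.sum_add_distrib, Pi.single_apply, two_mul]

theorem hasWirtAt_absSq (z : Fin n → ℂ) :
    HasWirtAt (fun w => dot w fun j => conj (w j)) (fun j => conj (z j)) z z := by
  refine (HasWirtAt.sum fun j (_ : j ∈ Finset.univ) =>
    (hasWirtAt_coord j z).mul (hasWirtAt_conj_coord j z)).congr_coeff ?_ ?_
  · intro j
    simp [Pi.single_apply]
  · intro j
    simp [Pi.single_apply]

/-- The derivative of `Δ` with respect to `z_j`. -/
def dDelta (z : Fin n → ℂ) (j : Fin n) : ℂ := -2 * conj (z j) + 2 * z j * conj (dot z z)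

/-- The derivative of `Δ` with respect to the conjugate of `z_j`. -/
def dDeltaBar (z : Fin n → ℂ) (j : Fin n) : ℂ := -2 * z j + 2 * dot z z * conj (z j)

theorem hasWirtAt_Delta (z : Fin n → ℂ) :
    HasWirtAt (fun w => (Delta w : ℂ)) (dDelta z) (dDeltaBar z) z := by
  simp_rw [ofReal_Delta]
  refine (((hasWirtAt_const 1 z).sub ((hasWirtAt_absSq z).const_mul 2)).add
    ((hasWirtAt_dot_self z).mul (hasWirtAt_conj_dot_self z))).congr_coeff ?_ ?_
  · intro j
    simp [dDelta]
    ring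
  · intro j
    simp [dDeltaBar]
    ring

theorem ofReal_Delta_ne_zero {z : Fin n → ℂ} (hz : z ∈ domain n) : (Delta z : ℂ) ≠ 0 :=
  Complex.ofReal_ne_zero.2 (Delta_pos hz).ne'

theorem log_bergmanKernel {z : Fin n → ℂ} (hz : z ∈ domain n) :
    Complex.log (bergmanKernel n z z) = -n * Complex.log (Delta z : ℂ) := by
  have hD := Delta_pos hz
  rw [bergmanKernel, ← ofReal_Delta, ← Complex.ofReal_pow, ← Complex.ofReal_inv,
    ← Complex.ofReal_log (by positivity), ← Complex.ofReal_log hD.le, Real.log_inv, Real.log_pow]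
  push_cast
  ring

theorem wirtingerBar_log_bergmanKernel {z : Fin n → ℂ} (hz : z ∈ domain n) (k : Fin n) :
    wirtingerBar k (fun w => Complex.log (bergmanKernel n w w)) z
      = -n * (dDeltaBar z k * (Delta z : ℂ)⁻¹) := by
  have hs : (Delta z : ℂ) ∈ Complex.slitPlane := Complex.ofReal_mem_slitPlane.2 (Delta_pos hz)
  have h := ((HasWirtAt.comp_hasDerivAt (Complex.hasDerivAt_log hs) (hasWirtAt_Delta z)).const_mul
    (-(n : ℂ)))
  have h2 : HasWirtAt (fun w => Complex.log (bergmanKernel n w w)) _ _ z :=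
    HasFDerivAt.congr_of_eventuallyEq h (by
      filter_upwards [(isOpen_domain n).mem_nhds hz] with w hw using log_bergmanKernel hw)
  rw [h2.wirtingerBar_eq]
  simp only [Pi.smul_apply, smul_eq_mul]
  ring

/-- Since log K = −n log Δ on the diagonal, the normalisation 1/(2n) leaves −½ ∂_j(∂̄_kΔ / Δ). -/
theorem metricCoeff_eq (hn : n ≠ 0) {z : Fin n → ℂ} (hz : z ∈ domain n) (j k : Fin n) :
    metricCoeff n j k z = -(1 / 2) *
      (((if j = k then -2 else 0) + 4 * z j * conj (z k)) / Delta z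
        - dDelta z j * dDeltaBar z k / (Delta z : ℂ) ^ 2) := by
  have hD := ofReal_Delta_ne_zero hz
  have h1 : HasWirtAt (fun w => dDeltaBar w k) _ _ z :=
    ((hasWirtAt_coord k z).const_mul (-2)).add
      (((hasWirtAt_dot_self z).const_mul 2).mul (hasWirtAt_conj_coord k z))
  have h2 := ((h1.mul (HasWirtAt.comp_hasDerivAt (hasDerivAt_inv hD) (hasWirtAt_Delta z))).const_mul
    (-(n : ℂ)))
  have h3 : HasWirtAt
      (wirtingerBar k fun w => Complex.log (bergmanKernel n w w)) _ _ z :=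
    HasFDerivAt.congr_of_eventuallyEq h2 (by
      filter_upwards [(isOpen_domain n).mem_nhds hz] with w hw using
        wirtingerBar_log_bergmanKernel hw k)
  have hn' : (n : ℂ) ≠ 0 := Nat.cast_ne_zero.2 hn
  rw [metricCoeff, h3.wirtinger_eq]
  simp only [Pi.smul_apply, Pi.add_apply, smul_eq_mul, Pi.zero_apply, Pi.single_apply, mul_zero,
    zero_add]
  by_cases hjk : j = k
  · simp only [hjk, if_true]
    field_simp
    ring
  · simp only [hjk, if_false]
    field_simp
    ring

/-! ## The moment map -/

theorem hasWirtAt_momentMapSO2 {z : Fin n → ℂ} (hz : z ∈ domain n) :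
    HasWirtAt (fun w => (momentMapSO2 n w : ℂ))
      (fun j => ((2 * z j * conj (dot z z) - conj (z j)) * Delta z
        - (dot z z * conj (dot z z) - dot z fun j => conj (z j)) * dDelta z j) / (Delta z : ℂ) ^ 2)
      (fun j => ((2 * dot z z * conj (z j) - z j) * Delta z
        - (dot z z * conj (dot z z) - dot z fun j => conj (z j)) * dDeltaBar z j)
          / (Delta z : ℂ) ^ 2) z := by
  have hD := ofReal_Delta_ne_zero hz
  have hF : (fun w : Fin n → ℂ => (momentMapSO2 n w : ℂ)) = fun w =>
      (dot w w * conj (dot w w) - dot w fun j => conj (w j)) * (Delta w : ℂ)⁻¹ := by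
    funext w
    rw [momentMapSO2, Complex.ofReal_div, Complex.ofReal_sub, ofReal_norm_dot_sq, ofReal_absSq,
      div_eq_mul_inv, Delta]
    congr 3
    ring
  rw [hF]
  refine ((((hasWirtAt_dot_self z).mul (hasWirtAt_conj_dot_self z)).sub (hasWirtAt_absSq z)).mul
    (HasWirtAt.comp_hasDerivAt (hasDerivAt_inv hD) (hasWirtAt_Delta z))).congr_coeff ?_ ?_
  · intro j
    simp
    field_simp
    ring
  · intro j
    simp
    field_simp
    ring

/-- The right side is −∂̄_k μ as in `hasWirtAt_momentMapSO2`. Conceptually, μ = ½ ∑ z_j ∂_j log Δ,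
and ∂̄_k passes through the holomorphic factors z_j. -/
theorem sum_metricCoeff_mul (hn : n ≠ 0) {z : Fin n → ℂ} (hz : z ∈ domain n) (k : Fin n) :
    ∑ j, metricCoeff n j k z * z j = -(((2 * dot z z * conj (z k) - z k) * Delta z
        - (dot z z * conj (dot z z) - dot z fun j => conj (z j)) * dDeltaBar z k)
          / (Delta z : ℂ) ^ 2) := by
  have hD := ofReal_Delta_ne_zero hz
  have h1 : ∑ j, dDelta z j * z j
      = -2 * dot z (fun j => conj (z j)) + 2 * dot z z * conj (dot z z) := by
    simp only [dDelta]
    generalize conj (dot z z) = s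
    simp only [dot, Finset.mul_sum, Finset.sum_mul, ← Finset.sum_add_distrib]
    exact Finset.sum_congr rfl fun j _ => by ring
  have h2 : ∑ j, metricCoeff n j k z * z j = -(1 / 2) *
      ((-2 * z k + 4 * dot z z * conj (z k)) / Delta z
        - (∑ j, dDelta z j * z j) * dDeltaBar z k / (Delta z : ℂ) ^ 2) := by
    have h3 : -2 * z k = ∑ j, (if j = k then -2 * z j else 0) := by simp
    have h4 : 4 * dot z z * conj (z k) = ∑ j, 4 * z j * conj (z k) * z j := by
      simp only [dot, Finset.mul_sum, Finset.sum_mul]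
      exact Finset.sum_congr rfl fun j _ => by ring
    rw [h3, h4, ← Finset.sum_add_distrib, Finset.sum_mul, Finset.sum_div, Finset.sum_div,
      ← Finset.sum_sub_distrib, Finset.mul_sum]
    refine Finset.sum_congr rfl fun j _ => ?_
    rw [metricCoeff_eq hn hz]
    split_ifs <;> ring
  rw [h2, h1]
  field_simp
  ring

theorem sum_metricCoeff_mul_conj (hn : n ≠ 0) {z : Fin n → ℂ} (hz : z ∈ domain n) (j : Fin n) :
    ∑ k, metricCoeff n j k z * conj (z k) = -(((2 * z j * conj (dot z z) - conj (z j)) * Delta z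
        - (dot z z * conj (dot z z) - dot z fun j => conj (z j)) * dDelta z j)
          / (Delta z : ℂ) ^ 2) := by
  have hD := ofReal_Delta_ne_zero hz
  have h1 : ∑ k, dDeltaBar z k * conj (z k)
      = -2 * dot z (fun j => conj (z j)) + 2 * dot z z * conj (dot z z) := by
    rw [conj_dot]
    simp only [dDeltaBar]
    generalize dot z z = s
    simp only [dot, Finset.mul_sum, ← Finset.sum_add_distrib]
    exact Finset.sum_congr rfl fun j _ => by ring
  have h2 : ∑ k, metricCoeff n j k z * conj (z k) = -(1 / 2) *
      ((-2 * conj (z j) + 4 * z j * conj (dot z z)) / Delta z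
        - dDelta z j * (∑ k, dDeltaBar z k * conj (z k)) / (Delta z : ℂ) ^ 2) := by
    have h3 : -2 * conj (z j) = ∑ k, (if j = k then -2 * conj (z k) else 0) := by simp
    have h4 : 4 * z j * conj (dot z z) = ∑ k, 4 * z j * conj (z k) * conj (z k) := by
      rw [conj_dot]
      simp only [dot, Finset.mul_sum]
      exact Finset.sum_congr rfl fun j _ => by ring
    rw [h3, h4, ← Finset.sum_add_distrib, Finset.mul_sum, Finset.sum_div, Finset.sum_div,
      ← Finset.sum_sub_distrib, Finset.mul_sum]
    refine Finset.sum_congr rfl fun k _ => ?_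
    rw [metricCoeff_eq hn hz]
    split_ifs <;> ring
  rw [h2, h1]
  field_simp
  ring

theorem inducedField_eq (X : ℝ) (z : Fin n → ℂ) : inducedField X z = (Complex.I * X) • z := by
  have h : HasDerivAt (fun r : ℝ => (Circle.exp (r * X) : ℂ) • z) ((Complex.I * X) • z) 0 := by
    have h1 : HasDerivAt (fun r : ℝ => Complex.exp (((r * X : ℝ) : ℂ) * Complex.I))
        (Complex.I * X) 0 := by
      have h2 : HasDerivAt (fun r : ℝ => ((r * X : ℝ) : ℂ) * Complex.I) (X * Complex.I) 0 := by
        have := (((hasDerivAt_id (0 : ℝ)).mul_const X).ofReal_comp).mul_const Complex.I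
        simpa using this
      have := h2.cexp
      simpa [mul_comm] using this
    simpa [Circle.coe_exp] using h1.smul_const z
  exact h.deriv

theorem contDiffOn_momentMapSO2 (n : ℕ) :
    ContDiffOn ℝ (⊤ : ℕ∞) (momentMapSO2 n) (domain n) := by
  have h1 : ContDiff ℝ (⊤ : ℕ∞) (absSq : (Fin n → ℂ) → ℝ) := by
    unfold absSq
    exact ContDiff.sum fun j _ => (contDiff_apply ℝ ℂ j).norm_sq ℝ
  have h2 : ContDiff ℝ (⊤ : ℕ∞) (fun z : Fin n → ℂ => ‖dot z z‖ ^ 2) := by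
    refine ContDiff.norm_sq ℝ ?_
    unfold dot
    exact ContDiff.sum fun j _ => (contDiff_apply ℝ ℂ j).mul (contDiff_apply ℝ ℂ j)
  refine ContDiffOn.div (h2.sub h1).contDiffOn
    ((contDiff_const.add h2).sub (contDiff_const.mul h1)).contDiffOn fun z hz => ?_
  have := hz.2
  exact ne_of_gt (by linarith)

theorem dot_smul_smul (c : ℂ) (z : Fin n → ℂ) : dot (c • z) (c • z) = c ^ 2 * dot z z := by
  simp only [dot, Finset.mul_sum, Pi.smul_apply, smul_eq_mul]
  exact Finset.sum_congr rfl fun j _ => by ring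

theorem absSq_smul (c : ℂ) (z : Fin n → ℂ) : absSq (c • z) = ‖c‖ ^ 2 * absSq z := by
  simp only [absSq, Finset.mul_sum, Pi.smul_apply, norm_smul, mul_pow]

theorem norm_dot_smul_smul (c : ℂ) (z : Fin n → ℂ) :
    ‖dot (c • z) (c • z)‖ ^ 2 = (‖c‖ ^ 2) ^ 2 * ‖dot z z‖ ^ 2 := by
  rw [dot_smul_smul, norm_mul, norm_pow]
  ring

theorem momentMapSO2_circle_smul (t : Circle) (z : Fin n → ℂ) :
    momentMapSO2 n ((t : ℂ) • z) = momentMapSO2 n z := by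
  rw [momentMapSO2, norm_dot_smul_smul, absSq_smul, Circle.norm_coe]
  simp [momentMapSO2]

theorem isMomentMapSO2_momentMapSO2 (hn : n ≠ 0) : IsMomentMapSO2 n (momentMapSO2 n) where
  smooth := contDiffOn_momentMapSO2 n
  equivariant t z _ := momentMapSO2_circle_smul t z
  hamiltonian X z hz u := by
    have hd : DifferentiableAt ℝ (momentMapSO2 n) z :=
      ((contDiffOn_momentMapSO2 n).contDiffAt ((isOpen_domain n).mem_nhds hz)).differentiableAt
        (by simp)
    have h1 : HasFDerivAt (fun w => (momentMapSO2 n w : ℂ))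
        (Complex.ofRealCLM ∘L fderiv ℝ (momentMapSO2 n) z) z :=
      Complex.ofRealCLM.hasFDerivAt.comp z hd.hasFDerivAt
    have h2 := congrArg (fun L => L u) (h1.unique (hasWirtAt_momentMapSO2 hz))
    simp only [ContinuousLinearMap.comp_apply, Complex.ofRealCLM_apply, wirtCLM_apply] at h2
    rw [fderiv_mul_const hd]
    simp only [_root_.smul_apply, smul_eq_mul, Complex.ofReal_mul]
    rw [h2, symplecticForm, inducedField_eq]
    -- The induced field is iXz. Its factor i and the i of ω multiply to −1, which cancels the minus
    -- sign of the contracted metric coefficients.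
    have h3 : ∑ j, ∑ k, metricCoeff n j k z *
        (((Complex.I * X) • z) j * conj (u k) - u j * conj (((Complex.I * X) • z) k))
        = Complex.I * X * (∑ k, (∑ j, metricCoeff n j k z * z j) * conj (u k)
          + ∑ j, (∑ k, metricCoeff n j k z * conj (z k)) * u j) := by
      simp only [Finset.sum_mul]
      rw [Finset.sum_comm (f := fun k j => metricCoeff n j k z * z j * conj (u k)),
        ← Finset.sum_add_distrib, Finset.mul_sum]
      refine Finset.sum_congr rfl fun j _ => ?_
      rw [← Finset.sum_add_distrib, Finset.mul_sum]
      refine Finset.sum_congr rfl fun k _ => ?_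
      simp only [Pi.smul_apply, smul_eq_mul, map_mul, Complex.conj_I, Complex.conj_ofReal]
      ring
    rw [h3]
    simp only [sum_metricCoeff_mul hn hz, sum_metricCoeff_mul_conj hn hz, neg_mul,
      Finset.sum_neg_distrib, Finset.sum_add_distrib]
    generalize ∑ k, _ / _ * conj (u k) = x
    generalize ∑ k, _ / _ * u k = y
    linear_combination (X * (x + y)) * Complex.I_mul_I

/-! ## The domain is balanced; uniqueness of the moment map -/

theorem norm_dot_self_le (z : Fin n → ℂ) : ‖dot z z‖ ≤ absSq z := by
  refine (norm_sum_le _ _).trans (le_of_eq ?_)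
  exact Finset.sum_congr rfl fun j _ => by rw [norm_mul, sq]

theorem absSq_nonneg (z : Fin n → ℂ) : 0 ≤ absSq z := Finset.sum_nonneg fun _ _ => by positivity

theorem smul_mem_domain {z : Fin n → ℂ} (hz : z ∈ domain n) {c : ℂ} (hc : ‖c‖ ≤ 1) :
    c • z ∈ domain n := by
  obtain ⟨h1, h2⟩ := hz
  have hs0 : 0 ≤ ‖c‖ ^ 2 := by positivity
  have hs1 : ‖c‖ ^ 2 ≤ 1 := pow_le_one₀ (norm_nonneg _) hc
  have ha := absSq_nonneg z
  have hb : ‖dot z z‖ ^ 2 ≤ absSq z ^ 2 := pow_le_pow_left₀ (norm_nonneg _) (norm_dot_self_le z) 2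
  rw [domain, mem_ofPred_eq, absSq_smul, norm_dot_smul_smul]
  set s := ‖c‖ ^ 2
  set a := absSq z
  set b := ‖dot z z‖ ^ 2
  refine ⟨by nlinarith, ?_⟩
  -- With a = |z|², b = |zᵀz|² and s = |c|², one has 1 − 2sa + s²b = (1 − 2a + b) + (1 − s)(2a − (1
  -- + s)b), and b ≤ a² ≤ a.
  have h3 : 0 ≤ (1 - s) * (2 * a - (1 + s) * b) := by
    refine mul_nonneg (by linarith) ?_
    have : 0 ≤ b := by positivity
    nlinarith
  nlinarith

theorem isPreconnected_domain (n : ℕ) : IsPreconnected (domain n) := by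
  rcases (domain n).eq_empty_or_nonempty with h | ⟨z, hz⟩
  · rw [h]; exact isPreconnected_empty
  refine (StarConvex.isPathConnected (a := 0) ?_ ?_).isConnected.isPreconnected
  · rw [starConvex_zero_iff (𝕜 := ℝ)]
    intro w hw a ha0 ha1
    have := smul_mem_domain hw (c := (a : ℂ)) (by rwa [Complex.norm_real, Real.norm_of_nonneg ha0])
    rwa [Complex.coe_smul] at this
  · simpa using smul_mem_domain hz (c := 0) (by simp)

/-- The Hamiltonian equation with X = 1 prescribes dμ, and the domain is connected. -/
theorem IsMomentMapSO2.exists_eq_add (hn : n ≠ 0) {μ : (Fin n → ℂ) → ℝ} (hμ : IsMomentMapSO2 n μ) :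
    ∃ c, ∀ z ∈ domain n, μ z = momentMapSO2 n z + c := by
  have hd : ∀ {ν : (Fin n → ℂ) → ℝ}, IsMomentMapSO2 n ν → ∀ z ∈ domain n, DifferentiableAt ℝ ν z :=
    fun hν z hz => (hν.smooth.contDiffAt ((isOpen_domain n).mem_nhds hz)).differentiableAt (by simp)
  have h0 := isMomentMapSO2_momentMapSO2 hn
  have key : ∀ z ∈ domain n, fderiv ℝ μ z = fderiv ℝ (momentMapSO2 n) z := by
    intro z hz
    ext u
    have h1 := hμ.hamiltonian 1 z hz u
    rw [← h0.hamiltonian 1 z hz u] at h1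
    simpa using h1
  obtain ⟨c, hc⟩ := (isOpen_domain n).exists_is_const_of_fderiv_eq_zero (isPreconnected_domain n)
    (f := fun z => μ z - momentMapSO2 n z)
    (fun z hz => ((hd hμ z hz).sub (hd h0 z hz)).differentiableWithinAt) (fun z hz => by
      rw [fderiv_fun_sub (hd hμ z hz) (hd h0 z hz), key z hz, sub_self]
      rfl)
  exact ⟨c, fun z hz => by linarith [hc z hz]⟩

end Wirtinger

end CartanIV

namespace CartanIV

/-! ## The weighted measure is finite -/

section Finiteness

/-- The extended valued function `|x|^(-s)`. -/
def negPow (s x : ℝ) : ℝ≥0∞ := ENNReal.ofReal |x| ^ (-s)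

theorem measurable_negPow (s : ℝ) : Measurable (negPow s) := by unfold negPow; fun_prop

variable {s : ℝ}

theorem negPow_neg (s x : ℝ) : negPow s (-x) = negPow s x := by rw [negPow, abs_neg, negPow]

theorem negPow_anti (hs : 0 < s) {x y : ℝ} (h : |x| ≤ |y|) : negPow s y ≤ negPow s x := by
  rw [negPow, negPow, ENNReal.rpow_neg, ENNReal.rpow_neg]
  exact ENNReal.inv_le_inv.2 (ENNReal.rpow_le_rpow (ENNReal.ofReal_le_ofReal h) hs.le)

theorem negPow_mul (s x y : ℝ) : negPow s (x * y) = negPow s x * negPow s y := by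
  rw [negPow, abs_mul, ENNReal.ofReal_mul (abs_nonneg x),
    ENNReal.mul_rpow_of_ne_top ENNReal.ofReal_ne_top ENNReal.ofReal_ne_top, negPow, negPow]

theorem negPow_le_inv (hs1 : s < 1) {x : ℝ} (hx : 0 < x) (hx1 : x ≤ 1) :
    negPow s x ≤ ENNReal.ofReal x⁻¹ := by
  rw [negPow, abs_of_pos hx, ENNReal.ofReal_rpow_of_pos hx, ← Real.rpow_neg_one]
  exact ENNReal.ofReal_le_ofReal (Real.rpow_le_rpow_of_exponent_ge hx hx1 (by linarith))

theorem lintegral_negPow_lt_top (hs1 : s < 1) :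
    ∫⁻ t in Icc (-1) 1, negPow s t < ⊤ := by
  have h1 : ∫⁻ t in Ioc 0 1, negPow s t < ⊤ := by
    have h := ((intervalIntegral.intervalIntegrable_rpow' (a := 0) (b := 1)
      (by linarith : -1 < -s)).1).lintegral_lt_top
    refine lt_of_le_of_lt (le_of_eq ?_) h
    refine setLIntegral_congr_fun measurableSet_Ioc fun t ht => ?_
    rw [negPow, abs_of_pos ht.1, ENNReal.ofReal_rpow_of_pos ht.1]
  have h2 : ∫⁻ t in Ico (-1) 0, negPow s t < ⊤ := by
    have := (Measure.measurePreserving_neg (volume : Measure ℝ)).setLIntegral_comp_preimage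
      (s := Ioc 0 1) measurableSet_Ioc (measurable_negPow s)
    simp only [negPow_neg] at this
    have h3 : (Neg.neg ⁻¹' Ioc 0 1 : Set ℝ) = Ico (-1) 0 := by
      ext x
      simp only [mem_preimage, mem_Ioc, mem_Ico]
      constructor <;> rintro ⟨h, h'⟩ <;> constructor <;> linarith
    rw [h3] at this
    rwa [this]
  have hsub : Icc (-1 : ℝ) 1 ⊆ (Ico (-1) 0 ∪ {0}) ∪ Ioc 0 1 := by
    intro x hx
    rcases lt_trichotomy x 0 with h | h | h
    · exact Or.inl (Or.inl ⟨hx.1, h⟩)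
    · exact Or.inl (Or.inr h)
    · exact Or.inr ⟨h, hx.2⟩
  calc _ ≤ ∫⁻ t in (Ico (-1) 0 ∪ {0}) ∪ Ioc 0 1, negPow s t := lintegral_mono_set hsub
    _ ≤ ((∫⁻ t in Ico (-1) 0, negPow s t) + ∫⁻ t in ({0} : Set ℝ), negPow s t)
        + ∫⁻ t in Ioc 0 1, negPow s t :=
      (lintegral_union_le _ _ _).trans (add_le_add_left (lintegral_union_le _ _ _) _)
    _ < ⊤ := by
      rw [setLIntegral_measure_zero {0} _ (by simp), add_zero]
      exact ENNReal.add_lt_top.2 ⟨h2, h1⟩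

/-- Away from |t − c| ≤ 1 the integrand is at most 1. The bound does not depend on the location c of
the singularity. -/
theorem setLIntegral_negPow_sub_le (hs : 0 < s) (c : ℝ) (A : Set ℝ) :
    ∫⁻ t in A, negPow s (t - c) ≤ (∫⁻ t in Icc (-1) 1, negPow s t) + volume A := by
  have hle : ∀ x, negPow s x ≤ (Icc (-1) 1).indicator (negPow s) x + 1 := by
    intro x
    by_cases hx : x ∈ Icc (-1 : ℝ) 1
    · rw [indicator_of_mem hx]; exact le_self_add
    · rw [indicator_of_notMem hx, zero_add]
      have h1 : |(1 : ℝ)| ≤ |x| := by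
        rw [abs_one]
        by_contra h
        exact hx (abs_le.1 (not_le.1 h).le)
      refine (negPow_anti hs h1).trans ?_
      simp [negPow]
  calc _ ≤ ∫⁻ t in A, ((Icc (-1) 1).indicator (negPow s) (t - c) + 1) :=
        lintegral_mono fun t => hle _
    _ = (∫⁻ t in A, (Icc (-1) 1).indicator (negPow s) (t - c)) + volume A := by
        rw [lintegral_add_right _ measurable_const, setLIntegral_const, one_mul]
    _ ≤ (∫⁻ t, (Icc (-1) 1).indicator (negPow s) (t - c)) + volume A :=
        add_le_add_left (setLIntegral_le_lintegral _ _) _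
    _ = _ := by
        rw [lintegral_sub_right_eq_self (μ := volume) ((Icc (-1) 1).indicator (negPow s)) c,
          lintegral_indicator measurableSet_Icc]

/-- The function `(1 - r M)^(-s)`, cut off where `r M ≥ 1`. -/
def cutPow (s M r : ℝ) : ℝ≥0∞ := if r * M < 1 then negPow s (1 - r * M) else 0

/-- The bound is uniform in M. For M < ½ there is no singularity; for M ≥ ½ factor 1 − rM = −M(r −
M⁻¹) and translate. -/
theorem lintegral_cutPow_le (hs : 0 < s) (hs1 : s < 1) {M : ℝ} (hM : 0 ≤ M) :
    ∫⁻ r in Icc (1 / 2) 1, cutPow s M r ≤ 2 * ((∫⁻ t in Icc (-1) 1, negPow s t) + 1) := by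
  have hvol : volume (Icc (1 / 2 : ℝ) 1) ≤ 1 := by
    rw [Real.volume_Icc]
    exact ENNReal.ofReal_le_one.2 (by norm_num)
  have h2 : negPow s (1 / 2) ≤ 2 :=
    (negPow_le_inv hs1 (by norm_num) (by norm_num)).trans (by norm_num)
  rcases lt_or_ge M (1 / 2) with h | h
  · calc _ ≤ ∫⁻ r in Icc (1 / 2 : ℝ) 1, 2 := by
          refine setLIntegral_mono' measurableSet_Icc fun r hr => ?_
          rw [cutPow]
          split_ifs with hc
          · refine le_trans (negPow_anti hs ?_) h2
            have : 1 / 2 ≤ 1 - r * M := by nlinarith [hr.1, hr.2]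
            rw [abs_of_pos (by norm_num), abs_of_nonneg (by linarith)]
            exact this
          · exact zero_le
      _ ≤ 2 * 1 := by rw [setLIntegral_const]; gcongr
      _ ≤ _ := by gcongr; exact le_add_self
  · have hM0 : 0 < M := by linarith
    calc _ ≤ ∫⁻ r in Icc (1 / 2 : ℝ) 1, 2 * negPow s (r - M⁻¹) := by
          refine lintegral_mono fun r => ?_
          rw [cutPow]
          split_ifs with hc
          · have h3 : 1 - r * M = (-M) * (r - M⁻¹) := by field_simp; ring
            rw [h3, negPow_mul, negPow_neg]
            gcongr
            refine le_trans (negPow_anti hs ?_) h2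
            rw [abs_of_pos hM0, abs_of_pos (by norm_num)]
            exact h
          · exact zero_le
      _ = 2 * ∫⁻ r in Icc (1 / 2 : ℝ) 1, negPow s (r - M⁻¹) :=
          lintegral_const_mul _ ((measurable_negPow s).comp (by fun_prop))
      _ ≤ _ := by
          gcongr
          exact (setLIntegral_negPow_sub_le hs _ _).trans (by gcongr)

theorem lintegral_negPow_im_lt_top (hs : 0 < s) (hs1 : s < 1) (R : ℝ) :
    ∫⁻ w in Metric.closedBall (0 : ℂ) R, negPow s w.im < ⊤ := by
  have hm : Measurable fun p : ℝ × ℝ => negPow s p.2 := (measurable_negPow s).comp measurable_snd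
  have h1 : ∫⁻ p in Icc (-R) R ×ˢ Icc (-R) R, negPow s p.2 < ⊤ := by
    rw [Measure.volume_eq_prod, ← Measure.prod_restrict,
      lintegral_prod _ hm.aemeasurable]
    simp only
    rw [lintegral_const, Measure.restrict_apply_univ]
    have := setLIntegral_negPow_sub_le hs 0 (Icc (-R) R)
    simp only [sub_zero] at this
    exact ENNReal.mul_lt_top (this.trans_lt (ENNReal.add_lt_top.2
      ⟨lintegral_negPow_lt_top hs1, measure_Icc_lt_top⟩)) measure_Icc_lt_top
  have h2 := Complex.volume_preserving_equiv_real_prod.setLIntegral_comp_preimage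
    (s := Icc (-R) R ×ˢ Icc (-R) R) (measurableSet_Icc.prod measurableSet_Icc) hm
  rw [← h2] at h1
  refine lt_of_le_of_lt (lintegral_mono_set fun w hw => ?_) h1
  have hw' : ‖w‖ ≤ R := by simpa using hw
  exact ⟨abs_le.1 ((Complex.abs_re_le_norm w).trans hw'),
    abs_le.1 ((Complex.abs_im_le_norm w).trans hw')⟩

/-- Rotating w turns |Im(z w̄)| into |z| |Im w|, and |z| ≥ |Im z|. -/
theorem lintegral_negPow_im_mul_conj_le (hs : 0 < s) (R : ℝ) (z : ℂ) :
    ∫⁻ w in Metric.closedBall (0 : ℂ) R, negPow s (z * conj w).im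
      ≤ negPow s z.im * ((∫⁻ w in Metric.closedBall (0 : ℂ) R, negPow s w.im) + 1) := by
  rcases eq_or_ne z 0 with rfl | hz
  · have : negPow s (0 : ℂ).im = ⊤ := by simp [negPow, hs]
    -- The summand 1 in the bound keeps the second factor nonzero, so that the right side is ⊤ at z
    -- = 0.
    rw [this, ENNReal.top_mul (by simp)]
    exact le_top
  obtain ⟨u, hu⟩ : ∃ u : Circle, (‖z‖ : ℂ) * u = conj z := by
    refine ⟨Circle.exp (-Complex.arg z), ?_⟩
    conv_rhs => rw [← Complex.norm_mul_exp_arg_mul_I z]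
    rw [map_mul, Complex.conj_ofReal, ← Complex.exp_conj, Circle.coe_exp]
    simp
  have h1 : ∀ w : ℂ, negPow s (z * conj w).im = negPow s ‖z‖ * negPow s ((u : ℂ) * w).im := by
    intro w
    rw [← negPow_mul, ← negPow_neg s (z * conj w).im]
    congr 1
    rw [← Complex.im_ofReal_mul, ← mul_assoc, hu, ← Complex.conj_im]
    simp
  have hm : Measurable fun w : ℂ => negPow s w.im :=
    (measurable_negPow s).comp Complex.measurable_im
  have h2 := ((rotation u).measurePreserving).setLIntegral_comp_preimage
    (s := Metric.closedBall (0 : ℂ) R) Metric.isClosed_closedBall.measurableSet hm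
  have h3 : (rotation u) ⁻¹' Metric.closedBall (0 : ℂ) R = Metric.closedBall (0 : ℂ) R := by
    ext w
    simp only [mem_preimage, mem_closedBall_zero_iff, LinearIsometryEquiv.norm_map]
  rw [h3] at h2
  simp only [rotation_apply] at h2
  simp_rw [h1]
  have hm2 : Measurable fun w : ℂ => negPow s ((u : ℂ) * w).im :=
    hm.comp (measurable_const_mul (u : ℂ))
  rw [lintegral_const_mul _ hm2, h2]
  refine mul_le_mul' (negPow_anti hs ?_) le_self_add
  rw [abs_norm]
  exact Complex.abs_im_le_norm z

theorem lintegral_pi_succ {m : ℕ} {Φ : ℂ × (Fin m → ℂ) → ℝ≥0∞} (hΦ : Measurable Φ) :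
    ∫⁻ z : Fin (m + 1) → ℂ, Φ (z 0, fun i => z i.succ) = ∫⁻ x, ∫⁻ y, Φ (x, y) := by
  have h := (volume_preserving_piFinSuccAbove (fun _ : Fin (m + 1) => ℂ) 0).lintegral_comp hΦ
  rw [Measure.volume_eq_prod, lintegral_prod _ hΦ.aemeasurable] at h
  exact h

theorem lintegral_negPow_im_pi_lt_top (hs : 0 < s) (hs1 : s < 1) (R : ℝ) (hR : 0 ≤ R) (m : ℕ) :
    ∫⁻ z in Metric.closedBall (0 : Fin (m + 2) → ℂ) R, negPow s (z 0 * conj (z 1)).im < ⊤ := by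
  obtain ⟨χ, hχ⟩ : ∃ χ : ℂ → ℝ≥0∞, χ = (Metric.closedBall 0 R).indicator 1 := ⟨_, rfl⟩
  obtain ⟨V, hV⟩ : ∃ V : (Fin m → ℂ) → ℝ≥0∞, V = (Metric.closedBall 0 R).indicator 1 := ⟨_, rfl⟩
  have hχm : Measurable χ := hχ ▸ measurable_one.indicator Metric.isClosed_closedBall.measurableSet
  have hVm : Measurable V := hV ▸ measurable_one.indicator Metric.isClosed_closedBall.measurableSet
  obtain ⟨τ, hτ'⟩ : ∃ τ : ℂ × ℂ → ℝ≥0∞, ∀ x y, negPow s (x * conj y).im = τ (x, y) :=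
    ⟨fun p => negPow s (p.1 * conj p.2).im, fun _ _ => rfl⟩
  have hτ : Measurable τ := by
    have h1 : Measurable fun p : ℂ × ℂ => (p.1 * conj p.2).im := by fun_prop
    have h2 : τ = fun p => negPow s (p.1 * conj p.2).im := funext fun p => (hτ' p.1 p.2).symm
    rw [h2]
    exact (measurable_negPow s).comp h1
  set Ψ : ℂ → ℂ × (Fin m → ℂ) → ℝ≥0∞ := fun x q =>
    χ x * (χ q.1 * τ (x, q.1) * V q.2) with hΨ
  set Φ : ℂ × (Fin (m + 1) → ℂ) → ℝ≥0∞ := fun p => Ψ p.1 (p.2 0, fun i => p.2 i.succ) with hΦ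
  have hΨm : Measurable (fun p : ℂ × (ℂ × (Fin m → ℂ)) => Ψ p.1 p.2) := by
    have h1 : Measurable fun p : ℂ × (ℂ × (Fin m → ℂ)) => τ (p.1, p.2.1) :=
      hτ.comp (measurable_fst.prodMk (measurable_fst.comp measurable_snd))
    exact (hχm.comp measurable_fst).mul
      (((hχm.comp (measurable_fst.comp measurable_snd)).mul h1).mul
        (hVm.comp (measurable_snd.comp measurable_snd)))
  have hΦm : Measurable Φ := hΨm.comp (by fun_prop :
    Measurable fun p : ℂ × (Fin (m + 1) → ℂ) => (p.1, (p.2 0, fun i : Fin m => p.2 i.succ)))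
  have h1 : ∫⁻ z in Metric.closedBall (0 : Fin (m + 2) → ℂ) R, negPow s (z 0 * conj (z 1)).im
      = ∫⁻ z : Fin (m + 2) → ℂ, Φ (z 0, fun i => z i.succ) := by
    rw [← lintegral_indicator Metric.isClosed_closedBall.measurableSet]
    simp only [hτ']
    refine lintegral_congr fun z => ?_
    have hiff : z ∈ Metric.closedBall (0 : Fin (m + 2) → ℂ) R ↔
        z 0 ∈ Metric.closedBall (0 : ℂ) R ∧ z 1 ∈ Metric.closedBall (0 : ℂ) R ∧
          (fun i : Fin m => z i.succ.succ) ∈ Metric.closedBall (0 : Fin m → ℂ) R := by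
      simp only [mem_closedBall_zero_iff, pi_norm_le_iff_of_nonneg hR, Fin.forall_fin_succ]
      rfl
    simp only [hΦ, hΨ, hχ, hV, Fin.succ_zero_eq_one]
    by_cases hz : z ∈ Metric.closedBall (0 : Fin (m + 2) → ℂ) R
    · obtain ⟨a, b, c⟩ := hiff.1 hz
      rw [indicator_of_mem hz, indicator_of_mem a, indicator_of_mem b, indicator_of_mem c]
      simp
    · rw [indicator_of_notMem hz]
      by_cases a : z 0 ∈ Metric.closedBall (0 : ℂ) R
      · by_cases b : z 1 ∈ Metric.closedBall (0 : ℂ) R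
        · rw [indicator_of_notMem (fun c => hz (hiff.2 ⟨a, b, c⟩))]
          simp
        · rw [indicator_of_notMem b]; simp
      · rw [indicator_of_notMem a]; simp
  set K := ∫⁻ w in Metric.closedBall (0 : ℂ) R, negPow s w.im with hK
  have hKt : K < ⊤ := lintegral_negPow_im_lt_top hs hs1 R
  set v := volume (Metric.closedBall (0 : Fin m → ℂ) R)
  have hv : v < ⊤ := measure_closedBall_lt_top
  rw [h1, lintegral_pi_succ hΦm]
  have h2 : ∀ x, ∫⁻ y, Φ (x, y) ≤ χ x * (negPow s x.im * (K + 1) * v) := by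
    intro x
    have h3 : ∫⁻ y, Φ (x, y) = ∫⁻ b, ∫⁻ c, Ψ x (b, c) :=
      lintegral_pi_succ (Φ := Ψ x) (hΨm.comp measurable_prodMk_left)
    have h4 : ∀ b, ∫⁻ c, Ψ x (b, c) = χ x * (χ b * τ (x, b) * v) := by
      intro b
      simp only [hΨ]
      rw [lintegral_const_mul _ (hVm.const_mul _), lintegral_const_mul _ hVm, hV,
        lintegral_indicator_one Metric.isClosed_closedBall.measurableSet]
    have h5 : Measurable fun b : ℂ => χ b * τ (x, b) :=
      hχm.mul (hτ.comp measurable_prodMk_left)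
    rw [h3, lintegral_congr h4, lintegral_const_mul _ (h5.mul_const _), lintegral_mul_const _ h5]
    gcongr
    refine le_trans (le_of_eq ?_) (lintegral_negPow_im_mul_conj_le hs R x)
    rw [← lintegral_indicator Metric.isClosed_closedBall.measurableSet]
    simp only [hτ']
    refine lintegral_congr fun b => ?_
    by_cases hb : b ∈ Metric.closedBall (0 : ℂ) R
    · rw [hχ, indicator_of_mem hb, indicator_of_mem hb, Pi.one_apply, one_mul]
    · rw [hχ, indicator_of_notMem hb, indicator_of_notMem hb, zero_mul]
  refine (lintegral_mono h2).trans_lt ?_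
  have h6 : ∫⁻ x, χ x * (negPow s x.im * (K + 1) * v) = K * ((K + 1) * v) := by
    have hm : Measurable fun x : ℂ => negPow s x.im :=
      (measurable_negPow s).comp Complex.measurable_im
    have h7 : K * ((K + 1) * v)
        = ∫⁻ x in Metric.closedBall (0 : ℂ) R, negPow s x.im * ((K + 1) * v) :=
      (lintegral_mul_const _ hm).symm
    rw [h7, ← lintegral_indicator Metric.isClosed_closedBall.measurableSet]
    refine lintegral_congr fun b => ?_
    by_cases hb : b ∈ Metric.closedBall (0 : ℂ) R
    · rw [hχ, indicator_of_mem hb, indicator_of_mem hb, Pi.one_apply, one_mul, mul_assoc]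
    · rw [hχ, indicator_of_notMem hb, indicator_of_notMem hb, zero_mul]
  rw [h6]
  exact ENNReal.mul_lt_top hKt (ENNReal.mul_lt_top (ENNReal.add_lt_top.2 ⟨hKt, ENNReal.one_lt_top⟩) hv)

/-- The function `|z|² + √(|z|⁴ - |zᵀ z|²)`, whose square root is the gauge of the domain. -/
def gaugeSq {n : ℕ} (z : Fin n → ℂ) : ℝ := absSq z + √(absSq z ^ 2 - ‖dot z z‖ ^ 2)

theorem continuous_gaugeSq {n : ℕ} : Continuous (gaugeSq : (Fin n → ℂ) → ℝ) := by
  have h1 := continuous_absSq (n := n)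
  have h2 := continuous_dot_self (n := n)
  unfold gaugeSq
  fun_prop

theorem norm_dot_sq_le {n : ℕ} (z : Fin n → ℂ) : ‖dot z z‖ ^ 2 ≤ absSq z ^ 2 :=
  pow_le_pow_left₀ (norm_nonneg _) (norm_dot_self_le z) 2

/-- A Lagrange identity, from |w|² − Re(w²) = 2 (Im w)² with w = z_j z̄_k. -/
theorem absSq_sq_sub_eq {n : ℕ} (z : Fin n → ℂ) :
    absSq z ^ 2 - ‖dot z z‖ ^ 2 = ∑ j, ∑ k, 2 * (z j * conj (z k)).im ^ 2 := by
  have h1 : ‖dot z z‖ ^ 2 = ∑ j, ∑ k, ((z j * conj (z k)) ^ 2).re := by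
    have h2 : ((‖dot z z‖ ^ 2 : ℝ) : ℂ) = ∑ j, ∑ k, (z j * conj (z k)) ^ 2 := by
      rw [ofReal_norm_dot_sq, conj_dot, dot, dot, Finset.sum_mul_sum]
      exact Finset.sum_congr rfl fun j _ => Finset.sum_congr rfl fun k _ => by ring
    have h3 := congrArg Complex.re h2
    rwa [Complex.ofReal_re, Complex.re_sum, Finset.sum_congr rfl fun j _ => Complex.re_sum _ _]
      at h3
  rw [h1, sq (absSq z), absSq, Finset.sum_mul_sum, ← Finset.sum_sub_distrib]
  refine Finset.sum_congr rfl fun j _ => ?_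
  rw [← Finset.sum_sub_distrib]
  refine Finset.sum_congr rfl fun k _ => ?_
  have h4 : ‖z j‖ ^ 2 * ‖z k‖ ^ 2 = ‖z j * conj (z k)‖ ^ 2 := by
    rw [norm_mul, Complex.norm_conj, mul_pow]
  rw [h4, ← Complex.normSq_eq_norm_sq]
  generalize z j * conj (z k) = w
  rw [Complex.normSq_apply, sq w, Complex.mul_re]
  ring

/-- Only the terms (a, b) and (b, a) of the Lagrange identity are kept; together they give 4 (Im z_a
z̄_b)². -/
theorem two_mul_abs_im_le {n : ℕ} (z : Fin n → ℂ) {a b : Fin n} (hab : a ≠ b) :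
    2 * |(z a * conj (z b)).im| ≤ √(absSq z ^ 2 - ‖dot z z‖ ^ 2) := by
  refine Real.le_sqrt_of_sq_le ?_
  rw [absSq_sq_sub_eq, mul_pow, sq_abs]
  have h0 : ∀ j, 0 ≤ ∑ k, 2 * (z j * conj (z k)).im ^ 2 :=
    fun j => Finset.sum_nonneg fun k _ => by positivity
  have h1 : ∀ j k, 2 * (z j * conj (z k)).im ^ 2 ≤ ∑ k, 2 * (z j * conj (z k)).im ^ 2 :=
    fun j k => Finset.single_le_sum (f := fun k => 2 * (z j * conj (z k)).im ^ 2)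
      (fun k _ => by positivity) (Finset.mem_univ k)
  have h2 : (z b * conj (z a)).im = -(z a * conj (z b)).im := by
    rw [← Complex.conj_im]
    congr 1
    simp [mul_comm]
  have h3 := Finset.add_le_sum (f := fun j => ∑ k, 2 * (z j * conj (z k)).im ^ 2)
    (fun j _ => h0 j) (Finset.mem_univ a) (Finset.mem_univ b) hab
  have h4 := h1 a b
  have h5 := h1 b a
  rw [h2, neg_sq] at h5
  refine le_trans ?_ h3
  linarith

theorem gaugeSq_smul {n : ℕ} (r : ℝ) (z : Fin n → ℂ) : gaugeSq (r • z) = r ^ 2 * gaugeSq z := by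
  have h : (r : ℝ) • z = (r : ℂ) • z := (Complex.coe_smul r z).symm
  rw [gaugeSq, gaugeSq, h, norm_dot_smul_smul, absSq_smul, Complex.norm_real, Real.norm_eq_abs,
    sq_abs, mul_pow, ← mul_sub, Real.sqrt_mul (by positivity), Real.sqrt_sq (by positivity)]
  ring

theorem absSq_le_gaugeSq {n : ℕ} (z : Fin n → ℂ) : absSq z ≤ gaugeSq z :=
  le_add_of_nonneg_right (Real.sqrt_nonneg _)

theorem norm_sq_le_absSq {n : ℕ} (z : Fin n → ℂ) : ‖z‖ ^ 2 ≤ absSq z := by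
  have h : ‖z‖ ≤ √(absSq z) := by
    rw [pi_norm_le_iff_of_nonneg (Real.sqrt_nonneg _)]
    intro j
    exact Real.le_sqrt_of_sq_le
      (Finset.single_le_sum (f := fun j => ‖z j‖ ^ 2) (fun k _ => by positivity) (Finset.mem_univ j))
  calc _ ≤ √(absSq z) ^ 2 := pow_le_pow_left₀ (norm_nonneg _) h 2
    _ = _ := Real.sq_sqrt (absSq_nonneg z)

theorem norm_lt_one_of_mem_domain {n : ℕ} {z : Fin n → ℂ} (hz : z ∈ domain n) : ‖z‖ < 1 := by
  have h1 := (norm_sq_le_absSq z).trans_lt hz.1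
  nlinarith [norm_nonneg z]

/-- With t = √(|z|⁴ − |zᵀz|²), this is Δ = (1 − |z|²)² − t². The first factor vanishes on the
boundary; on the domain the second one is at least t, hence at least |Im z_a z̄_b|. So the two
singularities of Δ^(−s) can be treated separately. -/
theorem Delta_eq_mul {n : ℕ} (z : Fin n → ℂ) :
    Delta z = (1 - gaugeSq z) * (1 - absSq z + √(absSq z ^ 2 - ‖dot z z‖ ^ 2)) := by
  have h := Real.sq_sqrt (sub_nonneg.2 (norm_dot_sq_le z))
  rw [gaugeSq, Delta]
  linear_combination h

theorem gaugeSq_lt_one {n : ℕ} {z : Fin n → ℂ} (hz : z ∈ domain n) : gaugeSq z < 1 := by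
  have h1 := Delta_pos hz
  rw [Delta_eq_mul] at h1
  have h2 : 0 < 1 - absSq z + √(absSq z ^ 2 - ‖dot z z‖ ^ 2) := by
    have := Real.sqrt_nonneg (absSq z ^ 2 - ‖dot z z‖ ^ 2)
    linarith [hz.1]
  linarith [pos_of_mul_pos_left h1 h2.le]

theorem abs_im_le_gaugeSq {n : ℕ} {a b : Fin n} (hab : a ≠ b) {z : Fin n → ℂ} (hz : z ∈ domain n) :
    (1 - gaugeSq z) * |(z a * conj (z b)).im| ≤ Delta z := by
  rw [Delta_eq_mul]
  have h1 := two_mul_abs_im_le z hab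
  have h2 := gaugeSq_lt_one hz
  refine mul_le_mul_of_nonneg_left ?_ (by linarith)
  linarith [hz.1, abs_nonneg (z a * conj (z b)).im]

/-- Dilation by r ≤ 1 has an inverse Jacobian at least 1. This inequality allows averaging over r
without polar coordinates. -/
theorem lintegral_le_lintegral_smul {n : ℕ} {H : (Fin n → ℂ) → ℝ≥0∞} (hH : Measurable H) {r : ℝ}
    (hr : 0 < r) (hr1 : r ≤ 1) : ∫⁻ z, H z ≤ ∫⁻ z, H (r • z) := by
  have h1 : ∫⁻ z, H (r • z) = ∫⁻ z, H z ∂(Measure.map (r • ·) volume) :=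
    (lintegral_map hH (measurable_const_smul r)).symm
  rw [h1, Measure.map_addHaar_smul _ hr.ne', lintegral_smul_measure, smul_eq_mul]
  refine le_mul_of_one_le_left zero_le ?_
  rw [ENNReal.one_le_ofReal, abs_of_pos (by positivity)]
  exact (one_le_inv₀ (by positivity)).2 (pow_le_one₀ hr.le hr1)

/-- Averaging over dilations r ∈ [½, 1] integrates the boundary singularity in r alone, uniformly in
z. What remains is the singularity of |Im(z₀ z̄₁)|^(−s), integrable on bounded sets as s < 1. -/
theorem lintegral_gauge_lt_top (hs : 0 < s) (hs1 : s < 1) (m : ℕ) :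
    ∫⁻ z : Fin (m + 2) → ℂ, (if gaugeSq z < 1 then
      negPow s (1 - gaugeSq z) * negPow s (z 0 * conj (z 1)).im else 0) < ⊤ := by
  set H : (Fin (m + 2) → ℂ) → ℝ≥0∞ := fun z => if gaugeSq z < 1 then
      negPow s (1 - gaugeSq z) * negPow s (z 0 * conj (z 1)).im else 0 with hH
  have hg : Measurable (gaugeSq : (Fin (m + 2) → ℂ) → ℝ) := continuous_gaugeSq.measurable
  have hτ : Measurable fun z : Fin (m + 2) → ℂ => negPow s (z 0 * conj (z 1)).im := by
    have h1 : Measurable fun z : Fin (m + 2) → ℂ => (z 0 * conj (z 1)).im := by fun_prop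
    exact (measurable_negPow s).comp h1
  have hHm : Measurable H := by
    refine Measurable.ite (measurableSet_lt hg measurable_const) ?_ measurable_const
    exact ((measurable_negPow s).comp (measurable_const.sub hg)).mul hτ
  set τ : (Fin (m + 2) → ℂ) → ℝ≥0∞ := fun z =>
    (Metric.closedBall (0 : Fin (m + 2) → ℂ) 2).indicator
      (fun z => negPow s (z 0 * conj (z 1)).im) z with hτd
  have hτm : Measurable τ := hτ.indicator Metric.isClosed_closedBall.measurableSet
  have hτi : ∫⁻ z, τ z < ⊤ := by
    rw [hτd, lintegral_indicator Metric.isClosed_closedBall.measurableSet]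
    exact lintegral_negPow_im_pi_lt_top hs hs1 2 (by norm_num) m
  have hgn : ∀ z : Fin (m + 2) → ℂ, 0 ≤ gaugeSq z := fun z =>
    (absSq_nonneg z).trans (absSq_le_gaugeSq z)
  have hbound : ∀ r ∈ Icc (1 / 2 : ℝ) 1, ∀ z : Fin (m + 2) → ℂ,
      H (r • z) ≤ 4 * (τ z * cutPow s (√(gaugeSq z)) r) := by
    intro r hr z
    have hr0 : 0 < r := by linarith [hr.1]
    simp only [hH]
    split_ifs with hc
    · rw [gaugeSq_smul] at hc ⊢
      set M := √(gaugeSq z) with hM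
      have hMM : gaugeSq z = M ^ 2 := (Real.sq_sqrt (hgn z)).symm
      have hM0 : 0 ≤ M := Real.sqrt_nonneg _
      rw [hMM] at hc ⊢
      have hrM : r * M < 1 := by
        by_contra h
        have : 1 ≤ (r * M) ^ 2 := one_le_pow₀ (not_lt.1 h)
        nlinarith
      -- From r²M² < 1 and r ≥ ½ follows M² < 4, whence the radius 2; likewise r² ≥ ¼ produces the
      -- factor 4 in `hbound`.
      have hz : z ∈ Metric.closedBall (0 : Fin (m + 2) → ℂ) 2 := by
        rw [mem_closedBall_zero_iff]
        have h1 := (norm_sq_le_absSq z).trans (absSq_le_gaugeSq z)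
        have h2 : gaugeSq z < 4 := by rw [hMM]; nlinarith [hr.1, hr.2]
        nlinarith [norm_nonneg z]
      -- For 0 ≤ rM < 1 one has 1 − (rM)² ≥ 1 − rM, which is linear in r.
      have h1 : negPow s (1 - r ^ 2 * M ^ 2) ≤ cutPow s M r := by
        rw [cutPow, if_pos hrM]
        refine negPow_anti hs ?_
        have : 0 ≤ r * M := by positivity
        rw [abs_of_nonneg (by linarith), abs_of_nonneg (by linarith)]
        nlinarith
      have h2 : negPow s ((r • z) 0 * conj ((r • z) 1)).im ≤ 4 * τ z := by
        have h3 : ((r • z) 0 * conj ((r • z) 1)).im = r ^ 2 * (z 0 * conj (z 1)).im := by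
          simp only [Pi.smul_apply, Complex.real_smul, map_mul, Complex.conj_ofReal]
          rw [← Complex.im_ofReal_mul]
          congr 1
          push_cast
          ring
        rw [h3, negPow_mul]
        simp only [hτd]
        rw [indicator_of_mem hz]
        gcongr
        have h4 : |(1 / 4 : ℝ)| ≤ |r ^ 2| := by
          rw [abs_of_pos (by norm_num), abs_of_pos (by positivity)]
          nlinarith [hr.1]
        refine (negPow_anti hs h4).trans
          ((negPow_le_inv hs1 (by norm_num) (by norm_num)).trans ?_)
        norm_num
      calc _ ≤ cutPow s M r * (4 * τ z) := mul_le_mul' h1 h2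
        _ = _ := by ring
    · exact zero_le
  have hcut : Measurable fun p : ℝ × (Fin (m + 2) → ℂ) => cutPow s (√(gaugeSq p.2)) p.1 := by
    have h1 : Measurable fun p : ℝ × (Fin (m + 2) → ℂ) => p.1 * √(gaugeSq p.2) :=
      measurable_fst.mul (hg.comp measurable_snd).sqrt
    exact Measurable.ite (measurableSet_lt h1 measurable_const)
      ((measurable_negPow s).comp (measurable_const.sub h1)) measurable_const
  have hjoint : Measurable fun p : ℝ × (Fin (m + 2) → ℂ) =>
      4 * (τ p.2 * cutPow s (√(gaugeSq p.2)) p.1) :=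
    ((hτm.comp measurable_snd).mul hcut).const_mul 4
  set C := 2 * ((∫⁻ t in Icc (-1) 1, negPow s t) + 1) with hC
  have hCt : C < ⊤ := ENNReal.mul_lt_top (by norm_num)
    (ENNReal.add_lt_top.2 ⟨lintegral_negPow_lt_top hs1, ENNReal.one_lt_top⟩)
  have hmain : (∫⁻ z, H z) * ENNReal.ofReal (1 - 1 / 2) ≤ 4 * ((∫⁻ z, τ z) * C) := by
    rw [← Real.volume_Icc, ← setLIntegral_const]
    calc ∫⁻ _ in Icc (1 / 2 : ℝ) 1, ∫⁻ z, H z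
        ≤ ∫⁻ r in Icc (1 / 2 : ℝ) 1, ∫⁻ z, 4 * (τ z * cutPow s (√(gaugeSq z)) r) := by
          refine setLIntegral_mono' measurableSet_Icc fun r hr => ?_
          exact (lintegral_le_lintegral_smul hHm (by linarith [hr.1]) hr.2).trans
            (lintegral_mono fun z => hbound r hr z)
      _ = ∫⁻ z, ∫⁻ r in Icc (1 / 2 : ℝ) 1, 4 * (τ z * cutPow s (√(gaugeSq z)) r) :=
          lintegral_lintegral_swap hjoint.aemeasurable
      _ ≤ ∫⁻ z, 4 * (τ z * C) := by
          refine lintegral_mono fun z => ?_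
          have hz : Measurable fun r => cutPow s (√(gaugeSq z)) r :=
            hcut.comp (measurable_id.prodMk measurable_const)
          rw [lintegral_const_mul _ (hz.const_mul _), lintegral_const_mul _ hz]
          gcongr
          exact lintegral_cutPow_le hs hs1 (Real.sqrt_nonneg _)
      _ = _ := by rw [lintegral_const_mul _ (hτm.mul_const _), lintegral_mul_const _ hτm]
  have hlt := hmain.trans_lt (ENNReal.mul_lt_top (by norm_num) (ENNReal.mul_lt_top hτi hCt))
  by_contra hcon
  rw [not_lt, top_le_iff] at hcon
  rw [hcon, ENNReal.top_mul (by norm_num)] at hlt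
  exact lt_irrefl _ hlt

/-- For λ ≥ n the density is at most 1 on a bounded set. For n − 1 < λ < n the exponent s = n − λ
lies in (0, 1), and Δ is bounded below by (1 − gauge²) |Im(z₀ z̄₁)|. -/
theorem weightedMeasure_univ_lt_top {n : ℕ} (hn : 2 ≤ n) {lam : ℝ} (hlam : (n : ℝ) - 1 < lam) :
    weightedMeasure n lam univ < ⊤ := by
  rw [weightedMeasure, withDensity_apply _ MeasurableSet.univ, Measure.restrict_univ]
  rcases le_or_gt (n : ℝ) lam with h | h
  · calc _ ≤ ∫⁻ _ in domain n, 1 := by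
          refine setLIntegral_mono' (isOpen_domain n).measurableSet fun z hz => ?_
          refine ENNReal.ofReal_le_one.2 (Real.rpow_le_one (Delta_pos hz).le ?_ (by linarith))
          have h1 := norm_dot_sq_le z
          have h2 := absSq_nonneg z
          rw [Delta]
          nlinarith [hz.1]
      _ ≤ volume (Metric.ball (0 : Fin n → ℂ) 1) := by
          rw [setLIntegral_const, one_mul]
          exact measure_mono fun z hz => by simpa using norm_lt_one_of_mem_domain hz
      _ < ⊤ := measure_ball_lt_top
  · obtain ⟨m, rfl⟩ := Nat.exists_eq_add_of_le' hn
    set s := ((m + 2 : ℕ) : ℝ) - lam with hsdef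
    have hs : 0 < s := by linarith
    have hs1 : s < 1 := by linarith
    refine lt_of_le_of_lt ?_ (lintegral_gauge_lt_top hs hs1 m)
    rw [← lintegral_indicator (isOpen_domain _).measurableSet]
    refine lintegral_mono fun z => ?_
    by_cases hz : z ∈ domain (m + 2)
    · rw [indicator_of_mem hz, if_pos (gaugeSq_lt_one hz), ← negPow_mul]
      have h1 : ENNReal.ofReal (Delta z ^ (lam - (m + 2 : ℕ))) = negPow s (Delta z) := by
        rw [negPow, abs_of_pos (Delta_pos hz), ENNReal.ofReal_rpow_of_pos (Delta_pos hz), hsdef]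
        congr 2
        ring
      rw [h1]
      refine negPow_anti hs ?_
      rw [abs_mul, abs_of_pos (by linarith [gaugeSq_lt_one hz]), abs_of_pos (Delta_pos hz)]
      exact abs_im_le_gaugeSq (by simp) hz
    · rw [indicator_of_notMem hz]
      exact zero_le

end Finiteness

end CartanIV

namespace CartanIV

/-! ## The normalised measure -/

instance isFiniteMeasure_bergmanMeasure (n : ℕ) (lam : ℝ) :
    IsFiniteMeasure (bergmanMeasure n lam) :=
  ⟨by
    rw [bergmanMeasure, Measure.smul_apply, smul_eq_mul]
    exact (ENNReal.inv_mul_le_one _).trans_lt ENNReal.one_lt_top⟩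

theorem measurable_density (n : ℕ) (lam : ℝ) :
    Measurable fun z : Fin n → ℂ => ENNReal.ofReal (Delta z ^ (lam - n)) :=
  ENNReal.measurable_ofReal.comp (continuous_Delta.measurable.pow_const _)

theorem ae_mem_domain (n : ℕ) (lam : ℝ) : ∀ᵐ z ∂(bergmanMeasure n lam), z ∈ domain n :=
  Measure.ae_smul_measure ((withDensity_absolutelyContinuous _ _).ae_le
    (ae_restrict_mem (isOpen_domain n).measurableSet)) _

/-- Finite total mass makes the normalising scalar nonzero, and Δ > 0, so on the domain null sets of
v_λ are Lebesgue null sets. -/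
theorem eqOn_domain_of_ae_eq {n : ℕ} (hn : 2 ≤ n) {lam : ℝ} (hlam : (n : ℝ) - 1 < lam)
    {F G : (Fin n → ℂ) → ℂ} (hF : ContinuousOn F (domain n)) (hG : ContinuousOn G (domain n))
    (h : F =ᵐ[bergmanMeasure n lam] G) : EqOn F G (domain n) := by
  have h1 : F =ᵐ[weightedMeasure n lam] G :=
    (Measure.ae_ennreal_smul_measure_iff
      (ENNReal.inv_ne_zero.2 (weightedMeasure_univ_lt_top hn hlam).ne)).1 h
  rw [Filter.EventuallyEq, weightedMeasure, ae_withDensity_iff (measurable_density n lam)] at h1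
  refine Measure.eqOn_open_of_ae_eq (μ := volume) ?_ (isOpen_domain n) hF hG
  filter_upwards [h1, ae_restrict_mem (isOpen_domain n).measurableSet] with z hz hzd
  exact hz (by simpa using Real.rpow_pos_of_pos (Delta_pos hzd) _)

/-! ## Measure preserving symmetries -/

/-- An injective linear map scales Lebesgue measure by a constant, which is 1 because the Euclidean
unit ball is its own preimage. -/
theorem measurePreserving_of_absSq {n : ℕ} (e : (Fin n → ℂ) →ₗ[ℝ] (Fin n → ℂ))
    (he : ∀ z, absSq (e z) = absSq z) : MeasurePreserving e volume volume := by
  have hinj : Function.Injective e := by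
    rw [← LinearMap.ker_eq_bot, LinearMap.ker_eq_bot']
    intro z hz
    have h1 := he z
    rw [hz] at h1
    have h2 : absSq z = 0 := by rw [← h1]; simp [absSq]
    funext j
    have h3 := (Finset.sum_eq_zero_iff_of_nonneg fun j _ => by positivity).1 h2 j (Finset.mem_univ j)
    simpa using h3
  have hdet : LinearMap.det e ≠ 0 :=
    (LinearEquiv.isUnit_det' (LinearEquiv.ofInjectiveEndo e hinj)).ne_zero
  have hc : Continuous e := e.continuous_of_finiteDimensional
  have hmap := Measure.map_linearMap_addHaar_eq_smul_addHaar (volume : Measure (Fin n → ℂ)) hdet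
  set B : Set (Fin n → ℂ) := {z | absSq z < 1} with hB
  have hBo : IsOpen B := isOpen_lt continuous_absSq continuous_const
  have hB0 : volume B ≠ 0 := (hBo.measure_pos _ ⟨0, by simp [hB, absSq]⟩).ne'
  have hBt : volume B ≠ ⊤ := by
    refine ne_top_of_le_ne_top (measure_ball_lt_top (x := (0 : Fin n → ℂ)) (r := 1)).ne
      (measure_mono fun z hz => ?_)
    have h1 := (norm_sq_le_absSq z).trans_lt hz
    rw [mem_ball_zero_iff]
    nlinarith [norm_nonneg z]
  have h1 := congrArg (fun ν : Measure (Fin n → ℂ) => ν B) hmap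
  simp only [Measure.map_apply hc.measurable hBo.measurableSet, Measure.smul_apply,
    smul_eq_mul] at h1
  have h2 : e ⁻¹' B = B := by
    ext z
    simp only [hB, mem_preimage, mem_ofPred_eq, he]
  rw [h2] at h1
  have h3 : ENNReal.ofReal |(LinearMap.det e)⁻¹| = 1 := by
    have h4 : 1 * volume B = ENNReal.ofReal |(LinearMap.det e)⁻¹| * volume B := by rw [one_mul]; exact h1
    exact ((ENNReal.mul_left_inj hB0 hBt).1 h4).symm
  exact ⟨hc.measurable, by rw [hmap, h3, one_smul]⟩

theorem measurePreserving_bergmanMeasure {n : ℕ} (lam : ℝ) {e : (Fin n → ℂ) → (Fin n → ℂ)}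
    (he : MeasurePreserving e volume volume) (h1 : ∀ z, absSq (e z) = absSq z)
    (h2 : ∀ z, ‖dot (e z) (e z)‖ = ‖dot z z‖) :
    MeasurePreserving e (bergmanMeasure n lam) (bergmanMeasure n lam) := by
  have hdom : e ⁻¹' (domain n) = domain n := by
    ext z
    simp only [domain, mem_preimage, mem_ofPred_eq, h1, h2]
  have hD : ∀ z, Delta (e z) = Delta z := fun z => by rw [Delta, Delta, h1, h2]
  refine ⟨he.measurable, ?_⟩
  rw [bergmanMeasure, Measure.map_smul]
  congr 1
  refine Measure.ext fun S hS => ?_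
  rw [Measure.map_apply he.measurable hS, weightedMeasure, withDensity_apply _ hS,
    withDensity_apply _ (he.measurable hS), Measure.restrict_restrict hS,
    Measure.restrict_restrict (he.measurable hS),
    ← he.setLIntegral_comp_preimage (hS.inter (isOpen_domain n).measurableSet)
      (measurable_density n lam), preimage_inter, hdom]
  simp only [hD]

/-- The rotation by the angle `θ` in the plane of the coordinates `i` and `j`. -/
def planeRot {n : ℕ} (i j : Fin n) (θ : ℝ) (z : Fin n → ℂ) : Fin n → ℂ := fun k =>
  if k = i then Real.cos θ * z i - Real.sin θ * z j
  else if k = j then Real.sin θ * z i + Real.cos θ * z j else z k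

theorem sum_eq_sum_of_pair {n : ℕ} {M : Type*} [AddCommMonoid M] {i j : Fin n} (hij : i ≠ j)
    {F G : Fin n → M} (h : ∀ k, k ≠ i → k ≠ j → F k = G k) (h2 : F i + F j = G i + G j) :
    ∑ k, F k = ∑ k, G k := by
  have hsplit : ∀ F : Fin n → M, ∑ k, F k
      = F i + F j + ∑ k ∈ (Finset.univ.erase i).erase j, F k := by
    intro F
    rw [add_assoc, Finset.add_sum_erase _ _ (Finset.mem_erase.2 ⟨hij.symm, Finset.mem_univ _⟩),
      Finset.add_sum_erase _ _ (Finset.mem_univ _)]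
  rw [hsplit F, hsplit G, h2]
  congr 1
  refine Finset.sum_congr rfl fun k hk => ?_
  rw [Finset.mem_erase, Finset.mem_erase] at hk
  exact h k hk.2.1 hk.1

theorem dot_planeRot {n : ℕ} {i j : Fin n} (hij : i ≠ j) (θ : ℝ) (z : Fin n → ℂ) :
    dot (planeRot i j θ z) (planeRot i j θ z) = dot z z := by
  have h : (Real.cos θ : ℂ) ^ 2 + (Real.sin θ : ℂ) ^ 2 = 1 := by
    exact_mod_cast Real.cos_sq_add_sin_sq θ
  refine sum_eq_sum_of_pair hij (fun k hi hj => by simp [planeRot, hi, hj]) ?_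
  simp only [planeRot, if_true, hij.symm, if_false]
  linear_combination (z i * z i + z j * z j) * h

theorem absSq_planeRot {n : ℕ} {i j : Fin n} (hij : i ≠ j) (θ : ℝ) (z : Fin n → ℂ) :
    absSq (planeRot i j θ z) = absSq z := by
  have h : (Real.cos θ : ℂ) ^ 2 + (Real.sin θ : ℂ) ^ 2 = 1 := by
    exact_mod_cast Real.cos_sq_add_sin_sq θ
  rw [← Complex.ofReal_inj, ofReal_absSq, ofReal_absSq]
  refine sum_eq_sum_of_pair hij (fun k hi hj => by simp [planeRot, hi, hj]) ?_
  simp only [planeRot, if_true, hij.symm, if_false, map_add, map_sub, map_mul, Complex.conj_ofReal]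
  linear_combination (z i * conj (z i) + z j * conj (z j)) * h

theorem planeRot_mem_domain {n : ℕ} {i j : Fin n} (hij : i ≠ j) (θ : ℝ) {z : Fin n → ℂ}
    (hz : z ∈ domain n) : planeRot i j θ z ∈ domain n := by
  simpa only [domain, mem_ofPred_eq, absSq_planeRot hij, dot_planeRot hij] using hz

theorem measurePreserving_planeRot {n : ℕ} (lam : ℝ) {i j : Fin n} (hij : i ≠ j) (θ : ℝ) :
    MeasurePreserving (planeRot i j θ) (bergmanMeasure n lam) (bergmanMeasure n lam) := by
  let e : (Fin n → ℂ) →ₗ[ℝ] (Fin n → ℂ) :=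
    { toFun := planeRot i j θ
      map_add' := fun z w => by
        funext k
        simp only [planeRot, Pi.add_apply]
        split_ifs <;> ring
      map_smul' := fun r z => by
        funext k
        simp only [planeRot, Pi.smul_apply, Complex.real_smul, RingHom.id_apply]
        split_ifs <;> ring }
  exact measurePreserving_bergmanMeasure lam
    (measurePreserving_of_absSq e (absSq_planeRot hij θ)) (absSq_planeRot hij θ)
    fun z => by rw [dot_planeRot hij]

theorem measurePreserving_circle {n : ℕ} (lam : ℝ) (t : Circle) :
    MeasurePreserving (fun z : Fin n → ℂ => (t : ℂ) • z) (bergmanMeasure n lam)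
      (bergmanMeasure n lam) := by
  refine measurePreserving_bergmanMeasure lam (volume_rot n t) (fun z => ?_) fun z => ?_
  · rw [absSq_smul, Circle.norm_coe, one_pow, one_mul]
  · rw [dot_smul_smul, norm_mul, norm_pow, Circle.norm_coe, one_pow, one_mul]

/-! ## Polynomials on the domain -/

open MvPolynomial

theorem eval_quad {n : ℕ} (z : Fin n → ℂ) : eval z (quad n) = dot z z := by
  simp [quad, dot, sq]

theorem hasDerivAt_eval {n : ℕ} {γ : ℝ → Fin n → ℂ} {γ' : Fin n → ℂ} {t : ℝ}
    (h : ∀ k, HasDerivAt (fun s => γ s k) (γ' k) t) (p : MvPolynomial (Fin n) ℂ) :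
    HasDerivAt (fun s => eval (γ s) p) (∑ k, γ' k * eval (γ t) (pderiv k p)) t := by
  induction p using MvPolynomial.induction_on with
  | C a => simpa using hasDerivAt_const t a
  | add p q hp hq =>
    simp only [map_add, mul_add, Finset.sum_add_distrib]
    exact hp.add hq
  | mul_X p i hp =>
    simp only [map_mul, eval_X]
    refine (hp.mul (h i)).congr_deriv ?_
    simp only [Derivation.leibniz, smul_eq_mul, map_add, map_mul, eval_X, pderiv_X, mul_add,
      Finset.sum_add_distrib, Finset.sum_mul]
    rw [add_comm]
    congr 1
    · rw [Finset.sum_eq_single i (fun k _ hk => by simp [hk.symm]) (by simp)]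
      simp [mul_comm]
    · exact Finset.sum_congr rfl fun k _ => by ring

/-- The derivation `rot i j` generates the flow θ ↦ `planeRot i j θ`. -/
theorem hasDerivAt_eval_planeRot {n : ℕ} {i j : Fin n} (hij : i ≠ j) (z : Fin n → ℂ)
    (p : MvPolynomial (Fin n) ℂ) (θ : ℝ) :
    HasDerivAt (fun s => eval (planeRot i j s z) p) (eval (planeRot i j θ z) (rot i j p)) θ := by
  have hcos : HasDerivAt (fun s : ℝ => (Real.cos s : ℂ)) (-Real.sin θ : ℂ) θ := by
    simpa using (Real.hasDerivAt_cos θ).ofReal_comp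
  have hsin : HasDerivAt (fun s : ℝ => (Real.sin s : ℂ)) (Real.cos θ : ℂ) θ :=
    (Real.hasDerivAt_sin θ).ofReal_comp
  have h : ∀ k, HasDerivAt (fun s => planeRot i j s z k)
      (if k = i then -planeRot i j θ z j else if k = j then planeRot i j θ z i else 0) θ := by
    intro k
    simp only [planeRot, if_true, hij.symm, if_false]
    split_ifs
    · exact ((hcos.mul_const _).sub (hsin.mul_const _)).congr_deriv (by ring)
    · exact ((hsin.mul_const _).add (hcos.mul_const _)).congr_deriv (by ring)
    · exact hasDerivAt_const θ _
  refine (hasDerivAt_eval h p).congr_deriv ?_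
  rw [Fintype.sum_eq_add i j hij fun k hk => by simp [hk.1, hk.2]]
  simp only [if_true, hij.symm, if_false, rot_apply, map_sub, map_mul, eval_X]
  ring

theorem eval_smul_of_isHomogeneous {n k : ℕ} {p : MvPolynomial (Fin n) ℂ} (hp : p.IsHomogeneous k)
    (c : ℂ) (z : Fin n → ℂ) : eval (c • z) p = c ^ k * eval z p := by
  rw [eval_eq', eval_eq', Finset.mul_sum]
  refine Finset.sum_congr rfl fun d hd => ?_
  have h1 : ∑ i, d i = k := by
    have := hp (mem_support_iff.1 hd)
    rwa [Finsupp.weight_apply, Finsupp.sum_fintype _ _ (by simp), Finset.sum_congr rfl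
      (g := fun i => d i) (fun i _ => by simp)] at this
  simp only [Pi.smul_apply, smul_eq_mul, mul_pow, Finset.prod_mul_distrib]
  rw [Finset.prod_pow_eq_pow_sum, h1]
  ring

theorem exists_bound_eval {n : ℕ} (p : MvPolynomial (Fin n) ℂ) :
    ∃ C, 0 ≤ C ∧ ∀ z ∈ domain n, ‖eval z p‖ ≤ C := by
  obtain ⟨C, hC⟩ := (isCompact_closedBall (0 : Fin n → ℂ) 1).exists_bound_of_continuousOn
    (f := fun z => eval z p) p.continuous_eval.continuousOn
  refine ⟨|C|, abs_nonneg C, fun z hz => (hC z ?_).trans (le_abs_self C)⟩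
  rw [mem_closedBall_zero_iff]
  exact (norm_lt_one_of_mem_domain hz).le

theorem memLp_eval {n : ℕ} (lam : ℝ) (p : MvPolynomial (Fin n) ℂ) (q : ℝ≥0∞) :
    MemLp (fun z => eval z p) q (bergmanMeasure n lam) := by
  obtain ⟨C, -, hC⟩ := exists_bound_eval p
  refine (memLp_top_of_bound p.continuous_eval.aestronglyMeasurable C ?_).mono_exponent le_top
  filter_upwards [ae_mem_domain n lam] with z hz using hC z hz

/-! ## The sesquilinear form of a bounded symbol -/

section SymbolForm

variable {n : ℕ} {lam : ℝ} {a : (Fin n → ℂ) → ℂ}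

theorem integrable_symbol_mul (ha : MemLp a ⊤ (bergmanMeasure n lam))
    (p q : MvPolynomial (Fin n) ℂ) :
    Integrable (fun z => a z * (eval z p * conj (eval z q))) (bergmanMeasure n lam) := by
  have h1 : MemLp (fun z => conj (eval z q)) 2 (bergmanMeasure n lam) := (memLp_eval lam q 2).star
  have h2 : Integrable (fun z => eval z p * conj (eval z q)) (bergmanMeasure n lam) :=
    (memLp_eval lam p 2).integrable_mul h1
  exact (memLp_one_iff_integrable.1 ((memLp_one_iff_integrable.2 h2).mul (p := ⊤) ha))

/-- The form `(p, q) ↦ ∫ a p conj(q)` on polynomials. -/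
def symbolForm (ha : MemLp a ⊤ (bergmanMeasure n lam)) :
    MvPolynomial (Fin n) ℂ →ₗ[ℂ] MvPolynomial (Fin n) ℂ →ₗ⋆[ℂ] ℂ :=
  LinearMap.mk₂'ₛₗ (RingHom.id ℂ) (starRingEnd ℂ)
    (fun p q => ∫ z, a z * (eval z p * conj (eval z q)) ∂(bergmanMeasure n lam))
    (fun p p' q => by
      rw [← integral_add (integrable_symbol_mul ha p q) (integrable_symbol_mul ha p' q)]
      refine integral_congr_ae (Eventually.of_forall fun z => ?_)
      simp only [map_add]
      ring)
    (fun c p q => by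
      rw [smul_eq_mul, ← integral_const_mul]
      refine integral_congr_ae (Eventually.of_forall fun z => ?_)
      simp only [smul_eval, RingHom.id_apply]
      ring)
    (fun p q q' => by
      rw [← integral_add (integrable_symbol_mul ha p q) (integrable_symbol_mul ha p q')]
      refine integral_congr_ae (Eventually.of_forall fun z => ?_)
      simp only [map_add]
      ring)
    (fun c p q => by
      rw [smul_eq_mul, ← integral_const_mul]
      refine integral_congr_ae (Eventually.of_forall fun z => ?_)
      simp only [smul_eval, map_mul]
      ring)

theorem symbolForm_apply (ha : MemLp a ⊤ (bergmanMeasure n lam)) (p q : MvPolynomial (Fin n) ℂ) :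
    symbolForm ha p q = ∫ z, a z * (eval z p * conj (eval z q)) ∂(bergmanMeasure n lam) := rfl

theorem integral_symbol_comp {e : (Fin n → ℂ) → (Fin n → ℂ)}
    (he : MeasurePreserving e (bergmanMeasure n lam) (bergmanMeasure n lam))
    (hinv : ∀ z ∈ domain n, a (e z) = a z) (ha : MemLp a ⊤ (bergmanMeasure n lam))
    (p q : MvPolynomial (Fin n) ℂ) :
    ∫ z, a z * (eval (e z) p * conj (eval (e z) q)) ∂(bergmanMeasure n lam)
      = ∫ z, a z * (eval z p * conj (eval z q)) ∂(bergmanMeasure n lam) := by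
  conv_rhs => rw [← he.map_eq]
  rw [integral_map he.aemeasurable (by
    rw [he.map_eq]; exact (integrable_symbol_mul ha p q).aestronglyMeasurable)]
  refine integral_congr_ae ?_
  filter_upwards [ae_mem_domain n lam] with z hz
  rw [hinv z hz]

/-- The rotation t = exp(iπ/(k − l)) multiplies the integrand by t^k t̄^l = −1 but preserves the
integral. -/
theorem symbolForm_eq_zero_of_degree_ne (ha : MemLp a ⊤ (bergmanMeasure n lam))
    (hinv : ∀ (t : Circle), ∀ z ∈ domain n, a ((t : ℂ) • z) = a z) {k l : ℕ} (hkl : k ≠ l)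
    {p q : MvPolynomial (Fin n) ℂ} (hp : p.IsHomogeneous k) (hq : q.IsHomogeneous l) :
    symbolForm ha p q = 0 := by
  have hkl' : (k : ℝ) - l ≠ 0 := sub_ne_zero.2 (Nat.cast_injective.ne hkl)
  set t : Circle := Circle.exp (Real.pi / (k - l)) with ht
  have h1 := integral_symbol_comp (measurePreserving_circle lam t) (hinv t) ha p q
  simp only [eval_smul_of_isHomogeneous hp, eval_smul_of_isHomogeneous hq, map_mul, map_pow] at h1
  have h2 : (t : ℂ) ^ k * conj (t : ℂ) ^ l = -1 := by
    rw [ht, Circle.coe_exp, ← Complex.exp_conj, ← Complex.exp_nat_mul, ← Complex.exp_nat_mul,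
      ← Complex.exp_add, ← Complex.exp_pi_mul_I]
    congr 1
    have h3 : (k : ℂ) - l ≠ 0 := by exact_mod_cast hkl'
    simp only [map_mul, Complex.conj_I, Complex.conj_ofReal]
    push_cast
    field_simp
    ring
  have h3 : ∀ z : Fin n → ℂ, a z * ((t : ℂ) ^ k * eval z p * (conj (t : ℂ) ^ l * conj (eval z q)))
      = -1 * (a z * (eval z p * conj (eval z q))) := by
    intro z
    rw [← h2]
    ring
  simp only [h3] at h1
  rw [integral_const_mul] at h1
  rw [symbolForm_apply]
  linear_combination (-1 / 2 : ℂ) * h1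

/-- The integral of a · p∘R_θ · conj(q∘R_θ) does not depend on θ; its derivative at θ = 0 is the
skewness identity. The polynomial bounds on the rotation-invariant domain justify differentiating
under the integral. -/
theorem rotInvariant_symbolForm (ha : MemLp a ⊤ (bergmanMeasure n lam))
    (hinv : ∀ i j : Fin n, i ≠ j → ∀ (θ : ℝ), ∀ z ∈ domain n, a (planeRot i j θ z) = a z) :
    RotInvariant (symbolForm ha) := by
  intro i j p q
  rcases eq_or_ne i j with rfl | hij
  · have h0 : ∀ f : MvPolynomial (Fin n) ℂ, rot i i f = 0 := fun f => by rw [rot_apply, sub_self]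
    simp [h0]
  set ν := bergmanMeasure n lam
  set F : ℝ → (Fin n → ℂ) → ℂ := fun θ z =>
    a z * (eval (planeRot i j θ z) p * conj (eval (planeRot i j θ z) q)) with hF
  set F' : ℝ → (Fin n → ℂ) → ℂ := fun θ z =>
    a z * (eval (planeRot i j θ z) (rot i j p) * conj (eval (planeRot i j θ z) q)
      + eval (planeRot i j θ z) p * conj (eval (planeRot i j θ z) (rot i j q))) with hF'
  have hrc : ∀ θ, Continuous (planeRot i j θ : (Fin n → ℂ) → Fin n → ℂ) := by
    intro θ
    refine continuous_pi fun k => ?_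
    simp only [planeRot]
    split_ifs <;> fun_prop
  have hpc : ∀ θ (f : MvPolynomial (Fin n) ℂ), Continuous fun z => eval (planeRot i j θ z) f :=
    fun θ f => f.continuous_eval.comp (hrc θ)
  have hFm : ∀ θ, AEStronglyMeasurable (F θ) ν := fun θ =>
    ha.1.mul ((hpc θ p).mul (Complex.continuous_conj.comp (hpc θ q))).aestronglyMeasurable
  have hF'm : AEStronglyMeasurable (F' 0) ν :=
    ha.1.mul (((hpc 0 _).mul (Complex.continuous_conj.comp (hpc 0 q))).add
      ((hpc 0 p).mul (Complex.continuous_conj.comp (hpc 0 _)))).aestronglyMeasurable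
  have hr0 : ∀ z : Fin n → ℂ, planeRot i j 0 z = z := by
    intro z
    funext k
    simp only [planeRot, Real.cos_zero, Real.sin_zero]
    split_ifs with h1 h2
    · simp [h1]
    · simp [h2]
    · rfl
  have hFint : Integrable (F 0) ν := by
    simp only [hF, hr0]
    exact integrable_symbol_mul ha p q
  obtain ⟨C1, hC10, hC1⟩ := exists_bound_eval p
  obtain ⟨C2, hC20, hC2⟩ := exists_bound_eval q
  obtain ⟨C3, hC30, hC3⟩ := exists_bound_eval (rot i j p)
  obtain ⟨C4, hC40, hC4⟩ := exists_bound_eval (rot i j q)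
  have hbound : ∀ᵐ z ∂ν, ∀ θ ∈ (univ : Set ℝ), ‖F' θ z‖ ≤ ‖a z‖ * (C3 * C2 + C1 * C4) := by
    filter_upwards [ae_mem_domain n lam] with z hz θ _
    have hz' := planeRot_mem_domain hij θ hz
    simp only [hF']
    rw [norm_mul]
    refine mul_le_mul_of_nonneg_left ((norm_add_le _ _).trans ?_) (norm_nonneg _)
    rw [norm_mul, norm_mul, Complex.norm_conj, Complex.norm_conj]
    exact add_le_add (mul_le_mul (hC3 _ hz') (hC2 _ hz') (norm_nonneg _) hC30)
      (mul_le_mul (hC1 _ hz') (hC4 _ hz') (norm_nonneg _) hC10)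
  have hbint : Integrable (fun z => ‖a z‖ * (C3 * C2 + C1 * C4)) ν :=
    ((ha.mono_exponent le_top).integrable le_rfl).norm.mul_const _
  have hderiv : ∀ᵐ z ∂ν, ∀ θ ∈ (univ : Set ℝ), HasDerivAt (fun s => F s z) (F' θ z) θ := by
    refine Eventually.of_forall fun z θ _ => ?_
    exact ((hasDerivAt_eval_planeRot hij z p θ).mul
      (hasDerivAt_eval_planeRot hij z q θ).star).const_mul (a z)
  obtain ⟨-, hd⟩ := hasDerivAt_integral_of_dominated_loc_of_deriv_le (x₀ := (0 : ℝ)) univ_mem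
    (Eventually.of_forall hFm) hFint hF'm hbound hbint hderiv
  have hconst : (fun θ => ∫ z, F θ z ∂ν) = fun _ => ∫ z, F 0 z ∂ν := by
    funext θ
    have := integral_symbol_comp (measurePreserving_planeRot lam hij θ) (hinv i j hij θ) ha p q
    simp only [hF, hr0]
    exact this
  rw [hconst] at hd
  have h0 := hd.unique (hasDerivAt_const (0 : ℝ) _)
  simp only [hF', hr0, mul_add] at h0
  rw [integral_add (integrable_symbol_mul ha _ _) (integrable_symbol_mul ha _ _)] at h0
  rw [symbolForm_apply, symbolForm_apply]
  exact eq_neg_of_add_eq_zero_left h0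

theorem symbolForm_one_self_eq_zero (hn : 2 ≤ n) (hlam : (n : ℝ) - 1 < lam)
    (h1 : MemLp (fun _ : Fin n → ℂ => (1 : ℂ)) ⊤ (bergmanMeasure n lam))
    {p : MvPolynomial (Fin n) ℂ} (h : symbolForm h1 p p = 0) : ∀ z ∈ domain n, eval z p = 0 := by
  rw [symbolForm_apply] at h
  have h2 : ∀ z, (1 : ℂ) * (eval z p * conj (eval z p)) = ((‖eval z p‖ ^ 2 : ℝ) : ℂ) := by
    intro z
    rw [one_mul, Complex.mul_conj']
    norm_cast
  simp only [h2] at h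
  rw [integral_complex_ofReal, Complex.ofReal_eq_zero,
    integral_eq_zero_iff_of_nonneg (fun z => by positivity)
      (by simpa using (memLp_eval lam p 2).integrable_norm_pow (by norm_num))] at h
  refine eqOn_domain_of_ae_eq hn hlam p.continuous_eval.continuousOn continuousOn_const
    (h.mono fun z hz => ?_)
  simpa using hz

end SymbolForm

theorem zero_mem_domain (n : ℕ) : (0 : Fin n → ℂ) ∈ domain n := by
  simp [domain, absSq, dot]

/-- The domain is a neighbourhood of 0, and homogeneity carries vanishing there to every point. -/
theorem eq_zero_of_eval_eq_zero_on_domain {n k : ℕ} {p : MvPolynomial (Fin n) ℂ}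
    (hp : p.IsHomogeneous k) (h : ∀ z ∈ domain n, eval z p = 0) : p = 0 := by
  refine MvPolynomial.funext fun z => ?_
  rw [map_zero]
  have hc : Tendsto (fun r : ℝ => (r : ℂ) • z) (𝓝[≠] 0) (𝓝 0) := by
    have : Continuous fun r : ℝ => (r : ℂ) • z := by fun_prop
    have h2 := this.tendsto 0
    simp only [Complex.ofReal_zero, zero_smul] at h2
    exact h2.mono_left nhdsWithin_le_nhds
  obtain ⟨r, hr, hr0⟩ := ((hc.eventually ((isOpen_domain n).mem_nhds (zero_mem_domain n))).and
    self_mem_nhdsWithin).exists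
  have h1 := h _ hr
  rw [eval_smul_of_isHomogeneous hp] at h1
  exact (mul_eq_zero.1 h1).resolve_left (pow_ne_zero _ (Complex.ofReal_ne_zero.2 hr0))

end CartanIV

namespace CartanIV

/-! ## Derivatives of holomorphic functions of several variables -/

/-- Near z₀ the directional derivative is a Cauchy integral of ζ ↦ F(z + ζv) over a small fixed
circle, which may be differentiated in z under the integral sign. -/
theorem differentiableOn_fderiv_apply {n : ℕ} {U : Set (Fin n → ℂ)} (hU : IsOpen U)
    {F : (Fin n → ℂ) → ℂ} (hF : DifferentiableOn ℂ F U) (v : Fin n → ℂ) :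
    DifferentiableOn ℂ (fun z => fderiv ℂ F z v) U := by
  intro z₀ hz₀
  refine DifferentiableAt.differentiableWithinAt ?_
  obtain ⟨R, hR, hRU⟩ := Metric.nhds_basis_closedBall.mem_iff.1 (hU.mem_nhds hz₀)
  -- Three nested radii: z stays within ρ, z + ζv within 2ρ, and the Cauchy estimate for the
  -- derivative there uses balls of radius ρ inside R = 3ρ.
  set ρ := R / 3 with hρ
  have hρ0 : 0 < ρ := by positivity
  have hR3 : R = 3 * ρ := by rw [hρ]; ring
  have hdiff : ∀ w ∈ Metric.ball z₀ R, DifferentiableAt ℂ F w := fun w hw =>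
    hF.differentiableAt (hU.mem_nhds (hRU (Metric.ball_subset_closedBall hw)))
  obtain ⟨M, hM⟩ := (isCompact_closedBall z₀ R).exists_bound_of_continuousOn
    (hF.continuousOn.mono hRU)
  have hfd : ∀ w ∈ Metric.ball z₀ (2 * ρ), ‖fderiv ℂ F w‖ ≤ (2 * M) / ρ := by
    intro w hw
    rw [Metric.mem_ball] at hw
    have hsub : Metric.ball w ρ ⊆ Metric.closedBall z₀ R :=
      (Metric.ball_subset_ball' (by linarith)).trans Metric.ball_subset_closedBall
    refine Complex.norm_fderiv_le_div_of_mapsTo_ball (hF.mono (hsub.trans hRU)) ?_ hρ0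
    intro y hy
    rw [Metric.mem_closedBall, dist_eq_norm]
    refine (norm_sub_le _ _).trans ?_
    linarith [hM y (hsub hy), hM w (hsub (Metric.mem_ball_self hρ0))]
  set δ := ρ / (‖v‖ + 1) with hδ
  have hδ0 : 0 < δ := by positivity
  have hδv : δ * ‖v‖ < ρ := by
    rw [hδ, div_mul_eq_mul_div, div_lt_iff₀ (by positivity)]
    nlinarith [norm_nonneg v]
  have hmem : ∀ z ∈ Metric.ball z₀ ρ, ∀ ζ ∈ Metric.closedBall (0 : ℂ) δ,
      z + ζ • v ∈ Metric.ball z₀ (2 * ρ) := by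
    intro z hz ζ hζ
    rw [mem_closedBall_zero_iff] at hζ
    rw [Metric.mem_ball, dist_eq_norm] at hz ⊢
    calc ‖z + ζ • v - z₀‖ = ‖(z - z₀) + ζ • v‖ := by congr 1; abel
      _ ≤ ‖z - z₀‖ + ‖ζ • v‖ := norm_add_le _ _
      _ < ρ + ρ := by
          refine add_lt_add_of_lt_of_le hz ?_
          rw [norm_smul]
          exact (mul_le_mul_of_nonneg_right hζ (norm_nonneg v)).trans hδv.le
      _ = 2 * ρ := by ring
  have hsub2 : Metric.ball z₀ (2 * ρ) ⊆ Metric.ball z₀ R := Metric.ball_subset_ball (by linarith)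
  have hformula : ∀ z ∈ Metric.ball z₀ ρ, fderiv ℂ F z v = (2 * Real.pi * Complex.I)⁻¹ •
      ∮ ζ in C(0, δ), (1 / (ζ - 0) ^ 2) • F (z + ζ • v) := by
    intro z hz
    have hd : ∀ ζ ∈ Metric.closedBall (0 : ℂ) δ,
        HasDerivAt (fun ζ : ℂ => F (z + ζ • v)) (fderiv ℂ F (z + ζ • v) v) ζ := by
      intro ζ hζ
      have h1 : HasDerivAt (fun ζ : ℂ => z + ζ • v) v ζ := by
        simpa using ((hasDerivAt_id ζ).smul_const v).const_add z
      exact (hdiff _ (hsub2 (hmem z hz ζ hζ))).hasFDerivAt.comp_hasDerivAt ζ h1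
    have h2 := DifferentiableOn.deriv_eq_smul_circleIntegral (c := (0 : ℂ)) hδ0
      (fun ζ hζ => (hd ζ hζ).differentiableAt.differentiableWithinAt)
    rw [h2, smul_smul, inv_mul_cancel₀ Complex.two_pi_I_ne_zero, one_smul,
      (hd 0 (Metric.mem_closedBall_self hδ0.le)).deriv, zero_smul, add_zero]
  have heq : (fun z => fderiv ℂ F z v) =ᶠ[𝓝 z₀] fun z => (2 * Real.pi * Complex.I)⁻¹ •
      ∮ ζ in C(0, δ), (1 / (ζ - 0) ^ 2) • F (z + ζ • v) := by
    filter_upwards [Metric.ball_mem_nhds z₀ hρ0] with z hz using hformula z hz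
  suffices hG : DifferentiableAt ℂ
      (fun z => ∮ ζ in C(0, δ), (1 / (ζ - 0) ^ 2) • F (z + ζ • v)) z₀ from
    (hG.const_smul (2 * Real.pi * Complex.I : ℂ)⁻¹).congr_of_eventuallyEq heq
  have hcm : ∀ θ, circleMap 0 δ θ ∈ Metric.closedBall (0 : ℂ) δ := fun θ => by
    simp [abs_of_pos hδ0]
  set c : ℝ → ℂ := fun θ => deriv (circleMap 0 δ) θ * (1 / (circleMap 0 δ θ - 0) ^ 2) with hc
  have hcc : Continuous c := by
    have h1 : ∀ θ, circleMap 0 δ θ - 0 ≠ 0 := fun θ => by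
      rw [sub_zero]; exact circleMap_ne_center hδ0.ne'
    have h2 : Continuous (circleMap 0 δ) := continuous_circleMap 0 δ
    simp only [hc, deriv_circleMap]
    exact (h2.mul continuous_const).mul (continuous_const.div ((h2.sub continuous_const).pow 2)
      fun θ => pow_ne_zero 2 (h1 θ))
  have hcn : ∀ θ, ‖c θ‖ = δ⁻¹ := by
    intro θ
    simp only [hc, deriv_circleMap, sub_zero, norm_mul, Complex.norm_I, norm_div, norm_pow,
      norm_circleMap_zero, abs_of_pos hδ0, norm_one, mul_one]
    field_simp
  have hint : (fun z => ∮ ζ in C(0, δ), (1 / (ζ - 0) ^ 2) • F (z + ζ • v))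
      = fun z => ∫ θ in (0 : ℝ)..2 * Real.pi, c θ * F (z + circleMap 0 δ θ • v) := by
    funext z
    simp only [circleIntegral, hc, smul_eq_mul, mul_assoc]
  rw [hint]
  have hpath : ∀ z, Continuous fun θ : ℝ => z + circleMap 0 δ θ • v := fun z =>
    continuous_const.add ((continuous_circleMap 0 δ).smul continuous_const)
  have hcont : ∀ z ∈ Metric.ball z₀ ρ,
      Continuous fun θ : ℝ => c θ * F (z + circleMap 0 δ θ • v) := by
    intro z hz
    refine hcc.mul (continuous_iff_continuousAt.2 fun θ => ?_)
    exact ContinuousAt.comp (g := F)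
      (hdiff _ (hsub2 (hmem z hz _ (hcm θ)))).continuousAt (hpath z).continuousAt
  have h := intervalIntegral.hasFDerivAt_integral_of_dominated_of_fderiv_le (𝕜 := ℂ)
    (μ := volume) (a := 0) (b := 2 * Real.pi) (x₀ := z₀) (s := Metric.ball z₀ ρ)
    (F := fun z θ => c θ * F (z + circleMap 0 δ θ • v))
    (F' := fun z θ => c θ • fderiv ℂ F (z + circleMap 0 δ θ • v))
    (bound := fun _ => δ⁻¹ * ((2 * M) / ρ))
    (Metric.ball_mem_nhds z₀ hρ0)
    (by
      filter_upwards [Metric.ball_mem_nhds z₀ hρ0] with z hz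
      exact (hcont z hz).aestronglyMeasurable)
    ((hcont z₀ (Metric.mem_ball_self hρ0)).intervalIntegrable _ _)
    ((hcc.measurable.smul ((measurable_fderiv ℂ F).comp
      (hpath z₀).measurable)).aestronglyMeasurable)
    (Eventually.of_forall fun θ _ z hz => by
      rw [norm_smul, hcn]
      exact mul_le_mul_of_nonneg_left (hfd _ (hmem z hz _ (hcm θ))) (by positivity))
    intervalIntegrable_const
    (Eventually.of_forall fun θ _ z hz => by
      have h1 := (hdiff _ (hsub2 (hmem z hz _ (hcm θ)))).hasFDerivAt.comp z
        ((hasFDerivAt_id z).add_const (circleMap 0 δ θ • v))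
      exact h1.const_mul (c θ))
  exact h.differentiableAt

/-! ## Taylor coefficients on the domain -/

open MvPolynomial

theorem hasDerivAt_slice {n : ℕ} {F : (Fin n → ℂ) → ℂ} (hF : DifferentiableOn ℂ F (domain n))
    {z : Fin n → ℂ} {ζ : ℂ} (hζ : ζ • z ∈ domain n) :
    HasDerivAt (fun ζ : ℂ => F (ζ • z)) (fderiv ℂ F (ζ • z) z) ζ := by
  have h1 : HasDerivAt (fun ζ : ℂ => ζ • z) z ζ := by
    simpa using (hasDerivAt_id ζ).smul_const z
  exact (hF.differentiableAt ((isOpen_domain n).mem_nhds hζ)).hasFDerivAt.comp_hasDerivAt ζ h1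

theorem differentiableOn_slice {n : ℕ} {F : (Fin n → ℂ) → ℂ} (hF : DifferentiableOn ℂ F (domain n))
    {z : Fin n → ℂ} (hz : z ∈ domain n) :
    DifferentiableOn ℂ (fun ζ : ℂ => F (ζ • z)) (Metric.closedBall 0 1) := fun ζ hζ =>
  (hasDerivAt_slice hF (smul_mem_domain hz
    (by simpa using hζ))).differentiableAt.differentiableWithinAt

/-- Differentiating the slice gives ∑ z_j (∂_j F)(ζz), so the degree rises by one with each
derivative. -/
theorem exists_polynomial_iteratedDeriv {n : ℕ} (m : ℕ) : ∀ {F : (Fin n → ℂ) → ℂ},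
    DifferentiableOn ℂ F (domain n) → ∃ P : MvPolynomial (Fin n) ℂ, P.IsHomogeneous m ∧
      ∀ z ∈ domain n, iteratedDeriv m (fun ζ : ℂ => F (ζ • z)) 0 = eval z P := by
  induction m with
  | zero =>
    intro F _
    exact ⟨C (F 0), isHomogeneous_C _ _, fun z _ => by simp⟩
  | succ m ih =>
    intro F hF
    have hD : ∀ j : Fin n, DifferentiableOn ℂ (fun z => fderiv ℂ F z (Pi.single j 1)) (domain n) :=
      fun j => differentiableOn_fderiv_apply (isOpen_domain n) hF _
    choose P hP hPe using fun j => ih (hD j)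
    refine ⟨∑ j, X j * P j, IsHomogeneous.sum _ _ _ fun j _ => ?_, fun z hz => ?_⟩
    · rw [add_comm]
      exact (isHomogeneous_X ℂ j).mul (hP j)
    · have hball : Metric.ball (0 : ℂ) 1 ∈ 𝓝 (0 : ℂ) := Metric.ball_mem_nhds _ one_pos
      have h1 : deriv (fun ζ : ℂ => F (ζ • z)) =ᶠ[𝓝 0]
          fun ζ => ∑ j, z j * fderiv ℂ F (ζ • z) (Pi.single j 1) := by
        filter_upwards [hball] with ζ hζ
        rw [(hasDerivAt_slice hF (smul_mem_domain hz (le_of_lt (by simpa using hζ)))).deriv]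
        generalize fderiv ℂ F (ζ • z) = L
        conv_lhs => rw [← Finset.univ_sum_single z, map_sum]
        refine Finset.sum_congr rfl fun j _ => ?_
        rw [← smul_eq_mul, ← map_smul, ← Pi.single_smul, smul_eq_mul, mul_one]
      have h2 : ∀ j, ContDiffAt ℂ m
          (fun ζ : ℂ => z j * fderiv ℂ F (ζ • z) (Pi.single j 1)) 0 := fun j =>
        contDiffAt_const.mul (((differentiableOn_slice (hD j) hz).mono
          Metric.ball_subset_closedBall).analyticAt hball).contDiffAt
      rw [iteratedDeriv_succ', Filter.EventuallyEq.iteratedDeriv_eq m h1,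
        iteratedDeriv_fun_sum fun j _ => h2 j, map_sum]
      refine Finset.sum_congr rfl fun j _ => ?_
      rw [iteratedDeriv_const_mul_field, hPe j z hz, map_mul, eval_X]

theorem eq_zero_of_iteratedDeriv_eq_zero {n : ℕ} {F : (Fin n → ℂ) → ℂ}
    (hF : DifferentiableOn ℂ F (domain n))
    (h : ∀ m, ∀ z ∈ domain n, iteratedDeriv m (fun ζ : ℂ => F (ζ • z)) 0 = 0) :
    ∀ z ∈ domain n, F z = 0 := by
  intro z hz
  have hc : Tendsto (fun r : ℝ => (r : ℂ) • z) (𝓝[>] 1) (𝓝 z) := by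
    have h1 : Continuous fun r : ℝ => (r : ℂ) • z := by fun_prop
    have h2 := h1.tendsto 1
    simp only [Complex.ofReal_one, one_smul] at h2
    exact h2.mono_left nhdsWithin_le_nhds
  -- The Taylor series is available only on the open unit disc, so z is written as r⁻¹ (rz) with r >
  -- 1 and rz still in the domain.
  obtain ⟨r, hr, hr1⟩ := ((hc.eventually ((isOpen_domain n).mem_nhds hz)).and
    self_mem_nhdsWithin).exists
  have hr1' : (1 : ℝ) < r := hr1
  have hr0 : (r : ℂ) ≠ 0 := Complex.ofReal_ne_zero.2 (by linarith)
  have hmem : (r : ℂ)⁻¹ ∈ Metric.ball (0 : ℂ) 1 := by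
    rw [mem_ball_zero_iff, norm_inv, Complex.norm_real, Real.norm_of_nonneg (by linarith)]
    exact inv_lt_one_of_one_lt₀ hr1'
  have h3 := Complex.hasSum_taylorSeries_on_ball ((differentiableOn_slice hF hr).mono
    Metric.ball_subset_closedBall) hmem
  simp only [h _ _ hr, smul_zero] at h3
  have h4 := h3.unique hasSum_zero
  rwa [smul_smul, inv_mul_cancel₀ hr0, one_smul] at h4

/-- Cauchy's formula on the unit circle: for p homogeneous of degree m, conj p(tz) = t^(−m) conj
p(z) supplies the kernel that extracts the m-th Taylor coefficient. -/
theorem iteratedDeriv_mul_conj_eq_integral {n : ℕ} {F : (Fin n → ℂ) → ℂ}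
    (hF : DifferentiableOn ℂ F (domain n)) {m : ℕ} {p : MvPolynomial (Fin n) ℂ}
    (hp : p.IsHomogeneous m) {z : Fin n → ℂ} (hz : z ∈ domain n) :
    iteratedDeriv m (fun ζ : ℂ => F (ζ • z)) 0 * conj (eval z p)
      = (2 * Real.pi * Complex.I / m.factorial : ℂ)⁻¹ * Complex.I *
        ∫ θ in Ioc 0 (2 * Real.pi),
          F ((Circle.exp θ : ℂ) • z) * conj (eval ((Circle.exp θ : ℂ) • z) p) := by
  have hfac : ((m.factorial : ℂ)) ≠ 0 := Nat.cast_ne_zero.2 m.factorial_ne_zero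
  have hpi : (Real.pi : ℂ) ≠ 0 := Complex.ofReal_ne_zero.2 Real.pi_ne_zero
  have h1 := DifferentiableOn.circleIntegral_one_div_sub_center_pow_smul one_pos m
    (differentiableOn_slice hF hz)
  rw [circleIntegral, intervalIntegral.integral_of_le (by positivity), smul_eq_mul] at h1
  have h2 : ∀ θ : ℝ, F ((Circle.exp θ : ℂ) • z) * conj (eval ((Circle.exp θ : ℂ) • z) p)
      = conj (eval z p) * (-Complex.I) *
      (deriv (circleMap 0 1) θ • (1 / (circleMap 0 1 θ - 0) ^ (m + 1)) •
        F (circleMap 0 1 θ • z)) := by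
    intro θ
    have h3 : circleMap 0 1 θ = (Circle.exp θ : ℂ) := by
      rw [Circle.coe_exp, circleMap, zero_add, Complex.ofReal_one, one_mul]
    have h4 : (Circle.exp θ : ℂ) ≠ 0 := Circle.coe_ne_zero _
    have h5 : conj (Circle.exp θ : ℂ) = (Circle.exp θ : ℂ)⁻¹ := by
      rw [← Circle.coe_inv_eq_conj, Circle.coe_inv]
    rw [deriv_circleMap, h3, eval_smul_of_isHomogeneous hp, map_mul, map_pow, h5, smul_eq_mul,
      smul_eq_mul, sub_zero]
    generalize (Circle.exp θ : ℂ) = t at *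
    generalize F (t • z) = w
    generalize conj (eval z p) = u
    rw [inv_pow, pow_succ]
    have h6 : t ^ m ≠ 0 := pow_ne_zero _ h4
    generalize t ^ m = s at *
    field_simp
    linear_combination (w * u) * Complex.I_sq
  simp only [h2]
  rw [integral_const_mul, h1]
  generalize iteratedDeriv m (fun ζ : ℂ => F (ζ • z)) 0 = w
  generalize conj (eval z p) = u
  have := Complex.I_ne_zero
  field_simp
  linear_combination (w * u) * Complex.I_sq

theorem integral_circle_average_eq_zero {n : ℕ} {lam : ℝ} {G : (Fin n → ℂ) → ℂ}
    (hGm : Measurable G) (hGi : Integrable G (bergmanMeasure n lam))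
    (h0 : ∫ z, G z ∂(bergmanMeasure n lam) = 0) :
    ∫ z, (∫ θ in Ioc 0 (2 * Real.pi), G ((Circle.exp θ : ℂ) • z)) ∂(bergmanMeasure n lam) = 0 := by
  have hexp : Measurable (fun θ : ℝ => (Circle.exp θ : ℂ)) := by fun_prop
  have hact : Measurable (fun x : (Fin n → ℂ) × ℝ => (Circle.exp x.2 : ℂ) • x.1) :=
    (hexp.comp measurable_snd).smul measurable_fst
  have hcomp : ∀ (θ : ℝ) {E : Type} [NormedAddCommGroup E] [NormedSpace ℝ E] (H : (Fin n → ℂ) → E),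
      AEStronglyMeasurable H (bergmanMeasure n lam) →
      ∫ z, H ((Circle.exp θ : ℂ) • z) ∂(bergmanMeasure n lam) = ∫ z, H z ∂(bergmanMeasure n lam) := by
    intro θ E _ _ H hH
    have h := measurePreserving_circle (n := n) lam (Circle.exp θ)
    conv_rhs => rw [← h.map_eq]
    rw [integral_map h.aemeasurable (by rwa [h.map_eq])]
  have hKi : Integrable (Function.uncurry fun (z : Fin n → ℂ) (θ : ℝ) => G ((Circle.exp θ : ℂ) • z))
      ((bergmanMeasure n lam).prod (volume.restrict (Ioc 0 (2 * Real.pi)))) := by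
    have hKm : AEStronglyMeasurable
        (Function.uncurry fun (z : Fin n → ℂ) (θ : ℝ) => G ((Circle.exp θ : ℂ) • z))
        ((bergmanMeasure n lam).prod (volume.restrict (Ioc 0 (2 * Real.pi)))) :=
      (hGm.comp hact).aestronglyMeasurable
    refine (integrable_prod_iff' hKm).2 ⟨Eventually.of_forall fun θ =>
      (measurePreserving_circle lam (Circle.exp θ)).integrable_comp_of_integrable hGi, ?_⟩
    refine (integrable_const (∫ z, ‖G z‖ ∂(bergmanMeasure n lam))).congr
      (Eventually.of_forall fun θ => ?_)
    exact (hcomp θ (fun z => ‖G z‖) hGm.norm.aestronglyMeasurable).symm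
  rw [integral_integral_swap hKi]
  simp only [hcomp _ G hGm.aestronglyMeasurable, h0, integral_zero]

/-- If F is orthogonal to p, then so is the degree m Taylor term of F, up to m!: circle averaging
commutes with the invariant integral. -/
theorem integral_iteratedDeriv_mul_conj {n : ℕ} {lam : ℝ} {F : (Fin n → ℂ) → ℂ}
    (hF : DifferentiableOn ℂ F (domain n)) (hFm : Measurable F)
    (hF2 : MemLp F 2 (bergmanMeasure n lam)) {m : ℕ} {p : MvPolynomial (Fin n) ℂ}
    (hp : p.IsHomogeneous m) (h0 : ∫ z, F z * conj (eval z p) ∂(bergmanMeasure n lam) = 0) :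
    ∫ z, iteratedDeriv m (fun ζ : ℂ => F (ζ • z)) 0 * conj (eval z p) ∂(bergmanMeasure n lam)
      = 0 := by
  have hpm : Measurable fun z : Fin n → ℂ => conj (eval z p) :=
    (Complex.continuous_conj.comp p.continuous_eval).measurable
  have hGi : Integrable (fun z => F z * conj (eval z p)) (bergmanMeasure n lam) :=
    hF2.integrable_mul (memLp_eval lam p 2).star
  have h1 := integral_circle_average_eq_zero (G := fun z => F z * conj (eval z p))
    (hFm.mul hpm) hGi h0
  rw [integral_congr_ae ((ae_mem_domain n lam).mono fun z hz =>
    iteratedDeriv_mul_conj_eq_integral hF hp hz), integral_const_mul, h1, mul_zero]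

theorem eq_zero_of_orthogonal_polynomials {n : ℕ} (hn : 2 ≤ n) {lam : ℝ}
    (hlam : (n : ℝ) - 1 < lam) {F : (Fin n → ℂ) → ℂ} (hF : DifferentiableOn ℂ F (domain n))
    (hF2 : MemLp F 2 (bergmanMeasure n lam))
    (h0 : ∀ (m : ℕ) (p : MvPolynomial (Fin n) ℂ), p.IsHomogeneous m →
      ∫ z, F z * conj (eval z p) ∂(bergmanMeasure n lam) = 0) :
    ∀ z ∈ domain n, F z = 0 := by
  classical
  have hmeas := (isOpen_domain n).measurableSet
  -- Cutting F off outside the domain makes it measurable everywhere, as the Fubini argument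
  -- requires.
  set G := (domain n).indicator F with hG
  have hGF : EqOn G F (domain n) := fun z hz => indicator_of_mem hz F
  have hGFae : G =ᵐ[bergmanMeasure n lam] F := by
    filter_upwards [ae_mem_domain n lam] with z hz using hGF hz
  have hGd : DifferentiableOn ℂ G (domain n) := hF.congr hGF
  have hGm : Measurable G := by
    have := hF.continuousOn.measurable_piecewise (g := fun _ => (0 : ℂ)) continuousOn_const hmeas
    rw [hG, ← Set.piecewise_eq_indicator]
    exact this
  have hG2 : MemLp G 2 (bergmanMeasure n lam) := (memLp_congr_ae hGFae).2 hF2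
  have key := eq_zero_of_iteratedDeriv_eq_zero hGd fun m => by
    obtain ⟨P, hP, hPe⟩ := exists_polynomial_iteratedDeriv m hGd
    have h1 := integral_iteratedDeriv_mul_conj hGd hGm hG2 hP (by
      rw [← h0 m P hP]
      exact integral_congr_ae (hGFae.mono fun z hz => by simp only [hz]))
    have hone : MemLp (fun _ : Fin n → ℂ => (1 : ℂ)) ⊤ (bergmanMeasure n lam) := memLp_const 1
    -- The test polynomial is the Taylor term P itself, so its norm is zero.
    have h2 : symbolForm hone P P = 0 := by
      rw [symbolForm_apply, ← h1]
      refine integral_congr_ae ?_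
      filter_upwards [ae_mem_domain n lam] with z hz
      rw [hPe z hz, one_mul]
    intro z hz
    rw [hPe z hz]
    exact symbolForm_one_self_eq_zero hn hlam hone h2 z hz
  intro z hz
  rw [← hGF hz]
  exact key z hz

end CartanIV

namespace CartanIV

/-! ## Operators that are diagonal with respect to an orthogonal decomposition -/

section Diagonal

variable {ι H : Type*} [NormedAddCommGroup H] [InnerProductSpace ℂ H] {V : ι → Submodule ℂ H}

/-- `A` acts on each of the subspaces `V k` as a scalar. -/
def IsDiagonal (V : ι → Submodule ℂ H) (A : H →L[ℂ] H) : Prop :=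
  ∃ c : ι → ℂ, ∀ k, ∀ F ∈ V k, A F = c k • F

theorem eq_zero_of_inner_eq_zero (hd : (⨆ k, V k)ᗮ = ⊥) {x : H}
    (h : ∀ k, ∀ G ∈ V k, inner ℂ G x = 0) : x = 0 := by
  have h1 : x ∈ (⨆ k, V k)ᗮ := by
    rw [← Submodule.iInf_orthogonal, Submodule.mem_iInf]
    exact fun k => (Submodule.mem_orthogonal _ _).2 (h k)
  rwa [hd, Submodule.mem_bot] at h1

theorem isDiagonal_of_inner_eq (hd : (⨆ k, V k)ᗮ = ⊥) {A : H →L[ℂ] H}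
    (h : ∀ k, ∃ c : ℂ, ∀ F ∈ V k, ∀ l, ∀ G ∈ V l, inner ℂ G (A F) = c * inner ℂ G F) :
    IsDiagonal V A := by
  choose c hc using h
  refine ⟨c, fun k F hF => ?_⟩
  rw [← sub_eq_zero]
  refine eq_zero_of_inner_eq_zero hd fun l G hG => ?_
  rw [inner_sub_right, inner_smul_right, hc k F hF l G hG, sub_self]

/-- An eigenvector of the compression of A to the finite-dimensional W; invariance of W under A is
not yet known. -/
theorem exists_inner_eq_mul_inner {W : Submodule ℂ H} [FiniteDimensional ℂ W] (hW : W ≠ ⊥)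
    (A : H →L[ℂ] H) :
    ∃ c : ℂ, ∃ x ∈ W, x ≠ 0 ∧ ∀ y ∈ W, inner ℂ y (A x) = c * inner ℂ y x := by
  have := Submodule.nontrivial_iff_ne_bot.2 hW
  obtain ⟨c, hc⟩ := Module.End.exists_eigenvalue
    (W.orthogonalProjectionOnto ∘L A ∘L W.subtypeL).toLinearMap
  obtain ⟨x, hx⟩ := hc.exists_hasEigenvector
  refine ⟨c, x, x.2, fun h => hx.2 (Subtype.ext h), fun y hy => ?_⟩
  have h1 : W.orthogonalProjectionOnto (A x) = c • x := hx.apply_eq_smul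
  have h2 := Submodule.inner_orthogonalProjectionOnto_eq_of_mem_left (⟨y, hy⟩ : W) (A x)
  rw [← h2, h1, Submodule.coe_inner, Submodule.coe_smul, inner_smul_right]

variable [CompleteSpace H]

theorem isHilbertSum_of_orthogonal [∀ k, FiniteDimensional ℂ (V k)] (hd : (⨆ k, V k)ᗮ = ⊥)
    (ho : ∀ k l, k ≠ l → ∀ F ∈ V k, ∀ G ∈ V l, inner ℂ F G = 0) :
    IsHilbertSum ℂ (fun k => V k) fun k => (V k).subtypeₗᵢ := by
  have : ∀ k, CompleteSpace (V k) := fun k => FiniteDimensional.complete ℂ _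
  refine IsHilbertSum.mkInternal _ (fun k l hkl F G => ho k l hkl F F.2 G G.2) ?_
  rw [top_le_iff, Submodule.topologicalClosure_eq_top_iff, hd]

/-- Tested against V l, the adjoint acts on V k by the conjugate scalar when l = k; orthogonality
disposes of l ≠ k. -/
theorem IsDiagonal.star (hd : (⨆ k, V k)ᗮ = ⊥)
    (ho : ∀ k l, k ≠ l → ∀ F ∈ V k, ∀ G ∈ V l, inner ℂ F G = 0) {A : H →L[ℂ] H}
    (hA : IsDiagonal V A) : IsDiagonal V (star A) := by
  obtain ⟨c, hc⟩ := hA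
  refine ⟨fun k => conj (c k), fun k F hF => ?_⟩
  rw [← sub_eq_zero]
  refine eq_zero_of_inner_eq_zero hd fun l G hG => ?_
  rw [inner_sub_right, ContinuousLinearMap.star_eq_adjoint, ContinuousLinearMap.adjoint_inner_right,
    hc l G hG, inner_smul_left, inner_smul_right]
  rcases eq_or_ne l k with rfl | hlk
  · rw [sub_self]
  · rw [ho l k hlk G hG F hF, mul_zero, mul_zero, sub_zero]

theorem IsDiagonal.commute (hd : (⨆ k, V k)ᗮ = ⊥) {A B : H →L[ℂ] H} (hA : IsDiagonal V A)
    (hB : IsDiagonal V B) : A * B = B * A := by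
  obtain ⟨c, hc⟩ := hA
  obtain ⟨d, hd'⟩ := hB
  have hdense : (Submodule.span ℂ (⋃ k, (V k : Set H))).topologicalClosure = ⊤ := by
    rw [← Submodule.iSup_eq_span, Submodule.topologicalClosure_eq_top_iff, hd]
  refine ContinuousLinearMap.ext_on (Submodule.dense_iff_topologicalClosure_eq_top.2 hdense) ?_
  intro F hF
  obtain ⟨k, hk⟩ := mem_iUnion.1 hF
  rw [_root_.mul_apply_eq_comp, _root_.mul_apply_eq_comp, hd' k F hk, hc k F hk, map_smul,
    map_smul, hd' k F hk, hc k F hk, smul_comm]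

theorem IsDiagonal.of_mem_adjoin (hd : (⨆ k, V k)ᗮ = ⊥)
    (ho : ∀ k l, k ≠ l → ∀ F ∈ V k, ∀ G ∈ V l, inner ℂ F G = 0) {S : Set (H →L[ℂ] H)}
    (hS : ∀ A ∈ S, IsDiagonal V A) {A : H →L[ℂ] H} (hA : A ∈ StarAlgebra.adjoin ℂ S) :
    IsDiagonal V A := by
  induction hA using StarAlgebra.adjoin_induction with
  | mem A hA => exact hS A hA
  | algebraMap r =>
    exact ⟨fun _ => r, fun k F _ => by rw [Algebra.algebraMap_eq_smul_one]; rfl⟩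
  | add A B _ _ hA hB =>
    obtain ⟨c, hc⟩ := hA
    obtain ⟨d, hd⟩ := hB
    refine ⟨fun k => c k + d k, fun k F hF => ?_⟩
    rw [_root_.add_apply, hc k F hF, hd k F hF, add_smul]
  | mul A B _ _ hA hB =>
    obtain ⟨c, hc⟩ := hA
    obtain ⟨d, hd⟩ := hB
    refine ⟨fun k => c k * d k, fun k F hF => ?_⟩
    rw [_root_.mul_apply_eq_comp, hd k F hF, map_smul, hc k F hF, smul_smul, mul_comm]
  | star A _ hA => exact hA.star hd ho

theorem mul_comm_of_mem_cstarAlgebraGenerated (hd : (⨆ k, V k)ᗮ = ⊥)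
    (ho : ∀ k l, k ≠ l → ∀ F ∈ V k, ∀ G ∈ V l, inner ℂ F G = 0) {S : Set (H →L[ℂ] H)}
    (hS : ∀ A ∈ S, IsDiagonal V A) {A B : H →L[ℂ] H} (hA : A ∈ cstarAlgebraGenerated S)
    (hB : B ∈ cstarAlgebraGenerated S) : A * B = B * A := by
  -- Diagonality is needed only on the algebraic star algebra; commutativity then extends to the
  -- norm closure by continuity.
  have hcomm : ∀ x y : StarAlgebra.adjoin ℂ S, x * y = y * x := fun x y =>
    Subtype.ext ((IsDiagonal.of_mem_adjoin hd ho hS x.2).commute hd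
      (IsDiagonal.of_mem_adjoin hd ho hS y.2))
  exact congrArg Subtype.val (((StarAlgebra.adjoin ℂ S).commRingTopologicalClosure hcomm).mul_comm
    ⟨A, hA⟩ ⟨B, hB⟩)

end Diagonal

/-! ## Polynomials in the Bergman space -/

open MvPolynomial

section Bergman

variable {n : ℕ} {lam : ℝ}

theorem differentiable_eval (p : MvPolynomial (Fin n) ℂ) :
    Differentiable ℂ fun z : Fin n → ℂ => eval z p := by
  induction p using MvPolynomial.induction_on with
  | C a => simp
  | add p q hp hq =>
    simp only [map_add]
    exact hp.add hq
  | mul_X p i hp =>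
    simp only [map_mul, eval_X]
    exact hp.mul (differentiable_apply i)

/-- The class of a polynomial in the Bergman space. -/
def polyL (n : ℕ) (lam : ℝ) : MvPolynomial (Fin n) ℂ →ₗ[ℂ] bergman n lam where
  toFun p := ⟨(memLp_eval lam p 2).toLp _, fun z => eval z p, (differentiable_eval p).differentiableOn,
    MemLp.coeFn_toLp _⟩
  map_add' p q := by
    refine Subtype.ext ((MemLp.toLp_congr (memLp_eval lam (p + q) 2)
      ((memLp_eval lam p 2).add (memLp_eval lam q 2))
      (Eventually.of_forall fun z => ?_)).trans (MemLp.toLp_add (memLp_eval lam p 2) (memLp_eval lam q 2)))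
    exact map_add (eval z) p q
  map_smul' c p := by
    refine Subtype.ext ((MemLp.toLp_congr (memLp_eval lam (c • p) 2)
      ((memLp_eval lam p 2).const_smul c)
      (Eventually.of_forall fun z => ?_)).trans (MemLp.toLp_const_smul c (memLp_eval lam p 2)))
    exact smul_eval z p c

theorem coeFn_polyL (p : MvPolynomial (Fin n) ℂ) :
    (polyL n lam p : Lp ℂ 2 (bergmanMeasure n lam)) =ᵐ[bergmanMeasure n lam] fun z => eval z p :=
  MemLp.coeFn_toLp (memLp_eval lam p 2)

theorem mem_component_iff {k : ℕ × ℕ} {F : bergman n lam} : F ∈ component n lam k ↔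
    ∃ p ∈ harmonicPoly n k.1, F = polyL n lam (p * quad n ^ k.2) := by
  refine exists_congr fun p => and_congr_right fun _ => ?_
  have h : (fun z => eval z (p * quad n ^ k.2)) = fun z => eval z p * dot z z ^ k.2 := by
    funext z
    rw [map_mul, map_pow, eval_quad]
  have h1 := coeFn_polyL (lam := lam) (p * quad n ^ k.2)
  rw [h] at h1
  constructor
  · intro h2
    exact Subtype.ext (Lp.ext (h2.trans h1.symm))
  · rintro rfl
    exact h1

/-- Paired with an element of the Bergman space, the orthogonal projection drops out. Toeplitz
operators thereby reduce to `symbolForm`. -/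
theorem inner_toeplitz (a : Lp ℂ ⊤ (bergmanMeasure n lam)) (F G : bergman n lam) :
    inner ℂ G (toeplitz a F) = ∫ z, a z * ((F : Lp ℂ 2 (bergmanMeasure n lam)) z
      * conj ((G : Lp ℂ 2 (bergmanMeasure n lam)) z)) ∂(bergmanMeasure n lam) := by
  rw [toeplitz, ContinuousLinearMap.comp_apply,
    Submodule.inner_orthogonalProjectionOnto_eq_of_mem_left, L2.inner_def]
  refine integral_congr_ae ?_
  have h := (ContinuousLinearMap.mul ℂ ℂ).coeFn_holder (r := 2) a
    (F : Lp ℂ 2 (bergmanMeasure n lam))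
  filter_upwards [h] with z hz
  rw [RCLike.inner_apply]
  erw [hz]
  rw [ContinuousLinearMap.mul_apply', mul_assoc]

theorem inner_polyL_toeplitz_polyL {a : Lp ℂ ⊤ (bergmanMeasure n lam)} {b : (Fin n → ℂ) → ℂ}
    (hb : MemLp b ⊤ (bergmanMeasure n lam)) (hab : a =ᵐ[bergmanMeasure n lam] b)
    (p q : MvPolynomial (Fin n) ℂ) :
    inner ℂ (polyL n lam q) (toeplitz a (polyL n lam p)) = symbolForm hb p q := by
  rw [inner_toeplitz, symbolForm_apply]
  refine integral_congr_ae ?_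
  filter_upwards [hab, coeFn_polyL (lam := lam) p, coeFn_polyL (lam := lam) q] with z h1 h2 h3
  rw [h1, h2, h3]

theorem memLp_one (n : ℕ) (lam : ℝ) :
    MemLp (fun _ : Fin n → ℂ => (1 : ℂ)) ⊤ (bergmanMeasure n lam) := memLp_const 1

theorem inner_polyL (p q : MvPolynomial (Fin n) ℂ) :
    inner ℂ (polyL n lam q) (polyL n lam p) = symbolForm (memLp_one n lam) p q := by
  rw [symbolForm_apply, Submodule.coe_inner, L2.inner_def]
  refine integral_congr_ae ?_
  filter_upwards [coeFn_polyL (lam := lam) p, coeFn_polyL (lam := lam) q] with z h2 h3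
  rw [h2, h3, RCLike.inner_apply, one_mul]

theorem component_eq_map (k : ℕ × ℕ) : component n lam k =
    (harmonicPoly n k.1).map ((polyL n lam) ∘ₗ LinearMap.mulRight ℂ (quad n ^ k.2)) := by
  ext F
  rw [mem_component_iff, Submodule.mem_map]
  exact exists_congr fun p => and_congr_right fun _ => eq_comm

instance finiteDimensional_component (k : ℕ × ℕ) : FiniteDimensional ℂ (component n lam k) := by
  rw [component_eq_map]
  infer_instance

/-- A symbol is invariant when it is invariant under the circle and under the coordinate
rotations. -/
structure IsInvariantSymbol (a : (Fin n → ℂ) → ℂ) : Prop where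
  circle : ∀ t : Circle, ∀ z ∈ domain n, a ((t : ℂ) • z) = a z
  planeRot : ∀ i j : Fin n, i ≠ j → ∀ θ : ℝ, ∀ z ∈ domain n, a (planeRot i j θ z) = a z

theorem IsInvariantSymbol.symbolForm_eq_zero (hn : 2 ≤ n) {b : (Fin n → ℂ) → ℂ}
    (hinv : IsInvariantSymbol b) (hb : MemLp b ⊤ (bergmanMeasure n lam)) {k l : ℕ × ℕ} (hkl : k ≠ l)
    {p q : MvPolynomial (Fin n) ℂ} (hp : p ∈ harmonicPoly n k.1) (hq : q ∈ harmonicPoly n l.1) :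
    symbolForm hb (p * quad n ^ k.2) (q * quad n ^ l.2) = 0 := by
  by_cases h1 : k.1 = l.1
  · have h2 : k.2 ≠ l.2 := fun h => hkl (Prod.ext h1 h)
    have hq2 := quad_isHomogeneous n
    refine symbolForm_eq_zero_of_degree_ne hb hinv.circle ?_
      ((mem_harmonicPoly.1 hp).1.mul (hq2.pow k.2)) ((mem_harmonicPoly.1 hq).1.mul (hq2.pow l.2))
    omega
  · exact (rotInvariant_symbolForm hb hinv.planeRot).eq_zero hn h1 hp hq _ _

theorem isInvariantSymbol_one : IsInvariantSymbol (fun _ : Fin n → ℂ => (1 : ℂ)) :=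
  ⟨fun _ _ _ => rfl, fun _ _ _ _ _ _ => rfl⟩

/-! ### Orthogonality, completeness and diagonal Toeplitz operators -/

theorem inner_component_eq_zero (hn : 2 ≤ n) (k l : ℕ × ℕ) (hkl : k ≠ l) :
    ∀ F ∈ component n lam k, ∀ G ∈ component n lam l, inner ℂ F G = 0 := by
  intro F hF G hG
  obtain ⟨p, hp, rfl⟩ := mem_component_iff.1 hF
  obtain ⟨q, hq, rfl⟩ := mem_component_iff.1 hG
  rw [inner_polyL]
  exact isInvariantSymbol_one.symbolForm_eq_zero hn _ hkl.symm hq hp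

/-- By the Fischer decomposition, F orthogonal to all components is orthogonal to all homogeneous
polynomials, hence zero. -/
theorem iSup_component_orthogonal (hn : 2 ≤ n) (hlam : (n : ℝ) - 1 < lam) :
    (⨆ k, component n lam k)ᗮ = ⊥ := by
  rw [Submodule.eq_bot_iff]
  intro F hF
  rw [← Submodule.iInf_orthogonal, Submodule.mem_iInf] at hF
  have hW := mem_of_isHomogeneous (by omega) (W := (ℂ ∙ F)ᗮ.comap (polyL n lam)) fun k j h hh => by
    rw [Submodule.mem_comap, Submodule.mem_orthogonal_singleton_iff_inner_left]
    exact (Submodule.mem_orthogonal _ _).1 (hF (k, j)) _ (mem_component_iff.2 ⟨h, hh, rfl⟩)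
  obtain ⟨g, hg, hFg⟩ := F.2
  have hg2 : MemLp g 2 (bergmanMeasure n lam) :=
    (memLp_congr_ae hFg).1 (Lp.memLp (F : Lp ℂ 2 (bergmanMeasure n lam)))
  have h0 := eq_zero_of_orthogonal_polynomials hn hlam hg hg2 fun m p hp => by
    have h1 := hW m 0 p hp
    rw [pow_zero, mul_one, Submodule.mem_comap,
      Submodule.mem_orthogonal_singleton_iff_inner_left, Submodule.coe_inner, L2.inner_def] at h1
    rw [← h1]
    refine integral_congr_ae ?_
    filter_upwards [hFg, coeFn_polyL (lam := lam) p] with z h2 h3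
    rw [h2, h3, RCLike.inner_apply]
  refine Subtype.ext (Lp.ext (hFg.trans ?_))
  filter_upwards [ae_mem_domain n lam, Lp.coeFn_zero ℂ 2 (bergmanMeasure n lam)] with z hz hz0
  rw [h0 z hz, Submodule.coe_zero, hz0, Pi.zero_apply]

/-- The compression to a component has an eigenvector with eigenvalue c; Schur's lemma spreads c
over the whole component. Pairings with other components vanish, so by completeness T_a itself acts
as c. -/
theorem isDiagonal_toeplitz (hn : 3 ≤ n) (hlam : (n : ℝ) - 1 < lam)
    {a : Lp ℂ ⊤ (bergmanMeasure n lam)} {b : (Fin n → ℂ) → ℂ}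
    (hb : MemLp b ⊤ (bergmanMeasure n lam)) (hab : a =ᵐ[bergmanMeasure n lam] b)
    (hinv : IsInvariantSymbol b) : IsDiagonal (component n lam) (toeplitz a) := by
  refine isDiagonal_of_inner_eq (iSup_component_orthogonal (by omega) hlam) fun k => ?_
  have h1 := memLp_one n lam
  by_cases hbot : component n lam k = ⊥
  · refine ⟨0, fun F hF l G _ => ?_⟩
    rw [hbot, Submodule.mem_bot] at hF
    rw [hF, map_zero, inner_zero_right, zero_mul]
  obtain ⟨c, F₀, hF₀, hne, heig⟩ := exists_inner_eq_mul_inner hbot (toeplitz a)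
  obtain ⟨p₀, hp₀, rfl⟩ := mem_component_iff.1 hF₀
  have h0 : p₀ ≠ 0 := by
    rintro rfl
    exact hne (by rw [zero_mul, map_zero])
  -- The inner product, as the form of the symbol 1, is the anisotropic form B; the form of b is B'.
  have hschur := (rotInvariant_symbolForm h1 isInvariantSymbol_one.planeRot).eq_smul hn
    (rotInvariant_symbolForm hb hinv.planeRot) (fun p hp hpp => by
      have h3 := eq_zero_of_eval_eq_zero_on_domain
        ((mem_harmonicPoly.1 hp).1.mul ((quad_isHomogeneous n).pow k.2))
        (symbolForm_one_self_eq_zero (by omega) hlam h1 hpp)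
      exact (mul_eq_zero.1 h3).resolve_right (pow_ne_zero _ (quad_ne_zero (by omega)))) hp₀ h0
    (c := c) fun q hq => by
      rw [← inner_polyL_toeplitz_polyL hb hab, ← inner_polyL]
      exact heig _ (mem_component_iff.2 ⟨q, hq, rfl⟩)
  refine ⟨c, fun F hF l G hG => ?_⟩
  obtain ⟨p, hp, rfl⟩ := mem_component_iff.1 hF
  obtain ⟨q, hq, rfl⟩ := mem_component_iff.1 hG
  rw [inner_polyL_toeplitz_polyL hb hab, inner_polyL]
  rcases eq_or_ne k l with rfl | hkl
  · exact hschur p hp q hq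
  · rw [hinv.symbolForm_eq_zero (by omega) hb hkl hp hq,
      isInvariantSymbol_one.symbolForm_eq_zero (by omega) h1 hkl hp hq, mul_zero]

/-- Circle invariance is part of being a moment map. Rotation invariance is not; it comes from the
explicit formula, up to a constant. -/
theorem IsMomentMapSO2.isInvariantSymbol (hn : n ≠ 0) {μ : (Fin n → ℂ) → ℝ}
    (hμ : IsMomentMapSO2 n μ) (f : ℝ → ℂ) : IsInvariantSymbol fun z => f (μ z) := by
  obtain ⟨c, hc⟩ := hμ.exists_eq_add hn
  refine ⟨fun t z hz => by simp only [hμ.equivariant t z hz], fun i j hij θ z hz => ?_⟩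
  simp only [hc _ hz, hc _ (planeRot_mem_domain hij θ hz), momentMapSO2, dot_planeRot hij,
    absSq_planeRot hij]

end Bergman

end CartanIV

end

/-! ### The theorem -/

theorem theorem5p1 (n : ℕ) (hn : 3 ≤ n) (lam : ℝ) (hlam : (n : ℝ) - 1 < lam) :
    IsMomentMapSO2 n (momentMapSO2 n) ∧
    IsHilbertSum ℂ (fun k : ℕ × ℕ => component n lam k)
      (fun k => (component n lam k).subtypeₗᵢ) ∧
    ∀ μ : (Fin n → ℂ) → ℝ, IsMomentMapSO2 n μ →
      (∀ S ∈ toeplitzAlgebra (momentMapSymbols n lam μ),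
        ∀ T ∈ toeplitzAlgebra (momentMapSymbols n lam μ), S * T = T * S) ∧
      ∀ f : ℝ → ℂ, Measurable f →
        ∀ hf : MemLp (fun z => f (μ z)) ⊤ (bergmanMeasure n lam),
          (∀ k : ℕ × ℕ, ∀ F ∈ component n lam k, toeplitz (hf.toLp _) F ∈ component n lam k) ∧
          ∃ c : ℕ × ℕ → ℂ, ∀ k : ℕ × ℕ, ∀ F ∈ component n lam k,
            toeplitz (hf.toLp _) F = c k • F := by
  have hn0 : n ≠ 0 := by omega
  have hn2 : 2 ≤ n := by omega
  refine ⟨isMomentMapSO2_momentMapSO2 hn0, isHilbertSum_of_orthogonal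
    (iSup_component_orthogonal hn2 hlam) (inner_component_eq_zero hn2), fun μ hμ => ⟨?_, ?_⟩⟩
  · intro S hS T hT
    refine mul_comm_of_mem_cstarAlgebraGenerated (iSup_component_orthogonal hn2 hlam)
      (inner_component_eq_zero hn2) ?_ hS hT
    rintro _ ⟨a, ⟨f, -, haf⟩, rfl⟩
    exact isDiagonal_toeplitz hn hlam ((memLp_congr_ae haf).1 (Lp.memLp a)) haf
      (hμ.isInvariantSymbol hn0 f)
  · intro f _ hf
    obtain ⟨c, hc⟩ := isDiagonal_toeplitz hn hlam hf (MemLp.coeFn_toLp hf)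
      (hμ.isInvariantSymbol hn0 f)
    refine ⟨fun k F hF => ?_, c, hc⟩
    rw [hc k F hF]
    exact Submodule.smul_mem _ _ hF
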